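/- \textbf{Theorem (exponential decay of sensitivity in the interior).} Let $\sigma,\lambda_A,\lambda_B,\lambda_C,\lambda_Q,\lambda_H,\lambda_R,\lambda_G,\lambda_W,\gamma_R,\gamma_Q,\alpha_0,\alpha_1,\beta_0,\beta_1>0$ be constants. Let $T>\sigma$ and consider, for parameters $d\in L^2([0,T];\mathbb R^{n_d})$, $d_0\in\mathbb R^{n_x}$, $d_T\in\mathbb R^{n_d}$, the problem $$\min_{u,x}\ \frac12\int_0^T\begin{bmatrix}x\\u\\d\end{bmatrix}^{\!\top}\begin{bmatrix}Q&H^\top&G^\top\\H&R&W^\top\\G&W&0\end{bmatrix}\begin{bmatrix}x\\u\\d\end{bmatrix}dt+\frac12\begin{bmatrix}x(T)\\d_T\end{bmatrix}^{\!\top}\begin{bmatrix}Q_T&G_T^\top\\G_T&0\end{bmatrix}\begin{bmatrix}x(T)\\d_T\end{bmatrix}$$ $$\text{s.t.}\quad \dot x=A x+B u+C d\ \text{ on }(0,T],\qquad x(0)=d_0,$$ over square-integrable controls $u$. The coefficients satisfy the following assumptions ($\|\cdot\|$ is the Euclidean or operator norm, $\preceq$ the order of symmetric matrices): (1) $A,B,C,Q,H,R,G,W$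 are continuous on $[0,T]$ with norms bounded by $\lambda_A,\lambda_B,\lambda_C,\lambda_Q,\lambda_H,\lambda_R,\lambda_G,\lambda_W$, and $\|G_T\|\le\lambda_G$. (2) Let $\Phi_A$ be the evolution operator of $\dot x=A(t)x$ and $\mathcal W(t_0,t_1)=\int_{t_0}^{t_1}\Phi_A(t_0,s)B(s)B(s)^\top\Phi_A(t_0,s)^\top ds$. For every $t_0\in[0,T-\sigma]$ there is $t_1\in[t_0,t_0+\sigma]$ with $\alpha_0I\preceq \mathcal W(t_0,t_1)\preceq\alpha_1I$ and $\beta_0I\preceq\Phi_A(t_1,t_0)\mathcal W(t_0,t_1)\Phi_A(t_1,t_0)^\top\preceq\beta_1I$. (3) $R(t)\succeq\gamma_RI$ and $Q(t)-H(t)^\top R(t)^{-1}H(t)\succeq\gamma_QI$ for all $t\in[0,T]$, and $\gamma_QI\preceq Q_T\preceq\lambda_QI$. \emph{Solutions.} Let $\mathcal H(t,x,u,\lambda;d)$ be the integrand of the cost (with the factor $\tfrac12$) plus $\lambda^\top(A(t)x+B(t)u+C(t)d)$. The solution $(x^*,u^*,\lambda^*)$ for $(d,d_0,d_T)$ is the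 optimal state and control, with the adjoint given by $\dot\lambda^*=-\nabla_x\mathcal H$, $\lambda^*(T)=Q_Tx^*(T)+G_T^\top d_T$, and with $u^*(t)$ minimizing $\mathcal H(t,x^*(t),\cdot,\lambda^*(t);d(t))$ for every $t\in[0,T]$. \emph{Perturbed solutions.} For $t'\in[0,T]$ and $l_{t'}\in\mathbb R^{n_d}$ let $d_p=d+l_{t'}\delta(\cdot-t')$, with $\delta(\cdot-t')$ the unit point mass at $t'$, counted fully also if $t'\in\{0,T\}$. The perturbed solution $(x_p^*,u_p^*,\lambda_p^*)$ solves the optimality system with $d$ replaced by the measure $d_p$: the state and adjoint equations and $Hx+Ru+B^\top\lambda+W^\top d_p=0$ hold as equations of measures on $[0,T]$, the control being a measure $u_p^*(t)\,dt+\eta\,\delta(\cdot-t')$. Here $x(0)=d_0$ is imposed before a jump at $t'=0$, and the terminal condition uses the value $x(T)$ after a jump at $t'=T$. \emph{Constants.} Put $\kappa=\lambda_A+\lambda_B\lambda_H/\gamma_R$ and $$\alpha_0'=\Big(\tfrac{2}{\alpha_0}+\tfrac{(\lambda_H/\gamma_R)^2}{\lambda_A}\big(1+\tfrac{\alpha_1}{\alpha_0}\big)^2(e^{2\lambda_A\sigma}-1)\Big)^{-1},\quad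 \alpha_1'=\tfrac{\lambda_B^2(e^{2\kappa\sigma}-1)}{2\kappa},\quad \tilde\alpha_0=\tfrac{1-e^{-2\kappa\sigma}}{2\kappa},\quad \tilde\alpha_1=\tfrac{e^{2\kappa\sigma}-1}{2\kappa},$$ $$c_0=e^{-2\kappa\sigma}\min\Big\{2\kappa\Big(\tfrac{\lambda_B^2}{\gamma_R}\big(1+\tfrac{\tilde\alpha_1}{\tilde\alpha_0}\big)^2+\tfrac1{\gamma_Q\tilde\alpha_0^2}\Big)^{-1},\Big(\tfrac{\lambda_B^2}{2\gamma_R\kappa}+\tfrac1{\gamma_Q}\Big)^{-1}\Big\},$$ $$c_1=e^{2\kappa\sigma}\max\Big\{\Big(\big(\lambda_Q+\tfrac{\lambda_H^2}{\gamma_R}\big)\big(1+\tfrac{\alpha_1'}{\alpha_0'}\big)^2+\tfrac{\lambda_R\lambda_B^2}{(\alpha_0')^2}\Big)\tfrac1{2\kappa},\ \big(\lambda_Q+\tfrac{\lambda_H^2}{\gamma_R}\big)\big(1+\tfrac1{2\kappa}\big)\Big\},$$ $$c_Z=\sqrt{c_1/c_0},\qquad \rho_Z(\sigma)=\frac{\gamma_Q}{2c_1},\qquad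 c_v=c_Z\Big(\big(\tfrac{\lambda_W\lambda_B}{\gamma_R}+\lambda_C\big)c_1+\tfrac{\lambda_W\lambda_H}{\gamma_R}+\lambda_G\Big),$$ $$\Lambda_x=c_Z\Big(\tfrac{c_v\lambda_B^2}{2\rho_Z\gamma_R}+\tfrac{\lambda_W\lambda_B}{\gamma_R}+\lambda_C\Big),\qquad \Lambda(\sigma)=\Big(1+\tfrac{\lambda_H}{\gamma_R}+c_1\big(1+\tfrac{\lambda_B}{\gamma_R}\big)\Big)\Lambda_x+c_v\big(1+\tfrac{\lambda_B}{\gamma_R}\big).$$ \emph{Conclusion.} $\rho_Z(\sigma)>0$ and $\Lambda(\sigma)>0$ (neither depends on $T$); the solution for $(d,d_0,d_T)$ exists and is unique on $[0,T]$, and the perturbed solution exists and is unique at all times $t\ne t'$. At every $t\neq t'$ the perturbed solution is the limit of the solutions for the parameters $(d+l_{t'}\varphi_n,d_0,d_T)$, whenever $\varphi_n\in L^2([0,T])$, $\varphi_n\ge0$, $\int_0^T\varphi_n=1$, and for each $\varepsilon>0$ the functions $\varphi_n$ vanish on $\{t\in[0,T]:|t-t'|\ge\varepsilon\}$ for all large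 $n$. Moreover, with $\delta x=x_p^*-x^*$, $\delta u=u_p^*-u^*$, $\delta\lambda=\lambda_p^*-\lambda^*$, $$\|\delta x(t)\|+\|\delta u(t)\|+\|\delta\lambda(t)\|\le\|l_{t'}\|\,\Lambda(\sigma)\,e^{-\rho_Z(\sigma)|t-t'|}\qquad\text{for all } t\in[0,T],\ t\neq t'.$$ -/

import Mathlib

open Set MeasureTheory Filter Topology
open scoped InnerProduct

namespace LQ

/-- `ℝⁿ` with the Euclidean norm. -/
abbrev Vec (n : ℕ) : Type := EuclideanSpace ℝ (Fin n)

/-- Real `m × n` matrices, as linear maps `ℝⁿ → ℝᵐ` with the operator norm; the transpose is the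
adjoint `†`, and `≤` on square matrices is the Loewner order (`M ≤ N` iff `N - M` is symmetric
positive semidefinite). -/
abbrev Mat (m n : ℕ) : Type := Vec n →L[ℝ] Vec m

/-! ### Evolution operator of a linear system -/

/-- `Φ t s` is the evolution operator of `x' = A(t) x` on `[0,T]`:
`∂ₜ Φ(t,s) = A(t) Φ(t,s)`, `Φ(s,s) = I`, for all `s, t ∈ [0,T]` (in either order). -/
def IsEvolution {n : ℕ} (T : ℝ) (A : ℝ → Mat n n) (Φ : ℝ → ℝ → Mat n n) : Prop :=
  ∀ s ∈ Icc 0 T, Φ s s = 1 ∧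
    ∀ t ∈ Icc 0 T, HasDerivWithinAt (fun r => Φ r s) (A t ∘L Φ t s) (Icc 0 T) t

/-- Terms of the Peano--Baker series. -/
noncomputable def peanoBaker {n : ℕ} (A : ℝ → Mat n n) (s : ℝ) : ℕ → ℝ → Mat n n
  | 0 => fun _ => 1
  | k + 1 => fun t => ∫ r in s..t, A r ∘L peanoBaker A s k r

/-- The evolution operator `Φ_A` on `[0,T]`. -/
noncomputable def evolution {n : ℕ} (T : ℝ) (A : ℝ → Mat n n) : ℝ → ℝ → Mat n n :=
  Classical.epsilon (IsEvolution T A)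

theorem peanoBaker_continuous {n : ℕ} {A : ℝ → Mat n n} (hA : Continuous A) (s : ℝ) (k : ℕ) :
    Continuous (peanoBaker A s k) := by
  induction k with
  | zero => exact continuous_const
  | succ k ih =>
    have h : Continuous fun r => A r ∘L peanoBaker A s k r := hA.clm_comp ih
    exact intervalIntegral.continuous_primitive (fun a b => h.intervalIntegrable a b) s

theorem peanoBaker_hasDerivAt {n : ℕ} {A : ℝ → Mat n n} (hA : Continuous A) (s : ℝ) (k : ℕ)
    (t : ℝ) : HasDerivAt (peanoBaker A s (k + 1)) (A t ∘L peanoBaker A s k t) t := by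
  have h : Continuous fun r => A r ∘L peanoBaker A s k r :=
    hA.clm_comp (peanoBaker_continuous hA s k)
  exact intervalIntegral.integral_hasDerivAt_right (h.intervalIntegrable _ _)
    (h.stronglyMeasurableAtFilter _ _) h.continuousAt

theorem peanoBaker_norm_le {n : ℕ} {A : ℝ → Mat n n} {K : ℝ}
    (hK : ∀ t, ‖A t‖ ≤ K) (s : ℝ) (k : ℕ) (t : ℝ) :
    ‖peanoBaker A s k t‖ ≤ (K * |t - s|) ^ k / (k.factorial : ℝ) := by
  have hK0 : 0 ≤ K := (norm_nonneg _).trans (hK 0)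
  induction k generalizing t with
  | zero =>
    have h1 : ‖(1 : Mat n n)‖ ≤ 1 := ContinuousLinearMap.norm_id_le
    simpa [peanoBaker] using h1
  | succ k ih =>
    have key : ∀ r, ‖A r ∘L peanoBaker A s k r‖ ≤ K * ((K * |r - s|) ^ k / (k.factorial : ℝ)) :=
      fun r => (ContinuousLinearMap.opNorm_comp_le _ _).trans
        (mul_le_mul (hK r) (ih r) (norm_nonneg _) hK0)
    have hint : ∀ a b : ℝ, IntervalIntegrable
        (fun r => K * ((K * |r - s|) ^ k / (k.factorial : ℝ))) volume a b := fun a b =>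
      Continuous.intervalIntegrable (by fun_prop) a b
    have hf : (((k + 1).factorial : ℕ) : ℝ) = (k + 1) * (k.factorial : ℝ) := by
      push_cast [Nat.factorial_succ]; ring
    have hk : (k.factorial : ℝ) ≠ 0 := by positivity
    have hk1 : (k : ℝ) + 1 ≠ 0 := by positivity
    change ‖∫ r in s..t, A r ∘L peanoBaker A s k r‖ ≤ _
    rcases le_total s t with h | h
    · refine (intervalIntegral.norm_integral_le_of_norm_le h
        (Eventually.of_forall fun r _ => key r) (hint s t)).trans (le_of_eq ?_)
      have e : ∀ r ∈ uIcc s t, K * ((K * |r - s|) ^ k / (k.factorial : ℝ))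
          = K ^ (k + 1) / (k.factorial : ℝ) * (r - s) ^ k := by
        intro r hr
        rw [uIcc_of_le h] at hr
        rw [abs_of_nonneg (by linarith [hr.1]), mul_pow]; ring
      rw [intervalIntegral.integral_congr e, intervalIntegral.integral_const_mul,
        intervalIntegral.integral_comp_sub_right (fun x => x ^ k), integral_pow, hf,
        abs_of_nonneg (by linarith)]
      simp [mul_pow]; field_simp
    · rw [intervalIntegral.integral_symm, norm_neg]
      refine (intervalIntegral.norm_integral_le_of_norm_le h
        (Eventually.of_forall fun r _ => key r) (hint t s)).trans (le_of_eq ?_)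
      have e : ∀ r ∈ uIcc t s, K * ((K * |r - s|) ^ k / (k.factorial : ℝ))
          = K ^ (k + 1) / (k.factorial : ℝ) * (s - r) ^ k := by
        intro r hr
        rw [uIcc_of_le h] at hr
        rw [abs_of_nonpos (by linarith [hr.2]), mul_pow]; ring
      rw [intervalIntegral.integral_congr e, intervalIntegral.integral_const_mul,
        intervalIntegral.integral_comp_sub_left (fun x => x ^ k), integral_pow, hf,
        abs_of_nonpos (by linarith)]
      simp [mul_pow]; field_simp

/-- A continuous linear system has an evolution operator. -/
theorem exists_isEvolution {n : ℕ} {T : ℝ} (hT : 0 < T) {A : ℝ → Mat n n}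
    (hA : ContinuousOn A (Icc 0 T)) : ∃ Φ, IsEvolution T A Φ := by
  set A' : ℝ → Mat n n := fun t => A (projIcc 0 T hT.le t) with hA'
  have hc : Continuous A' :=
    (continuousOn_iff_continuous_domRestrict.1 hA).comp continuous_projIcc
  have heq : ∀ t ∈ Icc 0 T, A' t = A t := fun t ht => by
    simp only [hA', projIcc_of_mem hT.le ht]
  obtain ⟨K, hK⟩ := isCompact_Icc.exists_bound_of_continuousOn hA
  have hK' : ∀ t, ‖A' t‖ ≤ K := fun t => hK _ (projIcc 0 T hT.le t).2
  have hK0 : 0 ≤ K := (norm_nonneg _).trans (hK' 0)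
  refine ⟨fun t s => ∑' k, peanoBaker A' s k t, fun s hs => ⟨?_, fun t ht => ?_⟩⟩
  · change (∑' k, peanoBaker A' s k s) = 1
    rw [tsum_eq_single 0]
    · rfl
    · intro k hk
      obtain ⟨m, rfl⟩ := Nat.exists_eq_succ_of_ne_zero hk
      simp [peanoBaker]
  · set u : ℕ → ℝ := fun k => K * ((K * (2 * T)) ^ k / (k.factorial : ℝ))
    have hu : Summable u := (Real.summable_pow_div_factorial _).mul_left K
    have hmem : ∀ y ∈ Ioo (s - 2 * T) (s + 2 * T), |y - s| ≤ 2 * T := fun y hy =>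
      abs_le.2 ⟨by linarith [hy.1], by linarith [hy.2]⟩
    have hsum : ∀ y, Summable fun k => peanoBaker A' s k y := fun y =>
      Summable.of_norm_bounded (Real.summable_pow_div_factorial (K * |y - s|))
        (fun k => peanoBaker_norm_le hK' s k y)
    have hts : t ∈ Ioo (s - 2 * T) (s + 2 * T) :=
      ⟨by linarith [ht.1, hs.2], by linarith [ht.2, hs.1]⟩
    have hsum1 : Summable fun k => peanoBaker A' s (k + 1) t :=
      (summable_nat_add_iff (f := fun k => peanoBaker A' s k t) 1).2 (hsum t)
    have hd : HasDerivAt (fun y => ∑' k, peanoBaker A' s (k + 1) y)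
        (∑' k, A' t ∘L peanoBaker A' s k t) t :=
      hasDerivAt_tsum_of_isPreconnected hu isOpen_Ioo isPreconnected_Ioo
        (fun k y _ => peanoBaker_hasDerivAt hc s k y)
        (fun k y hy => (ContinuousLinearMap.opNorm_comp_le _ _).trans
          (mul_le_mul (hK' y) ((peanoBaker_norm_le hK' s k y).trans
            (by
              have := hmem y hy
              gcongr)) (norm_nonneg _) hK0)) hts
        hsum1 hts
    have e1 : (fun y => ∑' k, peanoBaker A' s k y)
        = fun y => 1 + ∑' k, peanoBaker A' s (k + 1) y := by
      funext y
      rw [(hsum y).tsum_eq_zero_add]; rfl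
    have e2 : (∑' k, A' t ∘L peanoBaker A' s k t) = A t ∘L ∑' k, peanoBaker A' s k t := by
      rw [heq t ht]
      have h1 : HasSum (fun k => A t * peanoBaker A' s k t) (A t * ∑' k, peanoBaker A' s k t) :=
        (hsum t).hasSum.mul_left (A t)
      exact h1.tsum_eq
    rw [e2] at hd
    simp only [e1] at hd ⊢
    exact (hd.const_add 1).hasDerivWithinAt

theorem evolution_spec {n : ℕ} {T : ℝ} (hT : 0 < T) {A : ℝ → Mat n n}
    (hA : ContinuousOn A (Icc 0 T)) : IsEvolution T A (evolution T A) :=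
  Classical.epsilon_spec (exists_isEvolution hT hA)

/-- The controllability Gramian
`W_{A,B}(t₀,t₁) = ∫_{t₀}^{t₁} Φ_A(t₀,s) B(s) B(s)ᵀ Φ_A(t₀,s)ᵀ ds`. -/
noncomputable def gramian {n m : ℕ} (T : ℝ) (A : ℝ → Mat n n) (B : ℝ → Mat n m) (t₀ t₁ : ℝ) :
    Mat n n :=
  ∫ s in t₀..t₁, evolution T A t₀ s ∘L B s ∘L (B s)† ∘L (evolution T A t₀ s)†

/-! ### The parameterized linear-quadratic problem -/

/-- The coefficients of the problem. Only their values on `[0,T]` matter. -/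
structure Data (nx nu nd : ℕ) where
  /-- system matrix -/
  A : ℝ → Mat nx nx
  /-- control matrix -/
  B : ℝ → Mat nx nu
  /-- parameter matrix in the dynamics -/
  C : ℝ → Mat nx nd
  /-- state cost -/
  Q : ℝ → Mat nx nx
  /-- cross cost -/
  H : ℝ → Mat nu nx
  /-- control cost -/
  R : ℝ → Mat nu nu
  /-- parameter-state cost -/
  G : ℝ → Mat nd nx
  /-- parameter-control cost -/
  W : ℝ → Mat nd nu
  /-- terminal state cost -/
  QT : Mat nx nx
  /-- terminal parameter-state cost -/
  GT : Mat nd nx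

/-- The constants of the standing assumptions; none of them refers to the horizon `T`. -/
structure Constants where
  /-- length of the controllability window -/
  sigma : ℝ
  /-- bound of `A` -/
  lamA : ℝ
  /-- bound of `B` -/
  lamB : ℝ
  /-- bound of `Q` and `Q_T` -/
  lamQ : ℝ
  /-- bound of `H` -/
  lamH : ℝ
  /-- bound of `R` -/
  lamR : ℝ
  /-- bound of `G` and `G_T` -/
  lamG : ℝ
  /-- bound of `W` -/
  lamW : ℝ
  /-- bound of `C` -/
  lamC : ℝ
  /-- coercivity of `R` -/
  gamR : ℝ
  /-- coercivity of `Q - Hᵀ R⁻¹ H` and `Q_T` -/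
  gamQ : ℝ
  /-- lower bound of the Gramian -/
  alpha0 : ℝ
  /-- upper bound of the Gramian -/
  alpha1 : ℝ
  /-- lower bound of the transported Gramian -/
  beta0 : ℝ
  /-- upper bound of the transported Gramian -/
  beta1 : ℝ
  sigma_pos : 0 < sigma
  lamA_pos : 0 < lamA
  lamB_pos : 0 < lamB
  lamQ_pos : 0 < lamQ
  lamH_pos : 0 < lamH
  lamR_pos : 0 < lamR
  lamG_pos : 0 < lamG
  lamW_pos : 0 < lamW
  lamC_pos : 0 < lamC
  gamR_pos : 0 < gamR
  gamQ_pos : 0 < gamQ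
  alpha0_pos : 0 < alpha0
  alpha1_pos : 0 < alpha1
  beta0_pos : 0 < beta0
  beta1_pos : 0 < beta1

/-- The standing assumptions on the horizon `T` and the coefficients: continuity and boundedness,
uniform complete controllability, coercivity. -/
structure Assumptions {nx nu nd : ℕ} (k : Constants) (T : ℝ) (D : Data nx nu nd) : Prop where
  sigma_lt : k.sigma < T
  contA : ContinuousOn D.A (Icc 0 T)
  contB : ContinuousOn D.B (Icc 0 T)
  contC : ContinuousOn D.C (Icc 0 T)
  contQ : ContinuousOn D.Q (Icc 0 T)
  contH : ContinuousOn D.H (Icc 0 T)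
  contR : ContinuousOn D.R (Icc 0 T)
  contG : ContinuousOn D.G (Icc 0 T)
  contW : ContinuousOn D.W (Icc 0 T)
  boundA : ∀ t ∈ Icc 0 T, ‖D.A t‖ ≤ k.lamA
  boundB : ∀ t ∈ Icc 0 T, ‖D.B t‖ ≤ k.lamB
  boundC : ∀ t ∈ Icc 0 T, ‖D.C t‖ ≤ k.lamC
  boundQ : ∀ t ∈ Icc 0 T, ‖D.Q t‖ ≤ k.lamQ
  boundH : ∀ t ∈ Icc 0 T, ‖D.H t‖ ≤ k.lamH
  boundR : ∀ t ∈ Icc 0 T, ‖D.R t‖ ≤ k.lamR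
  boundG : ∀ t ∈ Icc 0 T, ‖D.G t‖ ≤ k.lamG
  boundW : ∀ t ∈ Icc 0 T, ‖D.W t‖ ≤ k.lamW
  boundGT : ‖D.GT‖ ≤ k.lamG
  controllable : ∀ t₀ ∈ Icc 0 (T - k.sigma), ∃ t₁ ∈ Icc t₀ (t₀ + k.sigma),
    k.alpha0 • (1 : Mat nx nx) ≤ gramian T D.A D.B t₀ t₁ ∧
    gramian T D.A D.B t₀ t₁ ≤ k.alpha1 • (1 : Mat nx nx) ∧
    k.beta0 • (1 : Mat nx nx) ≤
      evolution T D.A t₁ t₀ ∘L gramian T D.A D.B t₀ t₁ ∘L (evolution T D.A t₁ t₀)† ∧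
    evolution T D.A t₁ t₀ ∘L gramian T D.A D.B t₀ t₁ ∘L (evolution T D.A t₁ t₀)† ≤
      k.beta1 • (1 : Mat nx nx)
  coerciveR : ∀ t ∈ Icc 0 T, k.gamR • (1 : Mat nu nu) ≤ D.R t
  coerciveQ : ∀ t ∈ Icc 0 T,
    k.gamQ • (1 : Mat nx nx) ≤ D.Q t - (D.H t)† ∘L (D.R t).inverse ∘L D.H t
  coerciveQT : k.gamQ • (1 : Mat nx nx) ≤ D.QT
  boundQT : D.QT ≤ k.lamQ • (1 : Mat nx nx)

namespace Constants

variable (k : Constants)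

/-- Bound of the shifted system matrix `A - B R⁻¹ H`. -/
noncomputable def kappa : ℝ := k.lamA + k.lamB * k.lamH / k.gamR

/-- `α₀'(σ)`, lower Gramian bound of the pair `(A - B R⁻¹ H, B)`. -/
noncomputable def alpha0' : ℝ :=
  (2 / k.alpha0 + (k.lamH / k.gamR) ^ 2 / k.lamA * (1 + k.alpha1 / k.alpha0) ^ 2 *
    (Real.exp (2 * k.lamA * k.sigma) - 1))⁻¹

/-- `α₁'(σ)`, upper Gramian bound of the pair `(A - B R⁻¹ H, B)`. -/
noncomputable def alpha1' : ℝ :=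
  k.lamB ^ 2 * (Real.exp (2 * k.sigma * k.kappa) - 1) / (2 * k.kappa)

/-- `α̃₀(σ)`, lower Gramian bound of the dual pair. -/
noncomputable def alphaDual0 : ℝ := 1 / (2 * k.kappa) * (1 - Real.exp (-2 * k.kappa * k.sigma))

/-- `α̃₁(σ)`, upper Gramian bound of the dual pair. -/
noncomputable def alphaDual1 : ℝ := 1 / (2 * k.kappa) * (Real.exp (2 * k.kappa * k.sigma) - 1)

/-- `c₀(σ)`, lower bound of the Riccati matrix. -/
noncomputable def c0 : ℝ :=
  min
    (2 * k.kappa * (k.lamB ^ 2 / k.gamR * (1 + k.alphaDual1 / k.alphaDual0) ^ 2 +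
      1 / (k.gamQ * k.alphaDual0 ^ 2))⁻¹)
    (k.lamB ^ 2 / (2 * k.gamR * k.kappa) + 1 / k.gamQ)⁻¹ *
  Real.exp (-2 * k.kappa * k.sigma)

/-- `c₁(σ)`, upper bound of the Riccati matrix. -/
noncomputable def c1 : ℝ :=
  max
    (((k.lamQ + k.lamH ^ 2 / k.gamR) * (1 + k.alpha1' / k.alpha0') ^ 2 +
      k.lamR * k.lamB ^ 2 / k.alpha0' ^ 2) * (1 / (2 * k.kappa)))
    ((k.lamQ + k.lamH ^ 2 / k.gamR) * (1 + 1 / (2 * k.kappa))) *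
  Real.exp (2 * k.kappa * k.sigma)

/-- `c_Z(σ)`. -/
noncomputable def cZ : ℝ := √(k.c1 / k.c0)

/-- The decay rate `ρ_Z(σ)`. -/
noncomputable def rhoZ : ℝ := k.gamQ / (2 * k.c1)

/-- `c_v(σ)`. -/
noncomputable def cv : ℝ :=
  k.cZ * ((k.lamW * k.lamB / k.gamR + k.lamC) * k.c1 + k.lamW * k.lamH / k.gamR + k.lamG)

/-- `Λ_x(σ)`. -/
noncomputable def LambdaX : ℝ :=
  k.cZ * (k.cv * k.lamB ^ 2 / (2 * k.rhoZ * k.gamR) + k.lamW * k.lamB / k.gamR + k.lamC)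

/-- The sensitivity constant `Λ(σ)`. -/
noncomputable def Lambda : ℝ :=
  (1 + k.lamH / k.gamR + k.c1 * (1 + k.lamB / k.gamR)) * k.LambdaX +
    k.cv * (1 + k.lamB / k.gamR)

end Constants

/-! ### Optimal solutions -/

/-- A triple (state, control, adjoint) of trajectories; only values on `[0,T]` matter. -/
structure Trajectory (nx nu : ℕ) where
  /-- state -/
  x : ℝ → Vec nx
  /-- control -/
  u : ℝ → Vec nu
  /-- adjoint -/
  lam : ℝ → Vec nx

/-- Two triples agree on a set of times. -/
def Trajectory.AgreeOn {nx nu : ℕ} (z z' : Trajectory nx nu) (s : Set ℝ) : Prop :=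
  EqOn z.x z'.x s ∧ EqOn z.u z'.u s ∧ EqOn z.lam z'.lam s

section Problem

variable {nx nu nd : ℕ} (D : Data nx nu nd) (T : ℝ)

/-- The running cost: the quadratic form
`½ [x;u;d]ᵀ [[Q, Hᵀ, Gᵀ], [H, R, Wᵀ], [G, W, 0]] [x;u;d]` at time `t`. -/
noncomputable def runningCost (t : ℝ) (x : Vec nx) (u : Vec nu) (d : Vec nd) : ℝ :=
  (1 / 2) * (inner ℝ x (D.Q t x + ((D.H t)†) u + ((D.G t)†) d)
    + inner ℝ u (D.H t x + D.R t u + ((D.W t)†) d)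
    + inner ℝ d (D.G t x + D.W t u))

/-- The terminal cost: the quadratic form `½ [x;e]ᵀ [[Q_T, G_Tᵀ], [G_T, 0]] [x;e]`. -/
noncomputable def terminalCost (x : Vec nx) (e : Vec nd) : ℝ :=
  (1 / 2) * (inner ℝ x (D.QT x + (D.GT†) e) + inner ℝ e (D.GT x))

/-- The Hamiltonian. -/
noncomputable def hamiltonian (t : ℝ) (x : Vec nx) (u : Vec nu) (lam : Vec nx) (d : Vec nd) : ℝ :=
  runningCost D t x u d + inner ℝ lam (D.A t x + D.B t u + D.C t d)

/-- The cost functional. -/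
noncomputable def cost (d : ℝ → Vec nd) (dT : Vec nd) (x : ℝ → Vec nx) (u : ℝ → Vec nu) : ℝ :=
  (∫ t in (0 : ℝ)..T, runningCost D t (x t) (u t) (d t)) + terminalCost D (x T) dT

/-- `(x,u)` is admissible: `u` is square-integrable and `x` is the (Carathéodory) solution of
`x' = A x + B u + C d`, `x(0) = d₀`. -/
def Admissible (d : ℝ → Vec nd) (d0 : Vec nx) (x : ℝ → Vec nx) (u : ℝ → Vec nu) : Prop :=
  MemLp u 2 (volume.restrict (Icc 0 T)) ∧ ContinuousOn x (Icc 0 T) ∧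
    ∀ t ∈ Icc 0 T, x t = d0 + ∫ s in (0 : ℝ)..t, (D.A s (x s) + D.B s (u s) + D.C s (d s))

/-- `z` consists of an optimal state and control for the parameters `(d, d₀, d_T)`, with the
adjoint `λ' = -∇ₓ ℋ`, `λ(T) = Q_T x(T) + G_Tᵀ d_T` (the gradient of the terminal cost), the control
being represented by the function which minimizes the Hamiltonian at every time. -/
def IsOptimalTriple (d : ℝ → Vec nd) (d0 : Vec nx) (dT : Vec nd) (z : Trajectory nx nu) : Prop :=
  Admissible D T d d0 z.x z.u ∧
  (∀ x u, Admissible D T d d0 x u → cost D T d dT z.x z.u ≤ cost D T d dT x u) ∧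
  ContinuousOn z.lam (Icc 0 T) ∧
  (∀ t ∈ Icc 0 T, z.lam t = D.QT (z.x T) + (D.GT†) dT +
    ∫ s in t..T, (((D.A s)†) (z.lam s) + D.Q s (z.x s) + ((D.H s)†) (z.u s) + ((D.G s)†) (d s))) ∧
  ∀ t ∈ Icc 0 T, ∀ w : Vec nu,
    hamiltonian D t (z.x t) (z.u t) (z.lam t) (d t) ≤ hamiltonian D t (z.x t) w (z.lam t) (d t)

/-- `z` is the solution for the parameters `(d + l δ_{t'}, d₀, d_T)`, where `δ_{t'}` is the unit
point mass at `t'`: the optimality system (state equation, adjoint equation, stationarity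
`H x + R u + Bᵀ λ + Wᵀ d = 0` of the Hamiltonian in the control) with `d` replaced by the vector
measure `d dt + l δ_{t'}`. The control is then a measure `u dt + η δ_{t'}`, whose atom `η` is
determined by the stationarity condition at the atom, and `x` and `λ` jump at `t'`. The function
`z.u` is the density of the control, that is, the control at the times `t ≠ t'`. -/
def IsPerturbedTriple (d : ℝ → Vec nd) (d0 : Vec nx) (dT : Vec nd) (t' : ℝ) (l : Vec nd)
    (z : Trajectory nx nu) : Prop :=
  IntervalIntegrable z.x volume 0 T ∧ IntervalIntegrable z.u volume 0 T ∧
  IntervalIntegrable z.lam volume 0 T ∧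
  ∃ η : Vec nu, D.R t' η + ((D.W t')†) l = 0 ∧
    (∀ t ∈ Icc 0 T, z.x t = d0 +
      (∫ s in (0 : ℝ)..t, (D.A s (z.x s) + D.B s (z.u s) + D.C s (d s))) +
      if t' ≤ t then D.B t' η + D.C t' l else 0) ∧
    (∀ t ∈ Icc 0 T, z.lam t = D.QT (z.x T) + (D.GT†) dT +
      (∫ s in t..T, (((D.A s)†) (z.lam s) + D.Q s (z.x s) + ((D.H s)†) (z.u s) + ((D.G s)†) (d s))) +
      if t < t' then ((D.H t')†) η + ((D.G t')†) l else 0) ∧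
    ∀ t ∈ Icc 0 T, t ≠ t' → ∀ w : Vec nu,
      hamiltonian D t (z.x t) (z.u t) (z.lam t) (d t) ≤ hamiltonian D t (z.x t) w (z.lam t) (d t)

end Problem

/-- `φ n` is a sequence of square-integrable approximations on `[0,T]` of the unit point mass at
`t'`: nonnegative, of integral one, and vanishing eventually away from `t'`. -/
def ApproximatesDirac (T t' : ℝ) (φ : ℕ → ℝ → ℝ) : Prop :=
  (∀ n, MemLp (φ n) 2 (volume.restrict (Icc 0 T))) ∧
  (∀ n, ∀ t ∈ Icc 0 T, 0 ≤ φ n t) ∧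
  (∀ n, ∫ t in (0 : ℝ)..T, φ n t = 1) ∧
  ∀ ε > 0, ∀ᶠ n in atTop, ∀ t ∈ Icc 0 T, ε ≤ |t - t'| → φ n t = 0

end LQ

/-! Minimality of the Hamiltonian means `u = -R⁻¹(Hx + Bᵀλ + Wᵀd)`. Eliminating the control turns
the optimality system into a linear Hamiltonian boundary value problem `x' = Fx - Nλ + Ed`, `λ' =
-Fᵀλ - Kx - Jd`, with `x` given at `0` and `λ - Q_T x` given at `T`. Here `F = A - BR⁻¹H`, `N =
BR⁻¹Bᵀ ⪰ 0` and `K = Q - HᵀR⁻¹H ⪰ γ_Q`. A point mass `l δ_{t'}` in `d` becomes a jump `E(t')l` of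
`x` and `-J(t')l` of `λ`. The difference of the perturbed and the unperturbed solution therefore
solves the homogeneous system with zero boundary data and these two jumps.

Decoupling. Along homogeneous solutions `⟨x,λ⟩` decreases at the rate `⟨x,Kx⟩ + ⟨λ,Nλ⟩`. If `X`, `L`
are the operator solutions with `X(T) = 1`, `L(T) = Q_T`, this makes `X` invertible, with inverse
`Y`, and `LY` is the symmetric Riccati matrix (`exists_isFundamental`). For an inhomogeneous
solution, `Xᵀλ - Lᵀx` is a primitive of the data alone, and then so is `Yx` (`bvpR_eq`, `eq_bvpW`).
The resulting formula yields existence and uniqueness and, by dominated convergence, the limit for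
approximate point masses (`tendsto_zero`). Convexity of the cost identifies the solution of the
system with the optimum.

Decay. Everything rests on `c₀‖x‖² ≤ ⟨x,λ⟩ ≤ c₁‖x‖²` with constants independent of `T`
(`value_bounds`). The form is then a Lyapunov function of the closed loop, whose propagator
`X(t)Y(s)` is bounded by `c_Z exp(-ρ(t-s))` (`norm_le_exp`). The upper bound is the cost of one
explicit trajectory: it is steered to the origin within a controllability window by means of the
Gramian, or left uncontrolled if less than `σ` of the horizon remains. The lower bound comes from
explicit trajectories of the dual problem.

A source at `t'` acts on the adjoint backwards in time through the transposed propagator, and from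
there on the state forwards in time. The convolution of the two exponentials over `s ≤ min t t'`
decays like `exp(-ρ|t-t'|)` (`decay`). -/

namespace LQ

/-! ### One-dimensional calculus -/

section Calculus

variable {E F G : Type*} [NormedAddCommGroup E] [NormedSpace ℝ E] [NormedAddCommGroup F]
  [NormedSpace ℝ F] [NormedAddCommGroup G] [NormedSpace ℝ G]

theorem le_of_hasDerivWithinAt_nonneg {a b : ℝ} (hab : a ≤ b) {f f' : ℝ → ℝ}
    (hf : ∀ t ∈ Icc a b, HasDerivWithinAt f (f' t) (Icc a b) t) (h0 : ∀ t ∈ Icc a b, 0 ≤ f' t) :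
    f a ≤ f b := by
  refine monotoneOn_of_hasDerivWithinAt_nonneg (convex_Icc a b) (f' := f')
    (fun t ht => (hf t ht).continuousWithinAt) (fun t ht => ?_) (fun t ht => ?_)
    (left_mem_Icc.2 hab) (right_mem_Icc.2 hab) hab
  · exact (hf t (interior_subset ht)).mono interior_subset
  · exact h0 t (interior_subset ht)

/-- A bound for the growth of a function whose derivative is at most proportional to it. -/
theorem norm_le_exp_of_norm_deriv_le {V : Type*} [NormedAddCommGroup V] [InnerProductSpace ℝ V]
    {a b κ : ℝ} (hab : a ≤ b) {y y' : ℝ → V}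
    (hy : ∀ t ∈ Icc a b, HasDerivWithinAt y (y' t) (Icc a b) t)
    (hb : ∀ t ∈ Icc a b, ‖y' t‖ ≤ κ * ‖y t‖) : ‖y b‖ ≤ Real.exp (κ * (b - a)) * ‖y a‖ := by
  -- The function `exp(-2κ(t-a))‖y‖²` is nonincreasing. The square of the norm is used because the
  -- norm itself need not be differentiable where `y` vanishes.
  have h1 : ∀ t ∈ Icc a b, HasDerivWithinAt
      (fun t => -(Real.exp (-(2 * κ) * (t - a)) * inner ℝ (y t) (y t)))
      (-(Real.exp (-(2 * κ) * (t - a)) * (-(2 * κ)) * inner ℝ (y t) (y t) +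
        Real.exp (-(2 * κ) * (t - a)) * (inner ℝ (y t) (y' t) + inner ℝ (y' t) (y t))))
      (Icc a b) t := by
    intro t ht
    have h2 : HasDerivAt (fun t => Real.exp (-(2 * κ) * (t - a)))
        (Real.exp (-(2 * κ) * (t - a)) * (-(2 * κ))) t := by
      have := (((hasDerivAt_id t).sub_const a).const_mul (-(2 * κ))).exp
      simpa using this
    exact (h2.hasDerivWithinAt.mul ((hy t ht).inner ℝ (hy t ht))).neg
  have h3 := le_of_hasDerivWithinAt_nonneg hab h1 (fun t ht => by
    have e1 : inner ℝ (y t) (y' t) ≤ κ * ‖y t‖ ^ 2 := by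
      refine (real_inner_le_norm _ _).trans ?_
      nlinarith [hb t ht, norm_nonneg (y t)]
    rw [real_inner_comm (y t) (y' t), real_inner_self_eq_norm_sq]
    have := Real.exp_pos (-(2 * κ) * (t - a))
    nlinarith)
  simp only [sub_self, mul_zero, Real.exp_zero, one_mul, neg_le_neg_iff,
    real_inner_self_eq_norm_sq] at h3
  refine abs_le_of_sq_le_sq' (b := Real.exp (κ * (b - a)) * ‖y a‖) ?_ (by positivity) |>.2
  have h4 : Real.exp (-(2 * κ) * (b - a)) * (Real.exp (κ * (b - a))) ^ 2 = 1 := by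
    rw [← Real.exp_nat_mul, ← Real.exp_add]
    simp; ring
  calc ‖y b‖ ^ 2 = (Real.exp (-(2 * κ) * (b - a)) * ‖y b‖ ^ 2) * (Real.exp (κ * (b - a))) ^ 2 := by
        linear_combination (-‖y b‖ ^ 2) * h4
    _ ≤ ‖y a‖ ^ 2 * (Real.exp (κ * (b - a))) ^ 2 := by gcongr
    _ = _ := by ring

theorem eq_of_hasDerivWithinAt_zero {a b : ℝ} {f : ℝ → E}
    (hf : ∀ t ∈ Icc a b, HasDerivWithinAt f 0 (Icc a b) t) {s t : ℝ} (hs : s ∈ Icc a b)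
    (ht : t ∈ Icc a b) : f s = f t := by
  have h := (convex_Icc a b).norm_image_sub_le_of_norm_hasDerivWithin_le (C := 0)
    (fun x hx => hf x hx) (by simp) ht hs
  simpa [sub_eq_zero] using h

/-- The operator-valued fundamental solution of a continuous linear differential equation. -/
theorem exists_fundamental [FiniteDimensional ℝ E] {T : ℝ} (hT : 0 < T) {M : ℝ → E →L[ℝ] E}
    (hM : ContinuousOn M (Icc 0 T)) {s : ℝ} (hs : s ∈ Icc 0 T) :
    ∃ Z : ℝ → E →L[ℝ] E, Z s = 1 ∧
      ∀ t ∈ Icc 0 T, HasDerivWithinAt Z (M t ∘L Z t) (Icc 0 T) t := by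
  -- The Peano–Baker evolution lives on Euclidean space. Conjugation by a linear isomorphism
  -- transports it to other spaces, such as the product `V × V` of states and adjoints.
  let e : E ≃L[ℝ] Vec (Module.finrank ℝ E) :=
    ContinuousLinearEquiv.ofFinrankEq finrank_euclideanSpace_fin.symm
  have hM' : ContinuousOn
      (fun t => (e : E →L[ℝ] Vec (Module.finrank ℝ E)) ∘L M t ∘L (e.symm : Vec (Module.finrank ℝ E) →L[ℝ] E)) (Icc 0 T) := by
    fun_prop
  obtain ⟨Φ, hΦ⟩ := exists_isEvolution hT hM'
  obtain ⟨h1, h2⟩ := hΦ s hs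
  refine ⟨fun t => (e.symm : Vec (Module.finrank ℝ E) →L[ℝ] E) ∘L Φ t s ∘L (e : E →L[ℝ] Vec (Module.finrank ℝ E)), ?_, fun t ht => ?_⟩
  · ext v; simp [h1]
  · have h3 := ((hasDerivWithinAt_const t (Icc 0 T) (e.symm : Vec (Module.finrank ℝ E) →L[ℝ] E)).clm_comp
      ((h2 t ht).clm_comp (hasDerivWithinAt_const t (Icc 0 T) (e : E →L[ℝ] Vec (Module.finrank ℝ E)))))
    convert h3 using 1
    ext v; simp

end Calculus

/-! ### Primitives of integrable functions with one jump -/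

section Restriction

theorem _root_.IntervalIntegrable.of_mem_Icc {E : Type*} [NormedAddCommGroup E] {T t : ℝ} {h : ℝ → E}
    (hi : IntervalIntegrable h volume 0 T) (ht : t ∈ Icc 0 T) :
    IntervalIntegrable h volume 0 t :=
  hi.mono_set (by
    rw [uIcc_of_le ht.1, uIcc_of_le (ht.1.trans ht.2)]; exact Icc_subset_Icc_right ht.2)

theorem _root_.IntervalIntegrable.of_mem_Icc' {E : Type*} [NormedAddCommGroup E] {T t : ℝ} {h : ℝ → E}
    (hi : IntervalIntegrable h volume 0 T) (ht : t ∈ Icc 0 T) :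
    IntervalIntegrable h volume t T :=
  hi.mono_set (by
    rw [uIcc_of_le ht.2, uIcc_of_le (ht.1.trans ht.2)]; exact Icc_subset_Icc_left ht.1)

end Restriction

section Primitive

variable {E F G : Type*} [NormedAddCommGroup E] [NormedSpace ℝ E] [NormedAddCommGroup F]
  [NormedSpace ℝ F] [NormedAddCommGroup G] [NormedSpace ℝ G]

/-- On `[0,T]`, `y` is the primitive of `h` with initial value `y₀` and, at `t'`, a jump `p` after
which the value is taken. -/
structure HasJumpPrimitive (T t' : ℝ) (y : ℝ → E) (y₀ : E) (h : ℝ → E) (p : E) : Prop where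
  int : IntervalIntegrable h volume 0 T
  eq : ∀ t ∈ Icc 0 T, y t = y₀ + (∫ s in (0 : ℝ)..t, h s) + if t' ≤ t then p else 0

theorem intervalIntegrable_bilin (B : E →L[ℝ] F →L[ℝ] G) {a b : ℝ} {f : ℝ → E} {g : ℝ → F}
    (hab : a ≤ b) (hf : IntervalIntegrable f volume a b)
    (hg : AEStronglyMeasurable g (volume.restrict (Ioc a b))) {C : ℝ}
    (hC : ∀ t ∈ Ioc a b, ‖g t‖ ≤ C) :
    IntervalIntegrable (fun t => B (f t) (g t)) volume a b := by
  rw [intervalIntegrable_iff_integrableOn_Ioc_of_le hab] at hf ⊢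
  refine Integrable.mono' (g := fun t => ‖B‖ * C * ‖f t‖) (hf.norm.const_mul _)
    (B.aestronglyMeasurable_comp₂ hf.1 hg) ?_
  refine (ae_restrict_iff' measurableSet_Ioc).2 (Eventually.of_forall fun t ht => ?_)
  refine (B.le_opNorm₂ _ _).trans ?_
  have := hC t ht
  calc ‖B‖ * ‖f t‖ * ‖g t‖ ≤ ‖B‖ * ‖f t‖ * C := by gcongr
    _ = _ := by ring

/-- Integration by parts for merely integrable `f` and `g`. By Fubini, the integral of `B (f s) (g
r)` over the square is the sum of the integrals over the triangles `r ≤ s` and `s < r`, and these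
are the two terms on the left. -/
theorem integral_bilin_primitive [CompleteSpace E] [CompleteSpace F] [CompleteSpace G]
    (B : E →L[ℝ] F →L[ℝ] G) {t : ℝ} (ht : 0 ≤ t)
    {f : ℝ → E} {g : ℝ → F} (hf : IntervalIntegrable f volume 0 t)
    (hg : IntervalIntegrable g volume 0 t) :
    (∫ s in (0 : ℝ)..t, B (f s) (∫ r in (0 : ℝ)..s, g r)) +
      (∫ s in (0 : ℝ)..t, B (∫ r in (0 : ℝ)..s, f r) (g s)) =
      B (∫ s in (0 : ℝ)..t, f s) (∫ s in (0 : ℝ)..t, g s) := by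
  rw [intervalIntegrable_iff_integrableOn_Ioc_of_le ht] at hf hg
  simp only [intervalIntegral.integral_of_le ht]
  set μ := volume.restrict (Ioc 0 t) with hμ
  have hk : Integrable (fun z : ℝ × ℝ => B (f z.1) (g z.2)) (μ.prod μ) :=
    Integrable.op_fst_snd (by fun_prop) ⟨‖B‖, B.le_opNorm₂⟩ hf hg
  let A : Set (ℝ × ℝ) := {z | z.2 ≤ z.1}
  have hA : MeasurableSet A := measurableSet_le measurable_snd measurable_fst
  rw [← integral_prod_bilin B hf hg, ← integral_add_compl hA hk, ← integral_indicator hA,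
    ← integral_indicator hA.compl, integral_prod _ (hk.indicator hA),
    integral_prod_symm _ (hk.indicator hA.compl)]
  congr 1
  · refine setIntegral_congr_fun measurableSet_Ioc fun s hs => ?_
    have e : ∀ r, A.indicator (fun z : ℝ × ℝ => B (f z.1) (g z.2)) (s, r)
        = B (f s) ((Iic s).indicator g r) := fun r => by
      by_cases h : r ≤ s
      · rw [indicator_of_mem (show (s, r) ∈ A from h), indicator_of_mem (show r ∈ Iic s from h)]
      · rw [indicator_of_notMem (show (s, r) ∉ A from h),
          indicator_of_notMem (show r ∉ Iic s from h), map_zero]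
    simp only [e]
    rw [ContinuousLinearMap.integral_comp_comm _ (hg.indicator measurableSet_Iic),
      integral_indicator measurableSet_Iic, Measure.restrict_restrict measurableSet_Iic,
      intervalIntegral.integral_of_le hs.1.le]
    congr 3
    ext r
    simp only [mem_Ioc, mem_inter_iff, mem_Iic]
    exact ⟨fun h => ⟨h.2, h.1, h.2.trans hs.2⟩, fun h => ⟨h.2.1, h.1⟩⟩
  · refine setIntegral_congr_fun measurableSet_Ioc fun s hs => ?_
    have e : ∀ r, Aᶜ.indicator (fun z : ℝ × ℝ => B (f z.1) (g z.2)) (r, s)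
        = B.flip (g s) ((Iio s).indicator f r) := fun r => by
      by_cases h : r < s
      · rw [indicator_of_mem (show (r, s) ∈ Aᶜ from not_le.2 h),
          indicator_of_mem (show r ∈ Iio s from h)]; rfl
      · rw [indicator_of_notMem (show (r, s) ∉ Aᶜ from fun h' => h (not_le.1 h')),
          indicator_of_notMem (show r ∉ Iio s from h), map_zero]
    simp only [e]
    rw [ContinuousLinearMap.integral_comp_comm _ (hf.indicator measurableSet_Iio),
      integral_indicator measurableSet_Iio, Measure.restrict_restrict measurableSet_Iio,
      intervalIntegral.integral_of_le hs.1.le, integral_Ioc_eq_integral_Ioo,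
      ContinuousLinearMap.flip_apply]
    congr 4
    ext r
    simp only [mem_Ioo, mem_Ioc, mem_inter_iff, mem_Iio]
    exact ⟨fun h => ⟨h.2, h.1, h.2.le.trans hs.2⟩, fun h => ⟨h.2.1, h.1⟩⟩

theorem _root_.IntervalIntegrable.clm_map {a b : ℝ} {h : ℝ → E}
    (hi : IntervalIntegrable h volume a b) (L : E →L[ℝ] F) :
    IntervalIntegrable (fun t => L (h t)) volume a b :=
  ⟨L.integrable_comp hi.1, L.integrable_comp hi.2⟩

theorem continuousOn_primitive_Icc {T : ℝ} (hT : 0 ≤ T) {h : ℝ → E}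
    (hi : IntervalIntegrable h volume 0 T) :
    ContinuousOn (fun t => ∫ s in (0 : ℝ)..t, h s) (Icc 0 T) := by
  have := intervalIntegral.continuousOn_primitive_interval' hi (by simp [hT] : (0 : ℝ) ∈ uIcc 0 T)
  rwa [uIcc_of_le hT] at this

namespace HasJumpPrimitive

variable {T t' : ℝ} {y : ℝ → E} {y₀ : E} {h : ℝ → E} {p : E}

theorem aestronglyMeasurable (hT : 0 ≤ T) (hy : HasJumpPrimitive T t' y y₀ h p) :
    AEStronglyMeasurable y (volume.restrict (Ioc 0 T)) := by
  have h1 : AEStronglyMeasurable (fun t => ∫ s in (0 : ℝ)..t, h s) (volume.restrict (Ioc 0 T)) :=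
    ((continuousOn_primitive_Icc hT hy.int).mono Ioc_subset_Icc_self).aestronglyMeasurable
      measurableSet_Ioc
  have h2 : StronglyMeasurable fun t : ℝ => if t' ≤ t then p else 0 :=
    StronglyMeasurable.ite measurableSet_Ici stronglyMeasurable_const stronglyMeasurable_const
  refine ((aestronglyMeasurable_const (b := y₀)).add h1 |>.add
    h2.aestronglyMeasurable).congr ?_
  refine (ae_restrict_iff' measurableSet_Ioc).2 (Eventually.of_forall fun t ht => ?_)
  exact (hy.eq t (Ioc_subset_Icc_self ht)).symm

theorem exists_bound (hT : 0 ≤ T) (hy : HasJumpPrimitive T t' y y₀ h p) :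
    ∃ C, ∀ t ∈ Icc 0 T, ‖y t‖ ≤ C := by
  obtain ⟨C, hC⟩ := isCompact_Icc.exists_bound_of_continuousOn
    (continuousOn_primitive_Icc hT hy.int)
  refine ⟨‖y₀‖ + C + ‖p‖, fun t ht => ?_⟩
  rw [hy.eq t ht]
  refine (norm_add₃_le).trans ?_
  gcongr
  · exact hC t ht
  · split_ifs <;> simp

theorem intervalIntegrable (hT : 0 ≤ T) (hy : HasJumpPrimitive T t' y y₀ h p) :
    IntervalIntegrable y volume 0 T := by
  obtain ⟨C, hC⟩ := hy.exists_bound hT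
  rw [intervalIntegrable_iff_integrableOn_Ioc_of_le hT]
  refine Integrable.mono' (g := fun _ => C) (integrable_const C) (hy.aestronglyMeasurable hT) ?_
  exact (ae_restrict_iff' measurableSet_Ioc).2
    (Eventually.of_forall fun t ht => hC t (Ioc_subset_Icc_self ht))

theorem continuousOn (hT : 0 ≤ T) (hy : HasJumpPrimitive T t' y y₀ h 0) :
    ContinuousOn y (Icc 0 T) :=
  ((continuousOn_const (c := y₀)).add (continuousOn_primitive_Icc hT hy.int)).congr fun t ht => by
    simp [hy.eq t ht]

theorem congr (hy : HasJumpPrimitive T t' y y₀ h p) {z : ℝ → E} {z₀ : E} {k : ℝ → E} {q : E}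
    (hT : 0 ≤ T)
    (h1 : ∀ t ∈ Icc 0 T, z t = y t) (h2 : z₀ = y₀) (h3 : ∀ t ∈ Icc 0 T, k t = h t) (h4 : q = p) :
    HasJumpPrimitive T t' z z₀ k q := by
  subst h2 h4
  refine ⟨hy.int.congr fun t ht => (h3 t ?_).symm, fun t ht => ?_⟩
  · rw [uIoc_of_le hT] at ht; exact Ioc_subset_Icc_self ht
  · rw [h1 t ht, hy.eq t ht]
    congr 2
    refine intervalIntegral.integral_congr fun s hs => ?_
    rw [uIcc_of_le ht.1] at hs
    exact (h3 s ⟨hs.1, hs.2.trans ht.2⟩).symm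

theorem of_hasDerivWithinAt [CompleteSpace E] (t' : ℝ) (hT : 0 ≤ T)
    (hy : ∀ t ∈ Icc 0 T, HasDerivWithinAt y (h t) (Icc 0 T) t) (hc : ContinuousOn h (Icc 0 T)) :
    HasJumpPrimitive T t' y (y 0) h 0 := by
  refine ⟨hc.intervalIntegrable_of_Icc hT, fun t ht => ?_⟩
  have := intervalIntegral.integral_eq_sub_of_hasDerivAt_of_le ht.1
    (f := y) (f' := h) (fun s hs => ((hy s ⟨hs.1, hs.2.trans ht.2⟩).continuousWithinAt).mono
      (Icc_subset_Icc_right ht.2))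
    (fun s hs => (hy s ⟨hs.1.le, hs.2.le.trans ht.2⟩).hasDerivAt
      (Icc_mem_nhds hs.1 (hs.2.trans_le ht.2)))
    ((hc.intervalIntegrable_of_Icc hT).of_mem_Icc ht)
  rw [this]; simp

theorem add {z : ℝ → E} {z₀ : E} {k : ℝ → E} {q : E} (hy : HasJumpPrimitive T t' y y₀ h p)
    (hz : HasJumpPrimitive T t' z z₀ k q) :
    HasJumpPrimitive T t' (fun t => y t + z t) (y₀ + z₀) (fun t => h t + k t) (p + q) := by
  refine ⟨hy.int.add hz.int, fun t ht => ?_⟩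
  rw [hy.eq t ht, hz.eq t ht, intervalIntegral.integral_add (hy.int.of_mem_Icc ht)
    (hz.int.of_mem_Icc ht)]
  split_ifs <;> abel

theorem sub {z : ℝ → E} {z₀ : E} {k : ℝ → E} {q : E} (hy : HasJumpPrimitive T t' y y₀ h p)
    (hz : HasJumpPrimitive T t' z z₀ k q) :
    HasJumpPrimitive T t' (fun t => y t - z t) (y₀ - z₀) (fun t => h t - k t) (p - q) := by
  refine ⟨hy.int.sub hz.int, fun t ht => ?_⟩
  rw [hy.eq t ht, hz.eq t ht, intervalIntegral.integral_sub (hy.int.of_mem_Icc ht)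
    (hz.int.of_mem_Icc ht)]
  split_ifs <;> abel

/-- The value at `t` in terms of the value at the right end point. -/
theorem eq_right (hT : 0 ≤ T) (ht' : t' ≤ T) (hy : HasJumpPrimitive T t' y y₀ h p) {t : ℝ}
    (ht : t ∈ Icc 0 T) : y t = y T - (∫ s in t..T, h s) - if t < t' then p else 0 := by
  rw [hy.eq t ht, hy.eq T ⟨hT, le_rfl⟩, if_pos ht',
    ← intervalIntegral.integral_add_adjacent_intervals (hy.int.of_mem_Icc ht)
      (hy.int.of_mem_Icc' ht)]
  by_cases h1 : t' ≤ t
  · rw [if_pos h1, if_neg (not_lt.2 h1)]; abel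
  · rw [if_neg h1, if_pos (not_le.1 h1)]; abel

/-- The adjoint is prescribed from the right end, whereas `HasJumpPrimitive` counts from the left.
The initial value obtained here is the one before the jump, also if `t' = 0`. -/
theorem of_eq_right (hi : IntervalIntegrable h volume 0 T) {yT : E}
    (hy : ∀ t ∈ Icc 0 T, y t = yT - (∫ s in t..T, h s) - if t < t' then p else 0) :
    HasJumpPrimitive T t' y (yT - (∫ s in (0 : ℝ)..T, h s) - p) h p := by
  refine ⟨hi, fun t ht => ?_⟩
  rw [hy t ht, ← intervalIntegral.integral_add_adjacent_intervals (hi.of_mem_Icc ht)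
      (hi.of_mem_Icc' ht)]
  by_cases h1 : t' ≤ t
  · rw [if_pos h1, if_neg (not_lt.2 h1)]; abel
  · rw [if_neg h1, if_pos (not_le.1 h1)]; abel

/-- In the product rule the jump of the second factor contributes a step to the integrand that is
switched on at `t'`. The single time `t'` is a null set, so it does not matter on which side of the
step it falls. -/
theorem integral_step {t : ℝ} (ht' : 0 ≤ t') (ht : t ∈ Icc 0 T) {f : ℝ → E}
    (hf : IntervalIntegrable f volume 0 T) (L : E →L[ℝ] F) [CompleteSpace E] [CompleteSpace F] :
    ∫ s in (0 : ℝ)..t, (if t' ≤ s then L (f s) else 0) =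
      if t' ≤ t then L ((∫ s in (0 : ℝ)..t, f s) - ∫ s in (0 : ℝ)..t', f s) else 0 := by
  have key : ∀ c, 0 ≤ c → c ≤ t' → ∀ᵐ s, s ∈ uIoc 0 c →
      (if t' ≤ s then L (f s) else 0) = 0 := by
    intro c hc hct
    have : ∀ᵐ s : ℝ, s ≠ t' := by simp [ae_iff]
    filter_upwards [this] with s hs hsc
    rw [uIoc_of_le hc] at hsc
    exact if_neg fun h => hs (le_antisymm (hsc.2.trans hct) h)
  by_cases h1 : t' ≤ t
  · rw [if_pos h1]
    have i1 := hf.of_mem_Icc (t := t') ⟨ht', h1.trans ht.2⟩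
    have i2 := hf.of_mem_Icc ht
    have i3 : IntervalIntegrable f volume t' t := i1.symm.trans i2
    have e1 : ∫ s in t'..t, (if t' ≤ s then L (f s) else 0) = ∫ s in t'..t, L (f s) :=
      intervalIntegral.integral_congr fun s hs => by
        rw [uIcc_of_le h1] at hs; exact if_pos hs.1
    have e0 : ∫ s in (0 : ℝ)..t', (if t' ≤ s then L (f s) else 0) = 0 := by
      rw [intervalIntegral.integral_congr_ae (key t' ht' le_rfl)]; simp
    have j0 : IntervalIntegrable (fun s => if t' ≤ s then L (f s) else 0) volume 0 t' := by
      refine (IntervalIntegrable.zero : IntervalIntegrable (fun _ => (0 : F)) volume 0 t').congr_ae ?_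
      rw [EventuallyEq, ae_restrict_iff' measurableSet_uIoc]
      filter_upwards [key t' ht' le_rfl] with s hs hs'
      exact (hs hs').symm
    have j1 : IntervalIntegrable (fun s => if t' ≤ s then L (f s) else 0) volume t' t := by
      refine (i3.clm_map L).congr fun s hs => ?_
      rw [uIoc_of_le h1] at hs; exact (if_pos hs.1.le).symm
    rw [← intervalIntegral.integral_add_adjacent_intervals j0 j1, e0, e1, zero_add,
      L.intervalIntegral_comp_comm i3, intervalIntegral.integral_interval_sub_left i2 i1]
  · rw [if_neg h1, intervalIntegral.integral_congr_ae (key t ht.1 (not_le.1 h1).le)]; simp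

/-- The product rule. -/
theorem bilin [CompleteSpace E] [CompleteSpace F] [CompleteSpace G] (B : E →L[ℝ] F →L[ℝ] G)
    (hT : 0 ≤ T) (ht' : t' ∈ Icc 0 T)
    (hy : HasJumpPrimitive T t' y y₀ h 0) {z : ℝ → F} {z₀ : F} {k : ℝ → F} {q : F}
    (hz : HasJumpPrimitive T t' z z₀ k q) :
    HasJumpPrimitive T t' (fun t => B (y t) (z t)) (B y₀ z₀)
      (fun t => B (h t) (z t) + B (y t) (k t)) (B (y t') q) := by
  obtain ⟨Cy, hCy⟩ := hy.exists_bound hT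
  obtain ⟨Cz, hCz⟩ := hz.exists_bound hT
  have i1 : IntervalIntegrable (fun t => B (h t) (z t)) volume 0 T :=
    intervalIntegrable_bilin B hT hy.int (hz.aestronglyMeasurable hT)
      fun t ht => hCz t (Ioc_subset_Icc_self ht)
  have i2 : IntervalIntegrable (fun t => B (y t) (k t)) volume 0 T :=
    intervalIntegrable_bilin B.flip hT hz.int (hy.aestronglyMeasurable hT)
      fun t ht => hCy t (Ioc_subset_Icc_self ht)
  refine ⟨i1.add i2, fun t ht => ?_⟩
  have a1 : IntervalIntegrable (fun s => B (h s) z₀) volume 0 t :=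
    (hy.int.of_mem_Icc ht).clm_map (B.flip z₀)
  have a2 : IntervalIntegrable (fun s => B (h s) (∫ r in (0 : ℝ)..s, k r)) volume 0 t := by
    obtain ⟨C, hC⟩ := isCompact_Icc.exists_bound_of_continuousOn
      (continuousOn_primitive_Icc hT hz.int)
    exact (intervalIntegrable_bilin B hT hy.int
      (((continuousOn_primitive_Icc hT hz.int).mono Ioc_subset_Icc_self).aestronglyMeasurable
      measurableSet_Ioc) fun t ht => hC t (Ioc_subset_Icc_self ht)).of_mem_Icc ht
  have a3 : IntervalIntegrable (fun s => B y₀ (k s)) volume 0 t :=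
    (hz.int.of_mem_Icc ht).clm_map (B y₀)
  -- From `t'` on, the jump `q` of `z` adds the term `B (y t - y t') q` to this integral. The
  -- remaining `B (y t') q` is the jump of the product.
  have e1 : (∫ s in (0 : ℝ)..t, B (h s) (z s)) = (B (∫ s in (0 : ℝ)..t, h s) z₀ +
      ∫ s in (0 : ℝ)..t, B (h s) (∫ r in (0 : ℝ)..s, k r)) +
      if t' ≤ t then B ((∫ s in (0 : ℝ)..t, h s) - ∫ s in (0 : ℝ)..t', h s) q else 0 := by
    have a4 : ∀ s ∈ uIcc 0 t, (if t' ≤ s then B.flip q (h s) else 0)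
        = B (h s) (z s) - (B (h s) z₀ + B (h s) (∫ r in (0 : ℝ)..s, k r)) := by
      intro s hs
      rw [uIcc_of_le ht.1] at hs
      rw [hz.eq s ⟨hs.1, hs.2.trans ht.2⟩]
      split_ifs <;> simp
    have a5 := integral_step ht'.1 ht hy.int (B.flip q)
    rw [intervalIntegral.integral_congr a4, intervalIntegral.integral_sub (i1.of_mem_Icc ht)
      (a1.add a2), intervalIntegral.integral_add a1 a2] at a5
    have a6 := (B.flip z₀).intervalIntegral_comp_comm (hy.int.of_mem_Icc ht)
    simp only [ContinuousLinearMap.flip_apply] at a5 a6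
    rw [← a5, a6]; abel
  have e2 : (∫ s in (0 : ℝ)..t, B (y s) (k s)) = B y₀ (∫ s in (0 : ℝ)..t, k s) +
      ∫ s in (0 : ℝ)..t, B (∫ r in (0 : ℝ)..s, h r) (k s) := by
    have a4 : ∀ s ∈ uIcc 0 t, B (∫ r in (0 : ℝ)..s, h r) (k s) = B (y s) (k s) - B y₀ (k s) := by
      intro s hs
      rw [uIcc_of_le ht.1] at hs
      rw [hy.eq s ⟨hs.1, hs.2.trans ht.2⟩]
      simp
    rw [intervalIntegral.integral_congr a4, intervalIntegral.integral_sub (i2.of_mem_Icc ht) a3,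
      (B y₀).intervalIntegral_comp_comm (hz.int.of_mem_Icc ht)]
    abel
  have e3 := integral_bilin_primitive B ht.1 (hy.int.of_mem_Icc ht) (hz.int.of_mem_Icc ht)
  rw [intervalIntegral.integral_add (i1.of_mem_Icc ht) (i2.of_mem_Icc ht), e1, e2, hy.eq t ht,
    hz.eq t ht, hy.eq t' ht']
  simp only [ite_self, add_zero, map_add, add_apply, ← e3]
  split_ifs
  · simp only [map_sub, sub_apply]; abel
  · simp only [map_zero]; abel

end HasJumpPrimitive

end Primitive


/-! ### Adjoints and positive operators -/

section Operators

variable {V W : Type*} [NormedAddCommGroup V] [InnerProductSpace ℝ V] [CompleteSpace V]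
  [NormedAddCommGroup W] [InnerProductSpace ℝ W] [CompleteSpace W]

/-- The adjoint as a continuous linear map over `ℝ`. -/
noncomputable def adjointL : (V →L[ℝ] W) →L[ℝ] (W →L[ℝ] V) :=
  LinearMap.mkContinuous
    { toFun := fun M => M†
      map_add' := fun M N => map_add _ M N
      map_smul' := fun c M => by simp } 1 (fun M => by simp)

@[simp] theorem adjointL_apply (M : V →L[ℝ] W) : adjointL M = M† := rfl

theorem continuousOn_adjoint {M : ℝ → V →L[ℝ] W} {s : Set ℝ} (hM : ContinuousOn M s) :
    ContinuousOn (fun t => (M t)†) s :=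
  (adjointL (V := V) (W := W)).continuous.comp_continuousOn hM

theorem hasDerivWithinAt_adjoint {M : ℝ → V →L[ℝ] W} {M' : V →L[ℝ] W} {s : Set ℝ} {t : ℝ}
    (hM : HasDerivWithinAt M M' s t) : HasDerivWithinAt (fun t => (M t)†) (M'†) s t :=
  (adjointL (V := V) (W := W)).hasFDerivAt.comp_hasDerivWithinAt t hM

omit [CompleteSpace V] [CompleteSpace W] in
theorem hasDerivWithinAt_apply {M : ℝ → V →L[ℝ] W} {M' : V →L[ℝ] W} {s : Set ℝ} {t : ℝ}
    (hM : HasDerivWithinAt M M' s t) (v : V) : HasDerivWithinAt (fun t => M t v) (M' v) s t := by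
  simpa using hM.clm_apply (hasDerivWithinAt_const t s v)

omit [CompleteSpace V] in
/-- The norm of a symmetric positive operator is bounded by its quadratic form. -/
theorem norm_apply_le_of_inner_le {S : V →L[ℝ] V} (hS : ∀ x y, inner ℝ (S x) y = inner ℝ x (S y))
    {c : ℝ} (hc : 0 < c) (h0 : ∀ x, 0 ≤ inner ℝ x (S x)) (h1 : ∀ x, inner ℝ x (S x) ≤ c * ‖x‖ ^ 2)
    (x : V) : ‖S x‖ ≤ c * ‖x‖ := by
  -- Expanding the form at `c x - S x` and estimating `⟨Sx, S(Sx)⟩ ≤ c‖Sx‖²` gives `c‖Sx‖² ≤ c²⟨x,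
  -- Sx⟩ ≤ c³‖x‖²`.
  have h2 := h0 (c • x - S x)
  have h3 := h1 (S x)
  have h4 := h1 x
  have h5 : inner ℝ x (S (S x)) = ‖S x‖ ^ 2 := by rw [← hS, real_inner_self_eq_norm_sq]
  simp only [map_sub, map_smul, inner_sub_left, inner_sub_right, inner_smul_left, inner_smul_right,
    real_inner_self_eq_norm_sq, conj_trivial, h5] at h2
  refine abs_le_of_sq_le_sq' ?_ (by positivity) |>.2
  have h6 : c * ‖S x‖ ^ 2 ≤ c * (c * ‖x‖) ^ 2 := by
    nlinarith [mul_le_mul_of_nonneg_left h4 (mul_pos hc hc).le]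
  exact le_of_mul_le_mul_left h6 hc

end Operators

/-! ### Hamiltonian systems -/

section Hamiltonian

variable {V : Type*} [NormedAddCommGroup V] [InnerProductSpace ℝ V] [CompleteSpace V]

/-- The data of a linear Hamiltonian system `x' = F x - N λ`, `λ' = -Fᵀ λ - K x`,
`λ(T) = P x(T)`, with `N` positive semidefinite and `K`, `P` at least `γ`. -/
structure IsHamiltonianSystem (T γ : ℝ) (F N K : ℝ → V →L[ℝ] V) (P : V →L[ℝ] V) : Prop where
  T_pos : 0 < T
  gam_pos : 0 < γ
  contF : ContinuousOn F (Icc 0 T)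
  contN : ContinuousOn N (Icc 0 T)
  contK : ContinuousOn K (Icc 0 T)
  symmN : ∀ t ∈ Icc 0 T, ∀ x y, inner ℝ (N t x) y = inner ℝ x (N t y)
  symmK : ∀ t ∈ Icc 0 T, ∀ x y, inner ℝ (K t x) y = inner ℝ x (K t y)
  symmP : ∀ x y, inner ℝ (P x) y = inner ℝ x (P y)
  posN : ∀ t ∈ Icc 0 T, ∀ x, 0 ≤ inner ℝ x (N t x)
  coerK : ∀ t ∈ Icc 0 T, ∀ x, γ * ‖x‖ ^ 2 ≤ inner ℝ x (K t x)
  coerP : ∀ x, γ * ‖x‖ ^ 2 ≤ inner ℝ x (P x)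

/-- Solutions of the homogeneous Hamiltonian system. -/
def IsHamiltonianSolution (T : ℝ) (F N K : ℝ → V →L[ℝ] V) (x lam : ℝ → V) : Prop :=
  ∀ t ∈ Icc 0 T, HasDerivWithinAt x (F t (x t) - N t (lam t)) (Icc 0 T) t ∧
    HasDerivWithinAt lam (-((F t)†) (lam t) - K t (x t)) (Icc 0 T) t

/-- `X`, `L` are the operator solutions with `X(T) = 1`, `L(T) = P`, and `Y` is the inverse
of `X`. -/
structure IsFundamental (T : ℝ) (F N K : ℝ → V →L[ℝ] V) (P : V →L[ℝ] V) (X L Y : ℝ → V →L[ℝ] V) :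
    Prop where
  derivX : ∀ t ∈ Icc 0 T, HasDerivWithinAt X (F t ∘L X t - N t ∘L L t) (Icc 0 T) t
  derivL : ∀ t ∈ Icc 0 T, HasDerivWithinAt L (-((F t)†) ∘L L t - K t ∘L X t) (Icc 0 T) t
  derivY : ∀ t ∈ Icc 0 T,
    HasDerivWithinAt Y (-(Y t ∘L (F t ∘L X t - N t ∘L L t) ∘L Y t)) (Icc 0 T) t
  X_right : X T = 1
  L_right : L T = P
  XY : ∀ t ∈ Icc 0 T, ∀ v, X t (Y t v) = v
  YX : ∀ t ∈ Icc 0 T, ∀ v, Y t (X t v) = v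
  symm : ∀ t ∈ Icc 0 T, ∀ v w, inner ℝ (X t v) (L t w) = inner ℝ (L t v) (X t w)

variable {T γ : ℝ} {F N K : ℝ → V →L[ℝ] V} {P : V →L[ℝ] V}

/-- The contributions of `F` cancel by adjointness. Once `λ(T) = P x(T)`, the form `⟨x,λ⟩` is twice
the optimal cost-to-go, and its rate of decrease is twice the running cost. -/
theorem IsHamiltonianSolution.hasDerivWithinAt_inner {x lam : ℝ → V}
    (h : IsHamiltonianSolution T F N K x lam) {t : ℝ} (ht : t ∈ Icc 0 T) :
    HasDerivWithinAt (fun t => inner ℝ (x t) (lam t))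
      (-(inner ℝ (x t) (K t (x t)) + inner ℝ (lam t) (N t (lam t)))) (Icc 0 T) t := by
  obtain ⟨h1, h2⟩ := h t ht
  refine (h1.inner ℝ h2).congr_deriv ?_
  simp only [inner_sub_left, inner_sub_right, inner_neg_right,
    ContinuousLinearMap.adjoint_inner_right, real_inner_comm (lam t) (N t (lam t))]
  ring

/-- The flow is symplectic: the `F` terms cancel by adjointness, the `N` and `K` terms by symmetry.
Evaluated at `T`, where `λ = Px`, this produces the symmetry of the Riccati matrix. -/
theorem IsHamiltonianSystem.wronskian (H : IsHamiltonianSystem T γ F N K P) {x lam y mu : ℝ → V}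
    (h : IsHamiltonianSolution T F N K x lam) (h' : IsHamiltonianSolution T F N K y mu)
    {s t : ℝ} (hs : s ∈ Icc 0 T) (ht : t ∈ Icc 0 T) :
    inner ℝ (x s) (mu s) - inner ℝ (lam s) (y s) =
      inner ℝ (x t) (mu t) - inner ℝ (lam t) (y t) := by
  refine eq_of_hasDerivWithinAt_zero (f := fun t => inner ℝ (x t) (mu t) - inner ℝ (lam t) (y t))
    (fun r hr => ?_) hs ht
  obtain ⟨h1, h2⟩ := h r hr
  obtain ⟨h3, h4⟩ := h' r hr
  refine ((h1.inner ℝ h4).sub (h2.inner ℝ h3)).congr_deriv ?_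
  simp only [inner_sub_left, inner_sub_right, inner_neg_right, inner_neg_left,
    ContinuousLinearMap.adjoint_inner_right, ContinuousLinearMap.adjoint_inner_left,
    H.symmN r hr, H.symmK r hr]
  ring

/-- `⟨x,λ⟩` is nonincreasing and ends at `⟨x(T), P x(T)⟩`. The bound serves both for the
invertibility of `X` and for discarding the value at the end of a window. -/
theorem IsHamiltonianSystem.le_inner (H : IsHamiltonianSystem T γ F N K P) {x lam : ℝ → V}
    (h : IsHamiltonianSolution T F N K x lam) (hT : lam T = P (x T)) {t : ℝ} (ht : t ∈ Icc 0 T) :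
    γ * ‖x T‖ ^ 2 ≤ inner ℝ (x t) (lam t) := by
  have h1 := le_of_hasDerivWithinAt_nonneg ht.2
    (fun s hs => ((h.hasDerivWithinAt_inner ⟨ht.1.trans hs.1, hs.2⟩).neg.mono
      (Icc_subset_Icc_left ht.1))) (fun s hs => by
        have hs' : s ∈ Icc 0 T := ⟨ht.1.trans hs.1, hs.2⟩
        have := H.posN s hs' (lam s)
        have := H.coerK s hs' (x s)
        have := H.gam_pos
        have : 0 ≤ γ * ‖x s‖ ^ 2 := by positivity
        linarith)
  have h2 := H.coerP (x T)
  simp only [Pi.neg_apply, hT] at h1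
  linarith

/-- If `X(t)v = 0`, then `⟨X(t)v, L(t)v⟩ = 0`, and `le_inner` forces `v = X(T)v = 0`. So `X(t)` is
injective, hence invertible, on the whole interval, and `L Y` is available as the Riccati matrix
without solving the nonlinear Riccati equation. -/
theorem IsHamiltonianSystem.exists_isFundamental [FiniteDimensional ℝ V]
    (H : IsHamiltonianSystem T γ F N K P) :
    ∃ X L Y, IsFundamental T F N K P X L Y := by
  let i1 := ContinuousLinearMap.inl ℝ V V
  let i2 := ContinuousLinearMap.inr ℝ V V
  let p1 := ContinuousLinearMap.fst ℝ V V
  let p2 := ContinuousLinearMap.snd ℝ V V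
  let M : ℝ → (V × V) →L[ℝ] (V × V) := fun t =>
    i1 ∘L (F t ∘L p1 - N t ∘L p2) + i2 ∘L (-((F t)†) ∘L p2 - K t ∘L p1)
  have hM : ContinuousOn M (Icc 0 T) := by
    have := H.contF
    have := H.contN
    have := H.contK
    have := continuousOn_adjoint H.contF
    fun_prop
  have hTm : T ∈ Icc 0 T := ⟨H.T_pos.le, le_rfl⟩
  obtain ⟨Z, hZ, hZ'⟩ := exists_fundamental H.T_pos hM hTm
  let j : V →L[ℝ] V × V := i1 + i2 ∘L P
  let X : ℝ → V →L[ℝ] V := fun t => p1 ∘L Z t ∘L j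
  let L : ℝ → V →L[ℝ] V := fun t => p2 ∘L Z t ∘L j
  have hX : ∀ t ∈ Icc 0 T, HasDerivWithinAt X (F t ∘L X t - N t ∘L L t) (Icc 0 T) t := by
    intro t ht
    have h3 := (hasDerivWithinAt_const t (Icc 0 T) p1).clm_comp
      ((hZ' t ht).clm_comp (hasDerivWithinAt_const t (Icc 0 T) j))
    refine h3.congr_deriv ?_
    ext v
    simp [M, X, L, i1, i2, p1, p2]
  have hL : ∀ t ∈ Icc 0 T, HasDerivWithinAt L (-((F t)†) ∘L L t - K t ∘L X t) (Icc 0 T) t := by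
    intro t ht
    have h3 := (hasDerivWithinAt_const t (Icc 0 T) p2).clm_comp
      ((hZ' t ht).clm_comp (hasDerivWithinAt_const t (Icc 0 T) j))
    refine h3.congr_deriv ?_
    ext v
    simp [M, X, L, i1, i2, p1, p2]
  have hXT : X T = 1 := by ext v; simp [X, hZ, j, i1, i2, p1]
  have hLT : L T = P := by ext v; simp [L, hZ, j, i1, i2, p2]
  have hsol : ∀ v, IsHamiltonianSolution T F N K (fun t => X t v) (fun t => L t v) := fun v t ht =>
    ⟨by simpa using hasDerivWithinAt_apply (hX t ht) v,
      by simpa using hasDerivWithinAt_apply (hL t ht) v⟩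
  have hunit : ∀ t ∈ Icc 0 T, IsUnit (X t) := by
    intro t ht
    have hinj : Function.Injective (X t) := by
      rw [injective_iff_map_eq_zero]
      intro v hv
      have := H.le_inner (hsol v) (by simp [hXT, hLT]) ht
      simp only [hv, inner_zero_left, hXT, one_apply_eq_self] at this
      have h0 := H.gam_pos
      have : ‖v‖ ^ 2 ≤ 0 := by nlinarith
      simpa using this
    rw [ContinuousLinearMap.isUnit_iff_bijective]
    exact ⟨hinj, (LinearMap.injective_iff_surjective (f := (X t : V →ₗ[ℝ] V))).1 hinj⟩
  refine ⟨X, L, fun t => Ring.inverse (X t), hX, hL, fun t ht => ?_, hXT, hLT, fun t ht v => ?_,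
    fun t ht v => ?_, fun t ht v w => ?_⟩
  · obtain ⟨u, hu⟩ := hunit t ht
    have h1 := hasFDerivAt_ringInverse (𝕜 := ℝ) u
    rw [hu] at h1
    refine (h1.comp_hasDerivWithinAt t (hX t ht)).congr_deriv ?_
    rw [← hu, Ring.inverse_unit]
    rfl
  · exact DFunLike.congr_fun (Ring.mul_inverse_cancel _ (hunit t ht)) v
  · exact DFunLike.congr_fun (Ring.inverse_mul_cancel _ (hunit t ht)) v
  · have := H.wronskian (hsol v) (hsol w) ht hTm
    simp only [hXT, hLT, one_apply_eq_self, H.symmP, sub_self] at this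
    linarith

namespace IsFundamental

variable {X L Y : ℝ → V →L[ℝ] V}

theorem isHamiltonianSolution (h : IsFundamental T F N K P X L Y) (v : V) :
    IsHamiltonianSolution T F N K (fun t => X t v) (fun t => L t v) := fun t ht =>
  ⟨by simpa using hasDerivWithinAt_apply (h.derivX t ht) v,
    by simpa using hasDerivWithinAt_apply (h.derivL t ht) v⟩

theorem right (h : IsFundamental T F N K P X L Y) (v : V) : L T v = P (X T v) := by
  simp [h.X_right, h.L_right]

theorem symm_riccati (h : IsFundamental T F N K P X L Y) {t : ℝ} (ht : t ∈ Icc 0 T) (v w : V) :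
    inner ℝ (L t (Y t v)) w = inner ℝ v (L t (Y t w)) := by
  have := h.symm t ht (Y t v) (Y t w)
  rw [h.XY t ht, h.XY t ht] at this
  exact this.symm

theorem norm_riccati_le (h : IsFundamental T F N K P X L Y) {c₁ : ℝ} (hc₁ : 0 < c₁) {t : ℝ}
    (ht : t ∈ Icc 0 T) (h0 : ∀ v, 0 ≤ inner ℝ (X t v) (L t v))
    (h1 : ∀ v, inner ℝ (X t v) (L t v) ≤ c₁ * ‖X t v‖ ^ 2) (v : V) :
    ‖L t (Y t v)‖ ≤ c₁ * ‖v‖ := by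
  refine norm_apply_le_of_inner_le (S := L t ∘L Y t) (h.symm_riccati ht) hc₁ (fun x => ?_)
    (fun x => ?_) v
  · simpa [h.XY t ht] using h0 (Y t x)
  · simpa [h.XY t ht] using h1 (Y t x)

/-- Exponential stability of the closed loop. -/
theorem norm_le_exp (H : IsHamiltonianSystem T γ F N K P)
    (h : IsFundamental T F N K P X L Y) {c₀ c₁ : ℝ} (hc₀ : 0 < c₀) (hc₁ : 0 < c₁)
    (h0 : ∀ t ∈ Icc 0 T, ∀ v, c₀ * ‖X t v‖ ^ 2 ≤ inner ℝ (X t v) (L t v))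
    (h1 : ∀ t ∈ Icc 0 T, ∀ v, inner ℝ (X t v) (L t v) ≤ c₁ * ‖X t v‖ ^ 2)
    {s t : ℝ} (hs : s ∈ Icc 0 T) (ht : t ∈ Icc 0 T) (hst : s ≤ t) (v : V) :
    ‖X t v‖ ≤ √(c₁ / c₀) * Real.exp (-(γ / (2 * c₁)) * (t - s)) * ‖X s v‖ := by
  have hsub : Icc s t ⊆ Icc 0 T := Icc_subset_Icc hs.1 ht.2
  set ρ := γ / (2 * c₁) with hρ
  -- The form `⟨Xv, Lv⟩` decreases at least at the rate `γ‖Xv‖² = 2ρc₁‖Xv‖² ≥ 2ρ⟨Xv, Lv⟩`, so its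
  -- product with `exp(2ρ(r-s))` is nonincreasing. Comparing the form with `‖Xv‖²` at the two ends
  -- costs the factor `c₁/c₀`.
  have hd : ∀ r ∈ Icc s t, HasDerivWithinAt
      (fun r => -(Real.exp (2 * ρ * (r - s)) * inner ℝ (X r v) (L r v)))
      (-(Real.exp (2 * ρ * (r - s)) * (2 * ρ) * inner ℝ (X r v) (L r v) +
        Real.exp (2 * ρ * (r - s)) *
          (-(inner ℝ (X r v) (K r (X r v)) + inner ℝ (L r v) (N r (L r v)))))) (Icc s t) r := by
    intro r hr
    have h2 : HasDerivAt (fun t => Real.exp (2 * ρ * (t - s)))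
        (Real.exp (2 * ρ * (r - s)) * (2 * ρ)) r := by
      simpa using (((hasDerivAt_id r).sub_const s).const_mul (2 * ρ)).exp
    exact (h2.hasDerivWithinAt.mul (((h.isHamiltonianSolution v).hasDerivWithinAt_inner
      (hsub hr)).mono hsub)).neg
  have h3 := le_of_hasDerivWithinAt_nonneg hst hd (fun r hr => by
    have e1 := H.posN r (hsub hr) (L r v)
    have e2 := H.coerK r (hsub hr) (X r v)
    have e3 := h1 r (hsub hr) v
    have e4 : 2 * ρ * inner ℝ (X r v) (L r v) ≤ γ * ‖X r v‖ ^ 2 := by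
      have : γ = 2 * ρ * c₁ := by rw [hρ]; field_simp
      have hρ0 : 0 < ρ := by have := H.gam_pos; positivity
      rw [this, mul_assoc (2 * ρ)]
      gcongr
    have := Real.exp_pos (2 * ρ * (r - s))
    nlinarith)
  simp only [sub_self, mul_zero, Real.exp_zero, one_mul, neg_le_neg_iff] at h3
  have h4 := h0 t ht v
  have h5 := h1 s hs v
  refine abs_le_of_sq_le_sq' ?_ (by positivity) |>.2
  have h6 : Real.exp (2 * ρ * (t - s)) * (Real.exp (-ρ * (t - s))) ^ 2 = 1 := by
    rw [← Real.exp_nat_mul, ← Real.exp_add]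
    simp; ring
  rw [mul_pow, mul_pow, Real.sq_sqrt (by positivity)]
  have h7 : Real.exp (2 * ρ * (t - s)) * (c₀ * ‖X t v‖ ^ 2) ≤ c₁ * ‖X s v‖ ^ 2 :=
    (mul_le_mul_of_nonneg_left h4 (Real.exp_pos _).le).trans (h3.trans h5)
  have h8 : ‖X t v‖ ^ 2 = (Real.exp (2 * ρ * (t - s)) * (c₀ * ‖X t v‖ ^ 2)) / c₀ *
      (Real.exp (-ρ * (t - s))) ^ 2 := by
    rw [mul_div_assoc, mul_div_cancel_left₀ _ hc₀.ne']
    linear_combination (-‖X t v‖ ^ 2) * h6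
  rw [h8]
  calc _ ≤ (c₁ * ‖X s v‖ ^ 2) / c₀ * (Real.exp (-ρ * (t - s))) ^ 2 := by gcongr
    _ = _ := by ring

end IsFundamental

end Hamiltonian


/-! ### Bounds of the value function -/

section ValueBounds

variable {V : Type*} [NormedAddCommGroup V] [InnerProductSpace ℝ V] [CompleteSpace V]
  {T γ : ℝ} {F N K : ℝ → V →L[ℝ] V} {P : V →L[ℝ] V} {x lam : ℝ → V}

/-- Every trajectory of the controlled system bounds the value function from above. -/
theorem IsHamiltonianSystem.inner_le_of_trajectory (H : IsHamiltonianSystem T γ F N K P)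
    (h : IsHamiltonianSolution T F N K x lam) {a b : ℝ} (ha : 0 ≤ a) (hab : a ≤ b) (hb : b ≤ T)
    {ξ ζ : ℝ → V} {r β β' : ℝ → ℝ} (hξ0 : ξ a = x a)
    (hξ : ∀ t ∈ Icc a b, HasDerivWithinAt ξ (F t (ξ t) + ζ t) (Icc a b) t)
    (hζ : ∀ t ∈ Icc a b, ∀ v, 0 ≤ inner ℝ v (N t v) + 2 * inner ℝ v (ζ t) + r t)
    (hβ : ∀ t ∈ Icc a b, HasDerivWithinAt β (β' t) (Icc a b) t)
    (hβ' : ∀ t ∈ Icc a b, inner ℝ (ξ t) (K t (ξ t)) + r t ≤ β' t) :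
    inner ℝ (x a) (lam a) ≤
      2 * inner ℝ (lam b) (ξ b) - inner ℝ (x b) (lam b) + β b - β a := by
  have hsub : Icc a b ⊆ Icc 0 T := Icc_subset_Icc ha hb
  -- The derivative equals `⟨x-ξ, K(x-ξ)⟩ + (⟨λ,Nλ⟩ + 2⟨λ,ζ⟩ + r) + (β' - ⟨ξ,Kξ⟩ - r)`, a sum of
  -- nonnegative terms. At `a`, where `ξ = x`, the function itself is `⟨x,λ⟩ + β`. In the
  -- application `ζ = Bω` and `r = ⟨ω,Rω⟩`.
  have hd : ∀ t ∈ Icc a b, HasDerivWithinAt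
      (fun t => 2 * inner ℝ (lam t) (ξ t) - inner ℝ (x t) (lam t) + β t)
      (2 * (inner ℝ (lam t) (F t (ξ t) + ζ t) + inner ℝ (-((F t)†) (lam t) - K t (x t)) (ξ t)) -
        (-(inner ℝ (x t) (K t (x t)) + inner ℝ (lam t) (N t (lam t)))) + β' t) (Icc a b) t := by
    intro t ht
    exact (((((h t (hsub ht)).2.mono hsub).inner ℝ (hξ t ht)).const_mul 2).sub
      ((h.hasDerivWithinAt_inner (hsub ht)).mono hsub)).add (hβ t ht)
  have h1 := le_of_hasDerivWithinAt_nonneg hab hd (fun t ht => by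
    have e1 := hζ t ht (lam t)
    have e2 := hβ' t ht
    have e3 := H.coerK t (hsub ht) (x t - ξ t)
    have e4 : 0 ≤ γ * ‖x t - ξ t‖ ^ 2 := by have := H.gam_pos; positivity
    have e5 : inner ℝ (K t (x t)) (ξ t) = inner ℝ (x t) (K t (ξ t)) := H.symmK t (hsub ht) _ _
    have e6 : inner ℝ (ξ t) (K t (x t)) = inner ℝ (x t) (K t (ξ t)) := by
      rw [← e5, real_inner_comm]
    simp only [map_sub, inner_sub_left, inner_sub_right, e6] at e3
    simp only [inner_add_right, inner_sub_left, inner_neg_left,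
      ContinuousLinearMap.adjoint_inner_left, e5]
    linarith)
  simp only [hξ0, real_inner_comm (x a) (lam a)] at h1
  linarith

/-- Every trajectory of the dual system bounds the value function from below. -/
theorem IsHamiltonianSystem.le_inner_of_dual_trajectory (H : IsHamiltonianSystem T γ F N K P)
    (h : IsHamiltonianSolution T F N K x lam) {a b : ℝ} (ha : 0 ≤ a) (hab : a ≤ b) (hb : b ≤ T)
    {y w : ℝ → V} {β β' : ℝ → ℝ}
    (hy : ∀ t ∈ Icc a b, HasDerivWithinAt y (-((F t)†) (y t) + w t) (Icc a b) t)
    (hβ : ∀ t ∈ Icc a b, HasDerivWithinAt β (β' t) (Icc a b) t)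
    (hβ' : ∀ t ∈ Icc a b, inner ℝ (y t) (N t (y t)) + ‖w t‖ ^ 2 / γ ≤ β' t) :
    2 * inner ℝ (x a) (y a) - (2 * inner ℝ (x b) (y b) - inner ℝ (x b) (lam b) + β b - β a) ≤
      inner ℝ (x a) (lam a) := by
  have hsub : Icc a b ⊆ Icc 0 T := Icc_subset_Icc ha hb
  -- Here the derivative is `⟨λ-y, N(λ-y)⟩ + (⟨x,Kx⟩ + 2⟨x,w⟩ + ‖w‖²/γ) + (β' - ⟨y,Ny⟩ - ‖w‖²/γ)`.
  -- The middle term is nonnegative because `K ⪰ γ`.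
  have hd : ∀ t ∈ Icc a b, HasDerivWithinAt
      (fun t => 2 * inner ℝ (x t) (y t) - inner ℝ (x t) (lam t) + β t)
      (2 * (inner ℝ (x t) (-((F t)†) (y t) + w t) + inner ℝ (F t (x t) - N t (lam t)) (y t)) -
        (-(inner ℝ (x t) (K t (x t)) + inner ℝ (lam t) (N t (lam t)))) + β' t) (Icc a b) t := by
    intro t ht
    exact (((((h t (hsub ht)).1.mono hsub).inner ℝ (hy t ht)).const_mul 2).sub
      ((h.hasDerivWithinAt_inner (hsub ht)).mono hsub)).add (hβ t ht)
  have h1 := le_of_hasDerivWithinAt_nonneg hab hd (fun t ht => by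
    have hγ := H.gam_pos
    have e2 := hβ' t ht
    have e3 := H.coerK t (hsub ht) (x t)
    have e4 := H.posN t (hsub ht) (lam t - y t)
    have e5 : inner ℝ (N t (lam t)) (y t) = inner ℝ (lam t) (N t (y t)) := H.symmN t (hsub ht) _ _
    have e6 : inner ℝ (y t) (N t (lam t)) = inner ℝ (lam t) (N t (y t)) := by
      rw [← e5, real_inner_comm]
    have e7 : 0 ≤ γ * ‖x t‖ ^ 2 + 2 * inner ℝ (x t) (w t) + ‖w t‖ ^ 2 / γ := by
      have e8 := sq_nonneg (γ * ‖x t‖ - ‖w t‖)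
      have e9 := abs_le.1 (abs_real_inner_le_norm (x t) (w t)) |>.1
      have e10 : 0 ≤ (γ * ‖x t‖ - ‖w t‖) ^ 2 / γ := by positivity
      have e11 : (γ * ‖x t‖ - ‖w t‖) ^ 2 / γ =
          γ * ‖x t‖ ^ 2 - 2 * (‖x t‖ * ‖w t‖) + ‖w t‖ ^ 2 / γ := by
        field_simp; ring
      linarith
    simp only [map_sub, inner_sub_left, inner_sub_right, e6] at e4
    simp only [inner_add_right, inner_sub_left, inner_neg_right,
      ContinuousLinearMap.adjoint_inner_right, e5]
    linarith)
  linarith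

variable [FiniteDimensional ℝ V]

theorem exp_two_mul_eq_sq (a : ℝ) : Real.exp (2 * a) = Real.exp a ^ 2 := by
  rw [← Real.exp_nat_mul]; norm_num

theorem hasDerivAt_exp_primitive {κ : ℝ} (hκ : 0 < κ) (c a t : ℝ) :
    HasDerivAt (fun s => c * (Real.exp (2 * (κ * (s - a))) / (2 * κ)))
      (c * Real.exp (2 * (κ * (t - a)))) t := by
  have h2 : HasDerivAt (fun s => Real.exp (2 * (κ * (s - a))))
      (Real.exp (2 * (κ * (t - a))) * (2 * κ)) t := by
    simpa using ((((hasDerivAt_id t).sub_const a).const_mul κ).const_mul 2).exp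
  refine ((h2.div_const (2 * κ)).const_mul c).congr_deriv ?_
  field_simp

/-- When at most `σ` of the horizon is left, no steering is needed. The uncontrolled trajectory `ξ'
= Fξ` grows at most like `exp(κ(t-a))`; the `1` in the constant pays for the terminal cost, the
`1/(2κ)` for the running cost. -/
theorem IsHamiltonianSystem.inner_le_tail (H : IsHamiltonianSystem T γ F N K P)
    (h : IsHamiltonianSolution T F N K x lam) (hT : lam T = P (x T)) {κ q σ : ℝ} (hκ : 0 < κ)
    (hF : ∀ t ∈ Icc 0 T, ‖F t‖ ≤ κ) (hq : 0 ≤ q)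
    (hK : ∀ t ∈ Icc 0 T, ∀ v, inner ℝ v (K t v) ≤ q * ‖v‖ ^ 2)
    (hP : ∀ v, inner ℝ v (P v) ≤ q * ‖v‖ ^ 2) {a : ℝ} (ha : a ∈ Icc 0 T) (haσ : T - a ≤ σ) :
    inner ℝ (x a) (lam a) ≤
      q * (1 + 1 / (2 * κ)) * Real.exp (2 * (κ * σ)) * ‖x a‖ ^ 2 := by
  have hsub : Icc a T ⊆ Icc 0 T := Icc_subset_Icc_left ha.1
  obtain ⟨Z, hZ, hZ'⟩ := exists_fundamental H.T_pos H.contF ha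
  have hξ : ∀ t ∈ Icc 0 T, HasDerivWithinAt (fun t => Z t (x a)) (F t (Z t (x a))) (Icc 0 T) t :=
    fun t ht => by simpa using hasDerivWithinAt_apply (hZ' t ht) (x a)
  have hn : ∀ t ∈ Icc a T, ‖Z t (x a)‖ ^ 2 ≤ ‖x a‖ ^ 2 * Real.exp (2 * (κ * (t - a))) := by
    intro t ht
    have hs : Icc a t ⊆ Icc 0 T := Icc_subset_Icc ha.1 ht.2
    have := norm_le_exp_of_norm_deriv_le (κ := κ) ht.1 (fun s hs' => (hξ s (hs hs')).mono hs)
      (fun s hs' => ((F s).le_opNorm _).trans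
        (mul_le_mul_of_nonneg_right (hF s (hs hs')) (norm_nonneg _)))
    simp only [hZ, one_apply_eq_self] at this
    rw [exp_two_mul_eq_sq, ← mul_pow, mul_comm]
    gcongr
  have key := H.inner_le_of_trajectory h ha.1 ha.2 le_rfl (ξ := fun t => Z t (x a))
    (ζ := fun _ => 0) (r := fun _ => 0)
    (β := fun s => (q * ‖x a‖ ^ 2) * (Real.exp (2 * (κ * (s - a))) / (2 * κ)))
    (by simp [hZ]) (fun t ht => by simpa using (hξ t (hsub ht)).mono hsub)
    (fun t ht v => by simpa using H.posN t (hsub ht) v)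
    (fun t ht => (hasDerivAt_exp_primitive hκ _ a t).hasDerivWithinAt)
    (fun t ht => by
      have := hK t (hsub ht) (Z t (x a))
      have := mul_le_mul_of_nonneg_left (hn t ht) hq
      linarith)
  -- Positivity of `P` on `x(T) - ξ(T)` bounds the terminal term `2⟨λ(T), ξ(T)⟩ - ⟨x(T), λ(T)⟩` by
  -- the terminal cost `⟨ξ(T), Pξ(T)⟩`.
  have e1 := H.coerP (x T - Z T (x a))
  have e2 : 0 ≤ γ * ‖x T - Z T (x a)‖ ^ 2 := by have := H.gam_pos; positivity
  have e3 : inner ℝ (Z T (x a)) (P (x T)) = inner ℝ (x T) (P (Z T (x a))) := by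
    rw [← H.symmP, real_inner_comm]
  simp only [map_sub, inner_sub_left, inner_sub_right, e3] at e1
  have e4 := hP (Z T (x a))
  have e5 := mul_le_mul_of_nonneg_left (hn T ⟨ha.2, le_rfl⟩) hq
  simp only [hT, H.symmP, sub_self, mul_zero, Real.exp_zero] at key
  have e6 : Real.exp (2 * (κ * (T - a))) ≤ Real.exp (2 * (κ * σ)) := by gcongr
  have e7 : 0 ≤ (q * ‖x a‖ ^ 2) * (1 / (2 * κ)) := by positivity
  have e8 : (q * ‖x a‖ ^ 2 * (1 + 1 / (2 * κ))) * Real.exp (2 * (κ * (T - a))) ≤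
      (q * ‖x a‖ ^ 2 * (1 + 1 / (2 * κ))) * Real.exp (2 * (κ * σ)) := by gcongr
  calc inner ℝ (x a) (lam a) ≤
      (q * ‖x a‖ ^ 2 * (1 + 1 / (2 * κ))) * Real.exp (2 * (κ * (T - a))) := by
        rw [div_eq_mul_one_div] at key
        nlinarith
    _ ≤ _ := e8.trans (le_of_eq (by ring))

/-- The dual trajectory is `y' = -Fᵀy` with `y(a) = c x(a)`. It gives `2c‖x‖² - c²S‖x‖²`, where `S`
is the factor of `c` in `hc'`, and this is at least `c‖x‖²` as soon as `cS ≤ 1`. -/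
theorem IsHamiltonianSystem.le_inner_tail (H : IsHamiltonianSystem T γ F N K P)
    (h : IsHamiltonianSolution T F N K x lam) (hT : lam T = P (x T)) {κ ν σ c : ℝ} (hκ : 0 < κ)
    (hF : ∀ t ∈ Icc 0 T, ‖F t‖ ≤ κ) (hν : 0 ≤ ν)
    (hN : ∀ t ∈ Icc 0 T, ∀ v, inner ℝ v (N t v) ≤ ν * ‖v‖ ^ 2)
    (hc : 0 ≤ c) (hc' : c * (Real.exp (2 * (κ * σ)) * (ν / (2 * κ) + 1 / γ)) ≤ 1)
    {a : ℝ} (ha : a ∈ Icc 0 T) (haσ : T - a ≤ σ) :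
    c * ‖x a‖ ^ 2 ≤ inner ℝ (x a) (lam a) := by
  have hγ := H.gam_pos
  have hsub : Icc a T ⊆ Icc 0 T := Icc_subset_Icc_left ha.1
  obtain ⟨Z, hZ, hZ'⟩ := exists_fundamental H.T_pos (M := fun t => -((F t)†))
    (continuousOn_adjoint H.contF).neg ha
  have hy : ∀ t ∈ Icc 0 T, HasDerivWithinAt (fun t => Z t (c • x a))
      (-((F t)†) (Z t (c • x a))) (Icc 0 T) t :=
    fun t ht => by simpa using hasDerivWithinAt_apply (hZ' t ht) (c • x a)
  have hn : ∀ t ∈ Icc a T,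
      ‖Z t (c • x a)‖ ^ 2 ≤ c ^ 2 * ‖x a‖ ^ 2 * Real.exp (2 * (κ * (t - a))) := by
    intro t ht
    have hs : Icc a t ⊆ Icc 0 T := Icc_subset_Icc ha.1 ht.2
    have := norm_le_exp_of_norm_deriv_le (κ := κ) ht.1 (fun s hs' => (hy s (hs hs')).mono hs)
      (fun s hs' => by
        rw [norm_neg]
        refine (ContinuousLinearMap.le_opNorm _ _).trans
          (mul_le_mul_of_nonneg_right ?_ (norm_nonneg _))
        simpa using hF s (hs hs'))
    simp only [hZ, one_apply_eq_self, norm_smul, Real.norm_eq_abs, abs_of_nonneg hc] at this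
    rw [exp_two_mul_eq_sq, ← mul_pow, ← mul_pow, mul_comm]
    gcongr
  have key := H.le_inner_of_dual_trajectory h ha.1 ha.2 le_rfl (y := fun t => Z t (c • x a))
    (w := fun _ => 0)
    (β := fun s => (ν * (c ^ 2 * ‖x a‖ ^ 2)) * (Real.exp (2 * (κ * (s - a))) / (2 * κ)))
    (fun t ht => by simpa using (hy t (hsub ht)).mono hsub)
    (fun t ht => (hasDerivAt_exp_primitive hκ _ a t).hasDerivWithinAt)
    (fun t ht => by
      have := hN t (hsub ht) (Z t (c • x a))
      have := mul_le_mul_of_nonneg_left (hn t ht) hν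
      rw [norm_zero, zero_pow two_ne_zero, zero_div]
      linarith)
  have e1 := H.coerP (x T)
  have e5 := hn T ⟨ha.2, le_rfl⟩
  simp only [hT, hZ, one_apply_eq_self, inner_smul_right, real_inner_self_eq_norm_sq, sub_self,
    mul_zero, Real.exp_zero] at key
  -- The terminal part `2⟨x,y⟩ - ⟨x,Px⟩` at `T` is at most `‖y‖²/γ`, since `P ⪰ γ`.
  have e7 : 2 * inner ℝ (x T) (Z T (c • x a)) ≤ γ * ‖x T‖ ^ 2 + ‖Z T (c • x a)‖ ^ 2 / γ := by
    have e9 := real_inner_le_norm (x T) (Z T (c • x a))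
    have e10 : 0 ≤ (γ * ‖x T‖ - ‖Z T (c • x a)‖) ^ 2 / γ := by positivity
    have e11 : (γ * ‖x T‖ - ‖Z T (c • x a)‖) ^ 2 / γ =
        γ * ‖x T‖ ^ 2 - 2 * (‖x T‖ * ‖Z T (c • x a)‖) + ‖Z T (c • x a)‖ ^ 2 / γ := by
      field_simp; ring
    linarith
  have e12 : ‖Z T (c • x a)‖ ^ 2 / γ ≤
      c ^ 2 * ‖x a‖ ^ 2 * Real.exp (2 * (κ * (T - a))) / γ := by gcongr
  have e6 : Real.exp (2 * (κ * (T - a))) ≤ Real.exp (2 * (κ * σ)) := by gcongr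
  have e13 : c ^ 2 * ‖x a‖ ^ 2 * Real.exp (2 * (κ * (T - a))) / γ +
      (ν * (c ^ 2 * ‖x a‖ ^ 2)) * (Real.exp (2 * (κ * (T - a))) / (2 * κ)) ≤
      c * ‖x a‖ ^ 2 := by
    calc _ = c * ‖x a‖ ^ 2 * (c * (Real.exp (2 * (κ * (T - a))) * (ν / (2 * κ) + 1 / γ))) := by
          ring
      _ ≤ c * ‖x a‖ ^ 2 * (c * (Real.exp (2 * (κ * σ)) * (ν / (2 * κ) + 1 / γ))) := by gcongr
      _ ≤ c * ‖x a‖ ^ 2 * 1 := by gcongr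
      _ = _ := by ring
  have e14 : 0 ≤ ν * (c ^ 2 * ‖x a‖ ^ 2) * (1 / (2 * κ)) := by positivity
  linarith

omit [FiniteDimensional ℝ V] in
-- The dual trajectory is the linear ramp from `c x(a)` down to `0` at `a + σ`, made admissible by
-- `w = y' + Fᵀy`. At the end of the window `y` vanishes and only `⟨x,λ⟩ ≥ 0` is left, which can be
-- dropped. The size of `w` is at most `(1/σ + κ) c‖x(a)‖`.
theorem IsHamiltonianSystem.le_inner_window (H : IsHamiltonianSystem T γ F N K P)
    (h : IsHamiltonianSolution T F N K x lam) (hT : lam T = P (x T)) {κ ν σ c : ℝ} (hκ : 0 < κ)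
    (hσ : 0 < σ)
    (hF : ∀ t ∈ Icc 0 T, ‖F t‖ ≤ κ) (hν : 0 ≤ ν)
    (hN : ∀ t ∈ Icc 0 T, ∀ v, inner ℝ v (N t v) ≤ ν * ‖v‖ ^ 2)
    (hc : 0 ≤ c) (hc' : c * (ν * σ + (1 + κ * σ) ^ 2 / (σ * γ)) ≤ 1)
    {a : ℝ} (ha : 0 ≤ a) (haσ : a + σ ≤ T) :
    c * ‖x a‖ ^ 2 ≤ inner ℝ (x a) (lam a) := by
  have hγ := H.gam_pos
  have hsub : Icc a (a + σ) ⊆ Icc 0 T := Icc_subset_Icc ha haσ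
  have hd : ∀ t, HasDerivAt (fun t => 1 - (t - a) / σ) (-(1 / σ)) t := fun t => by
    simpa using (((hasDerivAt_id t).sub_const a).div_const σ).const_sub 1
  have h01 : ∀ t ∈ Icc a (a + σ), |1 - (t - a) / σ| ≤ 1 := fun t ht => by
    have h1 : 0 ≤ (t - a) / σ := div_nonneg (by linarith [ht.1]) hσ.le
    have h2 : (t - a) / σ ≤ 1 := (div_le_one hσ).2 (by linarith [ht.2])
    rw [abs_le]; constructor <;> linarith
  have key := H.le_inner_of_dual_trajectory h ha (by linarith : a ≤ a + σ) haσ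
    (y := fun t => (1 - (t - a) / σ) • c • x a)
    (w := fun t => (-(1 / σ)) • c • x a + ((F t)†) ((1 - (t - a) / σ) • c • x a))
    (β := fun t => (c ^ 2 * ‖x a‖ ^ 2 * (ν + (1 / σ + κ) ^ 2 / γ)) * (t - a))
    (β' := fun _ => c ^ 2 * ‖x a‖ ^ 2 * (ν + (1 / σ + κ) ^ 2 / γ))
    (fun t ht => by
      refine ((hd t).hasDerivWithinAt.smul_const (c • x a)).congr_deriv ?_
      abel)
    (fun t ht => by
      simpa using (((hasDerivAt_id t).sub_const a).const_mul
        (c ^ 2 * ‖x a‖ ^ 2 * (ν + (1 / σ + κ) ^ 2 / γ))).hasDerivWithinAt)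
    (fun t ht => by
      have h1 : ‖(1 - (t - a) / σ) • c • x a‖ ≤ c * ‖x a‖ := by
        rw [norm_smul, norm_smul, Real.norm_eq_abs, Real.norm_eq_abs, abs_of_nonneg hc]
        exact mul_le_of_le_one_left (by positivity) (h01 t ht)
      have h2 : ‖(-(1 / σ)) • c • x a + ((F t)†) ((1 - (t - a) / σ) • c • x a)‖ ≤
          (1 / σ + κ) * (c * ‖x a‖) := by
        refine (norm_add_le _ _).trans ?_
        rw [add_mul]
        refine add_le_add (le_of_eq ?_) ?_
        · rw [norm_smul, norm_smul, Real.norm_eq_abs, Real.norm_eq_abs, abs_of_nonneg hc, abs_neg,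
            abs_of_pos (by positivity)]
        · refine (ContinuousLinearMap.le_opNorm _ _).trans ?_
          rw [LinearIsometryEquiv.norm_map]
          exact mul_le_mul (hF t (hsub ht)) h1 (norm_nonneg _) hκ.le
      have h3 := hN t (hsub ht) ((1 - (t - a) / σ) • c • x a)
      have h4 : ‖(1 - (t - a) / σ) • c • x a‖ ^ 2 ≤ (c * ‖x a‖) ^ 2 := by gcongr
      have h5 : ‖(-(1 / σ)) • c • x a + ((F t)†) ((1 - (t - a) / σ) • c • x a)‖ ^ 2 / γ ≤
          ((1 / σ + κ) * (c * ‖x a‖)) ^ 2 / γ := by gcongr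
      calc _ ≤ ν * (c * ‖x a‖) ^ 2 + ((1 / σ + κ) * (c * ‖x a‖)) ^ 2 / γ :=
            add_le_add (h3.trans (mul_le_mul_of_nonneg_left h4 hν)) h5
        _ = _ := by ring)
  have hbT : a + σ ∈ Icc 0 T := ⟨by linarith, haσ⟩
  have e0 : 0 ≤ inner ℝ (x (a + σ)) (lam (a + σ)) := by
    refine le_trans ?_ (H.le_inner h hT hbT)
    positivity
  simp only [sub_self, zero_div, sub_zero, one_smul, add_sub_cancel_left, div_self hσ.ne',
    zero_smul, inner_zero_right, mul_zero, inner_smul_right, real_inner_self_eq_norm_sq] at key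
  have e1 : c ^ 2 * ‖x a‖ ^ 2 * (ν + (1 / σ + κ) ^ 2 / γ) * σ ≤ c * ‖x a‖ ^ 2 := by
    calc _ = c * ‖x a‖ ^ 2 * (c * (ν * σ + (1 + κ * σ) ^ 2 / (σ * γ))) := by field_simp
      _ ≤ c * ‖x a‖ ^ 2 * 1 := by gcongr
      _ = _ := by ring
  linarith

end ValueBounds


/-! ### The inhomogeneous boundary value problem -/

theorem intervalIntegrable_clm_apply {E F : Type*} [NormedAddCommGroup E] [NormedSpace ℝ E]
    [NormedAddCommGroup F] [NormedSpace ℝ F] {T : ℝ} (hT : 0 ≤ T) {M : ℝ → E →L[ℝ] F} {g : ℝ → E}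
    (hM : ContinuousOn M (Icc 0 T)) (hg : IntervalIntegrable g volume 0 T) :
    IntervalIntegrable (fun t => M t (g t)) volume 0 T := by
  obtain ⟨C, hC⟩ := isCompact_Icc.exists_bound_of_continuousOn hM
  exact intervalIntegrable_bilin (ContinuousLinearMap.id ℝ (E →L[ℝ] F)).flip hT hg
    ((hM.mono Ioc_subset_Icc_self).aestronglyMeasurable measurableSet_Ioc)
    fun t ht => hC t (Ioc_subset_Icc_self ht)

section BoundaryValue

variable {V : Type*} [NormedAddCommGroup V] [InnerProductSpace ℝ V] [CompleteSpace V]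

/-- Solutions of the inhomogeneous Hamiltonian system with forcing `f`, `g`, initial value `x₀`,
terminal inhomogeneity `e`, and jumps `p` of the state and `-q` of the adjoint at `t'`. -/
structure IsBVPSolution (T t' : ℝ) (F N K : ℝ → V →L[ℝ] V) (P : V →L[ℝ] V) (f g : ℝ → V)
    (x₀ e p q : V) (x lam : ℝ → V) : Prop where
  state : HasJumpPrimitive T t' x x₀ (fun t => F t (x t) - N t (lam t) + f t) p
  adj : ∃ l₀, HasJumpPrimitive T t' lam l₀
    (fun t => -((F t)†) (lam t) - K t (x t) - g t) (-q)
  right : lam T = P (x T) + e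

/-- The function `Xᵀ λ - Lᵀ x` of a solution. -/
noncomputable def bvpR (T t' : ℝ) (X L : ℝ → V →L[ℝ] V) (f g : ℝ → V) (e p q : V) (t : ℝ) : V :=
  e + (∫ s in t..T, (((X s)†) (g s) + ((L s)†) (f s))) +
    if t < t' then ((X t')†) q + ((L t')†) p else 0

/-- The function `Y x` of a solution. -/
noncomputable def bvpW (T t' : ℝ) (N X L Y : ℝ → V →L[ℝ] V) (f g : ℝ → V) (x₀ e p q : V)
    (t : ℝ) : V :=
  Y 0 x₀ + (∫ s in (0 : ℝ)..t, Y s (f s - N s (((Y s)†) (bvpR T t' X L f g e p q s)))) +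
    if t' ≤ t then Y t' p else 0

variable {T γ t' : ℝ} {F N K : ℝ → V →L[ℝ] V} {P : V →L[ℝ] V} {X L Y : ℝ → V →L[ℝ] V}
  {f g : ℝ → V} {x₀ e p q : V} {x lam : ℝ → V}

theorem IsBVPSolution.sub {f' g' x' lam' : ℝ → V} {x₀' e' p' q' : V}
    (h : IsBVPSolution T t' F N K P f g x₀ e p q x lam)
    (h' : IsBVPSolution T t' F N K P f' g' x₀' e' p' q' x' lam') (hT : 0 ≤ T) :
    IsBVPSolution T t' F N K P (fun t => f t - f' t) (fun t => g t - g' t) (x₀ - x₀') (e - e')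
      (p - p') (q - q') (fun t => x t - x' t) (fun t => lam t - lam' t) := by
  obtain ⟨l, hl⟩ := h.adj
  obtain ⟨l', hl'⟩ := h'.adj
  refine ⟨(h.state.sub h'.state).congr hT (fun _ _ => rfl) rfl (fun t _ => ?_) rfl,
    ⟨l - l', (hl.sub hl').congr hT (fun _ _ => rfl) rfl (fun t _ => ?_) (by abel)⟩, ?_⟩
  · simp only [map_sub]; abel
  · simp only [map_sub]; abel
  · rw [h.right, h'.right, map_sub]; abel

namespace IsHamiltonianSystem

theorem adjN (H : IsHamiltonianSystem T γ F N K P) {t : ℝ} (ht : t ∈ Icc 0 T) :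
    (N t)† = N t :=
  ((ContinuousLinearMap.eq_adjoint_iff _ _).2 (H.symmN t ht)).symm

theorem adjK (H : IsHamiltonianSystem T γ F N K P) {t : ℝ} (ht : t ∈ Icc 0 T) :
    (K t)† = K t :=
  ((ContinuousLinearMap.eq_adjoint_iff _ _).2 (H.symmK t ht)).symm

theorem adjP (H : IsHamiltonianSystem T γ F N K P) : P† = P :=
  ((ContinuousLinearMap.eq_adjoint_iff _ _).2 H.symmP).symm

end IsHamiltonianSystem

namespace IsFundamental

theorem contX (h : IsFundamental T F N K P X L Y) : ContinuousOn X (Icc 0 T) :=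
  fun t ht => (h.derivX t ht).continuousWithinAt

theorem contL (h : IsFundamental T F N K P X L Y) : ContinuousOn L (Icc 0 T) :=
  fun t ht => (h.derivL t ht).continuousWithinAt

theorem contY (h : IsFundamental T F N K P X L Y) : ContinuousOn Y (Icc 0 T) :=
  fun t ht => (h.derivY t ht).continuousWithinAt

theorem adjoint_YX (h : IsFundamental T F N K P X L Y) {t : ℝ} (ht : t ∈ Icc 0 T) (v : V) :
    ((Y t)†) (((X t)†) v) = v := by
  refine ext_inner_right ℝ fun w => ?_
  rw [ContinuousLinearMap.adjoint_inner_left, ContinuousLinearMap.adjoint_inner_left, h.XY t ht]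

theorem adjoint_YL (h : IsFundamental T F N K P X L Y) {t : ℝ} (ht : t ∈ Icc 0 T) (v : V) :
    ((Y t)†) (((L t)†) v) = L t (Y t v) := by
  refine ext_inner_right ℝ fun w => ?_
  rw [ContinuousLinearMap.adjoint_inner_left, ContinuousLinearMap.adjoint_inner_left,
    h.symm_riccati ht]

theorem primitiveX (H : IsHamiltonianSystem T γ F N K P) (h : IsFundamental T F N K P X L Y)
    (t' : ℝ) : HasJumpPrimitive T t' X (X 0) (fun t => F t ∘L X t - N t ∘L L t) 0 := by
  have := H.contF
  have := H.contN
  have := h.contX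
  have := h.contL
  exact .of_hasDerivWithinAt t' H.T_pos.le h.derivX (by fun_prop)

theorem primitiveL (H : IsHamiltonianSystem T γ F N K P) (h : IsFundamental T F N K P X L Y)
    (t' : ℝ) : HasJumpPrimitive T t' L (L 0) (fun t => -((F t)†) ∘L L t - K t ∘L X t) 0 := by
  have := continuousOn_adjoint H.contF
  have := H.contK
  have := h.contX
  have := h.contL
  exact .of_hasDerivWithinAt t' H.T_pos.le h.derivL (by fun_prop)

theorem primitiveY (H : IsHamiltonianSystem T γ F N K P) (h : IsFundamental T F N K P X L Y)
    (t' : ℝ) : HasJumpPrimitive T t' Y (Y 0)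
      (fun t => -(Y t ∘L (F t ∘L X t - N t ∘L L t) ∘L Y t)) 0 := by
  have := H.contF
  have := H.contN
  have := h.contX
  have := h.contL
  have := h.contY
  exact .of_hasDerivWithinAt t' H.T_pos.le h.derivY (by fun_prop)

end IsFundamental

theorem HasJumpPrimitive.adjoint {y y' : ℝ → V →L[ℝ] V} {y₀ : V →L[ℝ] V}
    (hy : HasJumpPrimitive T t' y y₀ y' 0) :
    HasJumpPrimitive T t' (fun t => (y t)†) (y₀†) (fun t => (y' t)†) 0 := by
  refine ⟨hy.int.clm_map adjointL, fun t ht => ?_⟩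
  have := (adjointL (V := V) (W := V)).intervalIntegral_comp_comm (hy.int.of_mem_Icc ht)
  simp only [adjointL_apply] at this
  rw [this, hy.eq t ht]
  simp

/-- Application of an operator-valued to a vector-valued function. -/
theorem HasJumpPrimitive.apply {M M' : ℝ → V →L[ℝ] V} {M₀ : V →L[ℝ] V} {z k : ℝ → V} {z₀ p : V}
    (hT : 0 ≤ T) (ht' : t' ∈ Icc 0 T)
    (hM : HasJumpPrimitive T t' M M₀ M' 0) (hz : HasJumpPrimitive T t' z z₀ k p) :
    HasJumpPrimitive T t' (fun t => M t (z t)) (M₀ z₀) (fun t => M' t (z t) + M t (k t))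
      (M t' p) :=
  HasJumpPrimitive.bilin (ContinuousLinearMap.id ℝ (V →L[ℝ] V)) hT ht' hM hz

namespace IsFundamental

theorem integrable_bvpR (H : IsHamiltonianSystem T γ F N K P) (h : IsFundamental T F N K P X L Y)
    (hf : IntervalIntegrable f volume 0 T) (hg : IntervalIntegrable g volume 0 T) :
    IntervalIntegrable (fun s => ((X s)†) (g s) + ((L s)†) (f s)) volume 0 T :=
  (intervalIntegrable_clm_apply H.T_pos.le (continuousOn_adjoint h.contX) hg).add
    (intervalIntegrable_clm_apply H.T_pos.le (continuousOn_adjoint h.contL) hf)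

/-- In the derivative of `Xᵀλ - Lᵀx` the homogeneous terms cancel as in the Wronskian, leaving
`-(Xᵀg + Lᵀf)`. At `T` the value is `λ - Px = e`, so the function is an explicit integral taken from
the right. -/
theorem bvpR_eq (H : IsHamiltonianSystem T γ F N K P) (h : IsFundamental T F N K P X L Y)
    (ht' : t' ∈ Icc 0 T)
    (hs : IsBVPSolution T t' F N K P f g x₀ e p q x lam) {t : ℝ} (ht : t ∈ Icc 0 T) :
    ((X t)†) (lam t) - ((L t)†) (x t) = bvpR T t' X L f g e p q t := by
  obtain ⟨l₀, hl⟩ := hs.adj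
  have hT := H.T_pos.le
  have h1 := HasJumpPrimitive.apply hT ht' (h.primitiveX H t').adjoint hl
  have h2 := HasJumpPrimitive.apply hT ht' (h.primitiveL H t').adjoint hs.state
  have h3 := (h1.sub h2).congr hT (k := fun s => -(((X s)†) (g s) + ((L s)†) (f s)))
    (q := -(((X t')†) q + ((L t')†) p)) (fun _ _ => rfl) rfl
    (fun s hs => by
      simp only [map_sub, map_neg, map_add, ContinuousLinearMap.adjoint_comp, H.adjN hs,
        H.adjK hs, sub_apply, neg_apply, ContinuousLinearMap.comp_apply,
        ContinuousLinearMap.adjoint_adjoint]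
      abel) (by rw [map_neg]; abel)
  rw [h3.eq_right hT ht'.2 ht]
  simp only [h.X_right, h.L_right, hs.right, H.adjP, bvpR, intervalIntegral.integral_neg,
    sub_neg_eq_add]
  have e1 : ((1 : V →L[ℝ] V)†) = 1 := by
    refine (ContinuousLinearMap.eq_adjoint_iff _ _).2 (fun x y => rfl) |>.symm
  rw [e1, one_apply_eq_self]
  split_ifs <;> abel

/-- The representation of the solutions of the boundary value problem. -/
theorem eq_bvpW (H : IsHamiltonianSystem T γ F N K P) (h : IsFundamental T F N K P X L Y)
    (ht' : t' ∈ Icc 0 T)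
    (hs : IsBVPSolution T t' F N K P f g x₀ e p q x lam) {t : ℝ} (ht : t ∈ Icc 0 T) :
    x t = X t (bvpW T t' N X L Y f g x₀ e p q t) ∧
    lam t = L t (bvpW T t' N X L Y f g x₀ e p q t) +
      ((Y t)†) (bvpR T t' X L f g e p q t) := by
  have hT := H.T_pos.le
  -- Applying `Yᵀ` to `Xᵀλ - Lᵀx` recovers `λ` as Riccati feedback plus a feedforward term, because
  -- `YᵀXᵀ = 1` and `YᵀLᵀ = LY` by symmetry.
  have hlam : ∀ s ∈ Icc 0 T, lam s = L s (Y s (x s)) + ((Y s)†) (bvpR T t' X L f g e p q s) := by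
    intro s hs'
    rw [← h.bvpR_eq H ht' hs hs', map_sub, h.adjoint_YX hs', h.adjoint_YL hs']
    abel
  -- With `λ = LYx + Yᵀr` inserted, the closed-loop terms `F - NLY` cancel in `(Yx)'`, and only `Y(f
  -- - N Yᵀ r)` remains.
  have h1 := HasJumpPrimitive.apply hT ht' (h.primitiveY H t') hs.state
  have h2 : Y t (x t) = bvpW T t' N X L Y f g x₀ e p q t := by
    refine ((h1.congr hT
      (k := fun s => Y s (f s - N s (((Y s)†) (bvpR T t' X L f g e p q s))))
      (fun _ _ => rfl) rfl (fun s hs' => ?_) rfl).eq t ht)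
    rw [hlam s hs']
    simp only [map_sub, map_add, sub_apply, neg_apply, ContinuousLinearMap.comp_apply,
      h.XY s hs']
    abel
  rw [← h2, h.XY t ht, ← hlam t ht]
  exact ⟨rfl, rfl⟩

theorem hasJumpPrimitive_bvpR (H : IsHamiltonianSystem T γ F N K P)
    (h : IsFundamental T F N K P X L Y)
    (hf : IntervalIntegrable f volume 0 T) (hg : IntervalIntegrable g volume 0 T) :
    ∃ r₀, HasJumpPrimitive T t' (bvpR T t' X L f g e p q) r₀
      (fun s => -(((X s)†) (g s) + ((L s)†) (f s))) (-(((X t')†) q + ((L t')†) p)) := by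
  refine ⟨_, HasJumpPrimitive.of_eq_right (h := fun s => -(((X s)†) (g s) + ((L s)†) (f s)))
    (h.integrable_bvpR H hf hg).neg (yT := e) fun t ht => ?_⟩
  simp only [bvpR, intervalIntegral.integral_neg, sub_neg_eq_add]
  split_ifs <;> abel

/-- The representation formula is read backwards: `x = Xw` and `λ = Lw + Yᵀr` are differentiated by
the product rule. -/
theorem exists_isBVPSolution (H : IsHamiltonianSystem T γ F N K P)
    (h : IsFundamental T F N K P X L Y) (ht' : t' ∈ Icc 0 T)
    (hf : IntervalIntegrable f volume 0 T) (hg : IntervalIntegrable g volume 0 T)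
    (x₀ e p q : V) :
    ∃ x lam, IsBVPSolution T t' F N K P f g x₀ e p q x lam := by
  have hT := H.T_pos.le
  have hTm : T ∈ Icc 0 T := ⟨hT, le_rfl⟩
  obtain ⟨r₀, hr⟩ := h.hasJumpPrimitive_bvpR (t' := t') (e := e) (p := p) (q := q) H hf hg
  set r := bvpR T t' X L f g e p q with hr'
  have hi : IntervalIntegrable (fun s => Y s (f s - N s (((Y s)†) (r s)))) volume 0 T :=
    intervalIntegrable_clm_apply hT h.contY (hf.sub (intervalIntegrable_clm_apply hT H.contN
      (intervalIntegrable_clm_apply hT (continuousOn_adjoint h.contY) (hr.intervalIntegrable hT))))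
  have hw : HasJumpPrimitive T t' (bvpW T t' N X L Y f g x₀ e p q) (Y 0 x₀)
      (fun s => Y s (f s - N s (((Y s)†) (r s)))) (Y t' p) := ⟨hi, fun t _ => rfl⟩
  set w := bvpW T t' N X L Y f g x₀ e p q with hw'
  refine ⟨fun t => X t (w t), fun t => L t (w t) + ((Y t)†) (r t), ?_,
    ⟨L 0 (Y 0 x₀) + ((Y 0)†) r₀, ?_⟩, ?_⟩
  · refine (HasJumpPrimitive.apply hT ht' (h.primitiveX H t') hw).congr hT (fun _ _ => rfl)
      (h.XY 0 ⟨le_rfl, hT⟩ _).symm (fun s hs => ?_) (h.XY t' ht' _).symm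
    simp only [map_add, sub_apply, ContinuousLinearMap.comp_apply, h.XY s hs]
    abel
  · refine ((HasJumpPrimitive.apply hT ht' (h.primitiveL H t') hw).add
      (HasJumpPrimitive.apply hT ht' (h.primitiveY H t').adjoint hr)).congr hT (fun _ _ => rfl)
      rfl (fun s hs => ?_) ?_
    · simp only [map_add, map_sub, map_neg, sub_apply, neg_apply, ContinuousLinearMap.comp_apply,
        ContinuousLinearMap.adjoint_comp, H.adjN hs, h.adjoint_YX hs, h.adjoint_YL hs]
      abel
    · simp only [map_neg, map_add, h.adjoint_YX ht', h.adjoint_YL ht']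
      abel
  · have e1 : Y T = 1 := by
      ext v
      simpa [h.X_right] using h.XY T hTm v
    have e2 : ((1 : V →L[ℝ] V)†) = 1 := by
      refine (ContinuousLinearMap.eq_adjoint_iff _ _).2 (fun x y => rfl) |>.symm
    simp [h.L_right, h.X_right, e1, e2, hr', bvpR, not_lt.2 ht'.2]

end IsFundamental

end BoundaryValue


/-! ### Decay of the effect of a point source -/

theorem norm_le_of_inner_le {V : Type*} [NormedAddCommGroup V] [InnerProductSpace ℝ V] {v : V}
    {C : ℝ} (hC : 0 ≤ C) (h : ∀ w, inner ℝ v w ≤ C * ‖w‖) : ‖v‖ ≤ C := by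
  have := h v
  rw [real_inner_self_eq_norm_sq, sq] at this
  rcases (norm_nonneg v).eq_or_lt with h0 | h0
  · rwa [← h0]
  · exact le_of_mul_le_mul_right this h0

/-- The exponents add up to `-ρ(t + t' - 2s)`, which at `s = min t t'` is `-ρ|t - t'|`. The integral
describes an influence that travels backwards from `t'` to `s` and then forwards to `t`. -/
theorem integral_exp_mul_exp_le {ρ t t' : ℝ} (hρ : 0 < ρ) :
    ∫ s in (0 : ℝ)..min t t', Real.exp (-ρ * (t - s)) * Real.exp (-ρ * (t' - s)) ≤
      Real.exp (-ρ * |t - t'|) / (2 * ρ) := by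
  have h1 : ∀ s ∈ uIcc 0 (min t t'), HasDerivAt
      (fun s => Real.exp (-ρ * (t + t' - 2 * s)) / (2 * ρ))
      (Real.exp (-ρ * (t - s)) * Real.exp (-ρ * (t' - s))) s := by
    intro s _
    have h2 : HasDerivAt (fun s => Real.exp (-ρ * (t + t' - 2 * s)))
        (Real.exp (-ρ * (t + t' - 2 * s)) * (-ρ * -(2 * 1))) s :=
      ((((hasDerivAt_id s).const_mul 2).const_sub (t + t')).const_mul (-ρ)).exp
    refine (h2.div_const (2 * ρ)).congr_deriv ?_
    rw [← Real.exp_add, show -ρ * (t - s) + -ρ * (t' - s) = -ρ * (t + t' - 2 * s) by ring]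
    field_simp
  rw [intervalIntegral.integral_eq_sub_of_hasDerivAt h1
    (Continuous.intervalIntegrable (by fun_prop) _ _)]
  have h3 : t + t' - 2 * min t t' = |t - t'| := by
    rcases le_total t t' with h | h
    · rw [min_eq_left h, abs_of_nonpos (by linarith)]; ring
    · rw [min_eq_right h, abs_of_nonneg (by linarith)]; ring
  rw [h3]
  have : 0 ≤ Real.exp (-ρ * (t + t' - 2 * 0)) / (2 * ρ) := by positivity
  linarith

section Decay

variable {V : Type*} [NormedAddCommGroup V] [InnerProductSpace ℝ V] [CompleteSpace V]
  {T γ t' : ℝ} {F N K : ℝ → V →L[ℝ] V} {P : V →L[ℝ] V} {X L Y : ℝ → V →L[ℝ] V}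
  {f g : ℝ → V} {p q : V} {x lam : ℝ → V}

/-- Without forcing, the feedforward term `Yᵀr` vanishes after `t'`. Before `t'` it is the
transposed closed-loop propagator applied to `q + LYp` at `t'`, which accounts for the factor `a c₁
+ b`. The state is the forward propagation of `-N Yᵀr` over `s ≤ min t t'` plus that of the jump
`p`, and the adjoint is the Riccati matrix applied to `x` plus `Yᵀr`. -/
theorem IsFundamental.decay (H : IsHamiltonianSystem T γ F N K P)
    (h : IsFundamental T F N K P X L Y) {c₀ c₁ : ℝ} (hc₀ : 0 < c₀) (hc₁ : 0 < c₁)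
    (h0 : ∀ t ∈ Icc 0 T, ∀ v, c₀ * ‖X t v‖ ^ 2 ≤ inner ℝ (X t v) (L t v))
    (h1 : ∀ t ∈ Icc 0 T, ∀ v, inner ℝ (X t v) (L t v) ≤ c₁ * ‖X t v‖ ^ 2)
    {ν : ℝ} (hν : ∀ t ∈ Icc 0 T, ‖N t‖ ≤ ν) (ht' : t' ∈ Icc 0 T)
    (hs : IsBVPSolution T t' F N K P f g 0 0 p q x lam)
    (hf : ∀ t ∈ Icc 0 T, f t = 0) (hg : ∀ t ∈ Icc 0 T, g t = 0) {a b : ℝ} (ha : ‖p‖ ≤ a)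
    (hb : ‖q‖ ≤ b) {t : ℝ} (ht : t ∈ Icc 0 T) :
    ‖x t‖ ≤ √(c₁ / c₀) * (√(c₁ / c₀) * (a * c₁ + b) * ν / (2 * (γ / (2 * c₁))) + a) *
        Real.exp (-(γ / (2 * c₁)) * |t - t'|) ∧
    ‖lam t‖ ≤ c₁ * ‖x t‖ + √(c₁ / c₀) * (a * c₁ + b) *
        Real.exp (-(γ / (2 * c₁)) * |t - t'|) := by
  have hT := H.T_pos.le
  have hγ := H.gam_pos
  have hexp : ∀ s ∈ Icc 0 T, ∀ r ∈ Icc 0 T, s ≤ r → ∀ v, ‖X r (Y s v)‖ ≤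
      √(c₁ / c₀) * Real.exp (-(γ / (2 * c₁)) * (r - s)) * ‖v‖ := by
    intro s hs r hr hsr v
    have := h.norm_le_exp H hc₀ hc₁ h0 h1 hs hr hsr (Y s v)
    rwa [h.XY s hs] at this
  set ρ := γ / (2 * c₁) with hρ
  have hρ0 : 0 < ρ := by positivity
  set Z := √(c₁ / c₀) with hZ
  have hZ0 : 0 ≤ Z := Real.sqrt_nonneg _
  have hν0 : 0 ≤ ν := (norm_nonneg _).trans (hν t ht)
  have ha0 : 0 ≤ a := (norm_nonneg _).trans ha
  have hb0 : 0 ≤ b := (norm_nonneg _).trans hb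
  have hS : ∀ s ∈ Icc 0 T, ∀ v, ‖L s (Y s v)‖ ≤ c₁ * ‖v‖ := fun s hs v =>
    h.norm_riccati_le hc₁ hs (fun v => le_trans (by positivity) (h0 s hs v)) (h1 s hs) v
  set m := Z * (a * c₁ + b) with hm
  have hm0 : 0 ≤ m := by positivity
  have hr : ∀ s ∈ Icc 0 T, bvpR T t' X L f g 0 p q s =
      if s < t' then ((X t')†) q + ((L t')†) p else 0 := by
    intro s hs
    have : ∫ r in s..T, (((X r)†) (g r) + ((L r)†) (f r)) = 0 := by
      rw [intervalIntegral.integral_congr (g := fun _ => (0 : V)) (fun r hr => ?_)]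
      · simp
      · rw [uIcc_of_le hs.2] at hr
        have hr' : r ∈ Icc 0 T := ⟨hs.1.trans hr.1, hr.2⟩
        simp [hf r hr', hg r hr']
    simp [bvpR, this]
  have hv : ∀ s ∈ Icc 0 T, s ≤ t' → ‖((Y s)†) (bvpR T t' X L f g 0 p q s)‖ ≤
      m * Real.exp (-ρ * (t' - s)) := by
    intro s hs hst
    rw [hr s hs]
    split_ifs with h2
    -- The decay estimate is known for `X(t')Y(s)`, not for its transpose. Testing with vectors `w`
    -- moves the operator to the other side.
    · refine norm_le_of_inner_le (by positivity) fun w => ?_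
      rw [ContinuousLinearMap.adjoint_inner_left, inner_add_left,
        ContinuousLinearMap.adjoint_inner_left, ContinuousLinearMap.adjoint_inner_left]
      have e1 := hexp s hs t' ht' hst w
      have e2 := hS t' ht' (X t' (Y s w))
      rw [h.YX t' ht'] at e2
      calc inner ℝ q (X t' (Y s w)) + inner ℝ p (L t' (Y s w))
          ≤ ‖q‖ * ‖X t' (Y s w)‖ + ‖p‖ * ‖L t' (Y s w)‖ :=
            add_le_add (real_inner_le_norm _ _) (real_inner_le_norm _ _)
        _ ≤ b * ‖X t' (Y s w)‖ + a * (c₁ * ‖X t' (Y s w)‖) := by gcongr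
        _ = (a * c₁ + b) * ‖X t' (Y s w)‖ := by ring
        _ ≤ (a * c₁ + b) * (Z * Real.exp (-ρ * (t' - s)) * ‖w‖) := by gcongr
        _ = _ := by rw [hm]; ring
    · simp only [map_zero, norm_zero]; positivity
  have hv' : ∀ s ∈ Icc 0 T, t' ≤ s → bvpR T t' X L f g 0 p q s = 0 := by
    intro s hs hst
    rw [hr s hs, if_neg (not_lt.2 hst)]
  obtain ⟨hx, hlam⟩ := h.eq_bvpW H ht' hs ht
  refine ⟨?_, ?_⟩
  · have hf0 : IntervalIntegrable f volume 0 T := by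
      refine (IntervalIntegrable.zero : IntervalIntegrable (fun _ => (0 : V)) volume 0 T).congr ?_
      intro s hs
      rw [uIoc_of_le hT] at hs
      exact (hf s (Ioc_subset_Icc_self hs)).symm
    have hg0 : IntervalIntegrable g volume 0 T := by
      refine (IntervalIntegrable.zero : IntervalIntegrable (fun _ => (0 : V)) volume 0 T).congr ?_
      intro s hs
      rw [uIoc_of_le hT] at hs
      exact (hg s (Ioc_subset_Icc_self hs)).symm
    obtain ⟨r₀, hrp⟩ := h.hasJumpPrimitive_bvpR (t' := t') (e := 0) (p := p) (q := q) H hf0 hg0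
    have hi : IntervalIntegrable
        (fun s => Y s (f s - N s (((Y s)†) (bvpR T t' X L f g 0 p q s)))) volume 0 T :=
      intervalIntegrable_clm_apply hT h.contY (hf0.sub (intervalIntegrable_clm_apply hT H.contN
        (intervalIntegrable_clm_apply hT (continuousOn_adjoint h.contY)
          (hrp.intervalIntegrable hT))))
    set k : ℝ → V := fun s => Y s (f s - N s (((Y s)†) (bvpR T t' X L f g 0 p q s))) with hk
    have hτ : min t t' ∈ Icc 0 T := ⟨le_min ht.1 ht'.1, (min_le_left _ _).trans ht.2⟩
    -- After `t'` the integrand is zero, so the integral always stops at `min t t'`.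
    have e1 : ∫ s in (0 : ℝ)..t, k s = ∫ s in (0 : ℝ)..min t t', k s := by
      rcases le_total t t' with h2 | h2
      · rw [min_eq_left h2]
      · rw [min_eq_right h2, ← intervalIntegral.integral_add_adjacent_intervals
          (hi.of_mem_Icc ht') ((hi.of_mem_Icc ht').symm.trans (hi.of_mem_Icc ht)),
          intervalIntegral.integral_congr (a := t') (g := fun _ => (0 : V)) (fun s hs => ?_)]
        · simp
        · rw [uIcc_of_le h2] at hs
          have hs' : s ∈ Icc 0 T := ⟨ht'.1.trans hs.1, hs.2.trans ht.2⟩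
          simp [hk, hf s hs', hv' s hs' hs.1]
    have e2 : ‖X t (∫ s in (0 : ℝ)..min t t', k s)‖ ≤
        Z * ν * m * (Real.exp (-ρ * |t - t'|) / (2 * ρ)) := by
      rw [← (X t).intervalIntegral_comp_comm (hi.of_mem_Icc hτ)]
      refine (intervalIntegral.norm_integral_le_of_norm_le hτ.1
        (g := fun s => Z * ν * m * (Real.exp (-ρ * (t - s)) * Real.exp (-ρ * (t' - s))))
        (Eventually.of_forall fun s hs => ?_)
        (Continuous.intervalIntegrable (by fun_prop) _ _)).trans ?_
      · have hst : s ≤ t := hs.2.trans (min_le_left _ _)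
        have hst' : s ≤ t' := hs.2.trans (min_le_right _ _)
        have hs' : s ∈ Icc 0 T := ⟨hs.1.le, hst.trans ht.2⟩
        refine (hexp s hs' t ht hst _).trans ?_
        rw [hf s hs', zero_sub, norm_neg]
        calc Z * Real.exp (-ρ * (t - s)) * ‖N s (((Y s)†) (bvpR T t' X L f g 0 p q s))‖
            ≤ Z * Real.exp (-ρ * (t - s)) * (ν * (m * Real.exp (-ρ * (t' - s)))) := by
              gcongr
              refine ((N s).le_opNorm _).trans ?_
              exact mul_le_mul (hν s hs') (hv s hs' hst') (norm_nonneg _) hν0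
          _ = _ := by ring
      · rw [intervalIntegral.integral_const_mul]
        exact mul_le_mul_of_nonneg_left (integral_exp_mul_exp_le hρ0) (by positivity)
    have e3 : ‖X t (if t' ≤ t then Y t' p else 0)‖ ≤ Z * a * Real.exp (-ρ * |t - t'|) := by
      split_ifs with h2
      · refine (hexp t' ht' t ht h2 p).trans ?_
        rw [abs_of_nonneg (by linarith)]
        calc _ ≤ Z * Real.exp (-ρ * (t - t')) * a := by gcongr
          _ = _ := by ring
      · simp only [map_zero, norm_zero]; positivity
    rw [hx]
    simp only [bvpW, map_zero, zero_add, map_add]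
    refine (norm_add_le _ _).trans ?_
    rw [e1]
    refine (add_le_add e2 e3).trans (le_of_eq ?_)
    ring
  · have e1 : L t (bvpW T t' N X L Y f g 0 0 p q t) = L t (Y t (x t)) := by
      rw [hx, h.YX t ht]
    rw [hlam, e1]
    refine (norm_add_le _ _).trans (add_le_add (hS t ht _) ?_)
    rcases le_total t t' with h2 | h2
    · rw [abs_of_nonpos (by linarith), neg_sub]
      exact hv t ht h2
    · rw [hv' t ht h2, map_zero, norm_zero]; positivity

end Decay

/-! ### Approximate point sources -/

namespace ApproximatesDirac

variable {V : Type*} [NormedAddCommGroup V] [InnerProductSpace ℝ V]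
  {T t' : ℝ} {φ : ℕ → ℝ → ℝ} {k : ℝ → V}

theorem intervalIntegrable (hφ : ApproximatesDirac T t' φ) (hT : 0 ≤ T) (n : ℕ) :
    IntervalIntegrable (φ n) volume 0 T := by
  rw [intervalIntegrable_iff_integrableOn_Icc_of_le hT]
  exact (hφ.1 n).integrable (by norm_num)

theorem intervalIntegrable_smul (hφ : ApproximatesDirac T t' φ) (hT : 0 ≤ T)
    (hk : ContinuousOn k (Icc 0 T)) (n : ℕ) :
    IntervalIntegrable (fun s => φ n s • k s) volume 0 T := by
  refine (hφ.intervalIntegrable hT n).smul_continuousOn ?_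
  rwa [uIcc_of_le hT]

theorem norm_integral_le (hφ : ApproximatesDirac T t' φ) (hT : 0 ≤ T) {C : ℝ} (hC0 : 0 ≤ C) {n : ℕ}
    (hC : ∀ s ∈ Icc 0 T, ‖φ n s • k s‖ ≤ φ n s * C) {t : ℝ} (ht : t ∈ Icc 0 T) :
    ‖∫ s in t..T, φ n s • k s‖ ≤ C := by
  have hi := hφ.intervalIntegrable hT n
  refine (intervalIntegral.norm_integral_le_of_norm_le ht.2 (g := fun s => φ n s * C)
    (Eventually.of_forall fun s hs => hC s ⟨ht.1.trans hs.1.le, hs.2⟩)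
    ((hi.of_mem_Icc' ht).mul_const C)).trans ?_
  rw [intervalIntegral.integral_mul_const]
  refine mul_le_of_le_one_left hC0 ?_
  rw [← hφ.2.2.1 n, ← intervalIntegral.integral_add_adjacent_intervals (hi.of_mem_Icc ht)
    (hi.of_mem_Icc' ht)]
  have := intervalIntegral.integral_nonneg ht.1 (μ := volume)
    (fun s hs => hφ.2.1 n s ⟨hs.1, hs.2.trans ht.2⟩)
  linarith

theorem tendsto_integral [CompleteSpace V] (hφ : ApproximatesDirac T t' φ) (hT : 0 ≤ T)
    (ht' : t' ∈ Icc 0 T) (hk : ContinuousOn k (Icc 0 T)) :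
    Tendsto (fun n => ∫ s in (0 : ℝ)..T, φ n s • k s) atTop (𝓝 (k t')) := by
  rw [Metric.tendsto_atTop']
  intro ε hε
  obtain ⟨δ, hδ, hδ'⟩ := Metric.continuousWithinAt_iff.1 (hk t' ht') (ε / 2) (by positivity)
  obtain ⟨n₀, hn₀⟩ := eventually_atTop.1 (hφ.2.2.2 δ hδ)
  refine ⟨n₀, fun n hn => ?_⟩
  have h1 : (∫ s in (0 : ℝ)..T, φ n s • k s) - k t' =
      ∫ s in (0 : ℝ)..T, φ n s • (k s - k t') := by
    simp only [smul_sub]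
    rw [intervalIntegral.integral_sub (hφ.intervalIntegrable_smul hT hk n)
      (hφ.intervalIntegrable_smul hT continuousOn_const n), intervalIntegral.integral_smul_const,
      hφ.2.2.1 n, one_smul]
  rw [dist_eq_norm, h1]
  refine lt_of_le_of_lt (hφ.norm_integral_le hT (C := ε / 2) (by positivity) (fun s hs => ?_)
    ⟨le_rfl, hT⟩) (by linarith)
  rw [norm_smul, Real.norm_eq_abs, abs_of_nonneg (hφ.2.1 n s hs)]
  by_cases h2 : δ ≤ |s - t'|
  · rw [hn₀ n hn.le s hs h2]; simp
  · have := hδ' hs (by rw [Real.dist_eq]; exact not_le.1 h2)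
    rw [dist_eq_norm] at this
    exact mul_le_mul_of_nonneg_left this.le (hφ.2.1 n s hs)

theorem integral_eventually_zero (hφ : ApproximatesDirac T t' φ) {a b : ℝ} (ha : 0 ≤ a)
    (hab : a ≤ b) (hb : b ≤ T) (h : t' ∉ Icc a b) (k : ℝ → V) :
    ∀ᶠ n in atTop, ∫ s in a..b, φ n s • k s = 0 := by
  have : ∃ ε > 0, ∀ s ∈ Icc a b, ε ≤ |s - t'| := by
    rcases lt_or_ge t' a with h1 | h1
    · exact ⟨a - t', by linarith, fun s hs => by
        rw [abs_of_nonneg (by linarith [hs.1])]; linarith [hs.1]⟩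
    · have h2 : b < t' := not_le.1 fun h2 => h ⟨h1, h2⟩
      exact ⟨t' - b, by linarith, fun s hs => by
        rw [abs_of_nonpos (by linarith [hs.2])]; linarith [hs.2]⟩
  obtain ⟨ε, hε, hε'⟩ := this
  filter_upwards [hφ.2.2.2 ε hε] with n hn
  rw [intervalIntegral.integral_congr (g := fun _ => (0 : V)) (fun s hs => ?_)]
  · simp
  · rw [uIcc_of_le hab] at hs
    simp [hn s ⟨ha.trans hs.1, hs.2.trans hb⟩ (hε' s hs)]

theorem tendsto_integral_left [CompleteSpace V] (hφ : ApproximatesDirac T t' φ) (hT : 0 ≤ T)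
    (ht' : t' ∈ Icc 0 T) (hk : ContinuousOn k (Icc 0 T)) {t : ℝ} (ht : t ∈ Icc 0 T)
    (htt : t ≠ t') :
    Tendsto (fun n => ∫ s in (0 : ℝ)..t, φ n s • k s) atTop
      (𝓝 (if t' ≤ t then k t' else 0)) := by
  split_ifs with h
  · refine (hφ.tendsto_integral hT ht' hk).congr' ?_
    filter_upwards [hφ.integral_eventually_zero ht.1 ht.2 le_rfl
      (fun h' => htt (le_antisymm h'.1 h)) k] with n hn
    have hi := hφ.intervalIntegrable_smul hT hk n
    rw [← intervalIntegral.integral_add_adjacent_intervals (hi.of_mem_Icc ht)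
      (hi.of_mem_Icc' ht), hn, add_zero]
  · refine tendsto_const_nhds.congr' ?_
    filter_upwards [hφ.integral_eventually_zero le_rfl ht.1 ht.2 (fun h' => h h'.2) k] with n hn
    exact hn.symm

theorem tendsto_integral_right [CompleteSpace V] (hφ : ApproximatesDirac T t' φ) (hT : 0 ≤ T)
    (ht' : t' ∈ Icc 0 T) (hk : ContinuousOn k (Icc 0 T)) {t : ℝ} (ht : t ∈ Icc 0 T)
    (htt : t ≠ t') :
    Tendsto (fun n => ∫ s in t..T, φ n s • k s) atTop
      (𝓝 (if t < t' then k t' else 0)) := by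
  split_ifs with h
  · refine (hφ.tendsto_integral hT ht' hk).congr' ?_
    filter_upwards [hφ.integral_eventually_zero le_rfl ht.1 ht.2
      (fun h' => htt (le_antisymm h.le h'.2)) k] with n hn
    have hi := hφ.intervalIntegrable_smul hT hk n
    rw [← intervalIntegral.integral_add_adjacent_intervals (hi.of_mem_Icc ht)
      (hi.of_mem_Icc' ht), hn, zero_add]
  · refine tendsto_const_nhds.congr' ?_
    filter_upwards [hφ.integral_eventually_zero ht.1 ht.2 le_rfl
      (fun h' => htt (le_antisymm h'.1 (not_lt.1 h))) k] with n hn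
    exact hn.symm

end ApproximatesDirac

/-! ### Convergence of the boundary value problems with approximate point sources. -/

section Convergence

variable {V : Type*} [NormedAddCommGroup V] [InnerProductSpace ℝ V] [CompleteSpace V]
  {T γ t' : ℝ} {F N K : ℝ → V →L[ℝ] V} {P : V →L[ℝ] V} {X L Y : ℝ → V →L[ℝ] V}
  {φ : ℕ → ℝ → ℝ} {k₁ k₂ : ℝ → V} {x lam : ℕ → ℝ → V}

/-- The difference of an approximate and the perturbed solution has the forcing `φₙ k` and the
opposite jump `-k(t')`. Its function `r` tends to zero at every time except `t'` and is bounded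
uniformly in `n`, because `φₙ` has mass one. Dominated convergence then handles the term `∫ Y N Yᵀ
r` in the formula for the state. -/
theorem IsFundamental.tendsto_zero (H : IsHamiltonianSystem T γ F N K P)
    (h : IsFundamental T F N K P X L Y) (hφ : ApproximatesDirac T t' φ) (ht' : t' ∈ Icc 0 T)
    (hk₁ : ContinuousOn k₁ (Icc 0 T)) (hk₂ : ContinuousOn k₂ (Icc 0 T))
    (hs : ∀ n, IsBVPSolution T t' F N K P (fun s => φ n s • k₁ s) (fun s => φ n s • k₂ s) 0 0
      (-k₁ t') (-k₂ t') (x n) (lam n)) {t : ℝ} (ht : t ∈ Icc 0 T) (htt : t ≠ t') :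
    Tendsto (fun n => x n t) atTop (𝓝 0) ∧ Tendsto (fun n => lam n t) atTop (𝓝 0) := by
  have hT := H.T_pos.le
  have hT0 : (0 : ℝ) ∈ Icc 0 T := ⟨le_rfl, hT⟩
  let r : ℕ → ℝ → V := fun n => bvpR T t' X L (fun s => φ n s • k₁ s) (fun s => φ n s • k₂ s) 0
    (-k₁ t') (-k₂ t')
  let w : ℕ → ℝ → V := fun n => bvpW T t' N X L Y (fun s => φ n s • k₁ s)
    (fun s => φ n s • k₂ s) 0 0 (-k₁ t') (-k₂ t')
  let k : ℝ → V := fun s => ((X s)†) (k₂ s) + ((L s)†) (k₁ s)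
  have hk : ContinuousOn k (Icc 0 T) :=
    ((continuousOn_adjoint h.contX).clm_apply hk₂).add
      ((continuousOn_adjoint h.contL).clm_apply hk₁)
  have hr : ∀ n s, r n s = (∫ u in s..T, φ n u • k u) - if s < t' then k t' else 0 := by
    intro n s
    simp only [r, bvpR, k, smul_add, map_smul, map_neg, zero_add]
    split_ifs <;> abel
  have hr0 : ∀ s ∈ Icc 0 T, s ≠ t' → Tendsto (fun n => r n s) atTop (𝓝 0) := by
    intro s hs hst
    simp only [hr]
    simpa using (hφ.tendsto_integral_right hT ht' hk hs hst).sub_const (if s < t' then k t' else 0)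
  obtain ⟨C, hC⟩ := isCompact_Icc.exists_bound_of_continuousOn hk
  have hC0 : 0 ≤ C := (norm_nonneg _).trans (hC 0 hT0)
  have hrb : ∀ n, ∀ s ∈ Icc 0 T, ‖r n s‖ ≤ C + C := by
    intro n s hs
    rw [hr]
    refine (norm_sub_le _ _).trans (add_le_add (hφ.norm_integral_le hT hC0 (fun u hu => ?_) hs) ?_)
    · rw [norm_smul, Real.norm_eq_abs, abs_of_nonneg (hφ.2.1 n u hu)]
      exact mul_le_mul_of_nonneg_left (hC u hu) (hφ.2.1 n u hu)
    · split_ifs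
      · exact hC t' ht'
      · simpa using hC0
  have hrp : ∀ n, AEStronglyMeasurable (r n) (volume.restrict (Ioc 0 T)) ∧
      IntervalIntegrable (r n) volume 0 T := by
    intro n
    obtain ⟨r₀, hrp⟩ := h.hasJumpPrimitive_bvpR (t' := t') (e := 0) (p := -k₁ t') (q := -k₂ t') H
      (hφ.intervalIntegrable_smul hT hk₁ n) (hφ.intervalIntegrable_smul hT hk₂ n)
    exact ⟨hrp.aestronglyMeasurable hT, hrp.intervalIntegrable hT⟩
  let M : ℝ → V →L[ℝ] V := fun s => Y s ∘L N s ∘L ((Y s)†)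
  have hM : ContinuousOn M (Icc 0 T) := by
    have := h.contY
    have := H.contN
    have := continuousOn_adjoint h.contY
    fun_prop
  obtain ⟨B, hB⟩ := isCompact_Icc.exists_bound_of_continuousOn hM
  have hint : Tendsto (fun n => ∫ s in (0 : ℝ)..t, M s (r n s)) atTop (𝓝 0) := by
    have hsub : uIoc 0 t ⊆ Ioc 0 T := by
      rw [uIoc_of_le ht.1]; exact Ioc_subset_Ioc_right ht.2
    have := intervalIntegral.tendsto_integral_filter_of_dominated_convergence
      (μ := volume) (a := 0) (b := t) (l := atTop) (F := fun n s => M s (r n s))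
      (f := fun _ => (0 : V)) (fun _ => B * (C + C))
      (Eventually.of_forall fun n => by
        have h1 := (intervalIntegrable_clm_apply hT hM (hrp n).2).of_mem_Icc ht
        exact (intervalIntegrable_iff.1 h1).1)
      (Eventually.of_forall fun n => Eventually.of_forall fun s hs => by
        have hs' := Ioc_subset_Icc_self (hsub hs)
        refine ((M s).le_opNorm _).trans ?_
        exact mul_le_mul (hB s hs') (hrb n s hs') (norm_nonneg _)
          ((norm_nonneg _).trans (hB s hs')))
      intervalIntegrable_const
      (by
        have : ∀ᵐ s : ℝ, s ≠ t' := by simp [ae_iff]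
        filter_upwards [this] with s hst hs
        simpa [Function.comp_def] using ((M s).continuous.tendsto 0).comp
          (hr0 s (Ioc_subset_Icc_self (hsub hs)) hst))
    simpa using this
  have hYk : ContinuousOn (fun s => Y s (k₁ s)) (Icc 0 T) := h.contY.clm_apply hk₁
  have hw : Tendsto (fun n => w n t) atTop (𝓝 0) := by
    have h2 : ∀ n, w n t = (∫ s in (0 : ℝ)..t, φ n s • Y s (k₁ s)) -
        (∫ s in (0 : ℝ)..t, M s (r n s)) - if t' ≤ t then Y t' (k₁ t') else 0 := by
      intro n
      rw [← intervalIntegral.integral_sub ((hφ.intervalIntegrable_smul hT hYk n).of_mem_Icc ht)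
        ((intervalIntegrable_clm_apply hT hM (hrp n).2).of_mem_Icc ht)]
      simp only [w, bvpW, M, r, map_zero, zero_add, map_sub, map_smul, map_neg,
        ContinuousLinearMap.comp_apply]
      split_ifs <;> abel
    simp only [h2]
    simpa using ((hφ.tendsto_integral_left hT ht' hYk ht htt).sub hint).sub_const
      (if t' ≤ t then Y t' (k₁ t') else 0)
  have hx := fun n => (h.eq_bvpW H ht' (hs n) ht).1
  have hl := fun n => (h.eq_bvpW H ht' (hs n) ht).2
  refine ⟨?_, ?_⟩
  · simp only [hx]
    simpa [Function.comp_def, w] using ((X t).continuous.tendsto 0).comp hw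
  · simp only [hl]
    simpa using (((L t).continuous.tendsto 0).comp hw).add
      ((((Y t)†).continuous.tendsto 0).comp (hr0 t ht htt))

end Convergence


/-! ### The constants -/

namespace Constants

variable (k : Constants)

theorem kappa_pos : 0 < k.kappa := by
  have := k.lamA_pos; have := k.lamB_pos; have := k.lamH_pos; have := k.gamR_pos
  unfold kappa; positivity

theorem lamA_le_kappa : k.lamA ≤ k.kappa := by
  have := k.lamB_pos; have := k.lamH_pos; have := k.gamR_pos
  have : 0 ≤ k.lamB * k.lamH / k.gamR := by positivity
  unfold kappa; linarith

theorem one_lt_exp : 1 < Real.exp (2 * (k.kappa * k.sigma)) := by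
  have := k.kappa_pos; have := k.sigma_pos
  exact Real.one_lt_exp_iff.2 (by positivity)

theorem inv_alpha0' : k.alpha0'⁻¹ = 2 / k.alpha0 + (k.lamH / k.gamR) ^ 2 / k.lamA *
    (1 + k.alpha1 / k.alpha0) ^ 2 * (Real.exp (2 * k.lamA * k.sigma) - 1) := by
  rw [alpha0', inv_inv]

theorem two_div_le_inv_alpha0' : 2 / k.alpha0 ≤ k.alpha0'⁻¹ := by
  have := k.lamA_pos; have := k.lamH_pos; have := k.gamR_pos; have := k.alpha0_pos
  have := k.alpha1_pos; have := k.sigma_pos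
  have h1 : 1 ≤ Real.exp (2 * k.lamA * k.sigma) := Real.one_le_exp (by positivity)
  have h2 : 0 ≤ Real.exp (2 * k.lamA * k.sigma) - 1 := by linarith
  rw [inv_alpha0']
  have : 0 ≤ (k.lamH / k.gamR) ^ 2 / k.lamA * (1 + k.alpha1 / k.alpha0) ^ 2 *
    (Real.exp (2 * k.lamA * k.sigma) - 1) := by positivity
  linarith

theorem alpha0'_pos : 0 < k.alpha0' := by
  have := k.alpha0_pos
  exact inv_pos.1 (lt_of_lt_of_le (by positivity) k.two_div_le_inv_alpha0')

theorem alpha0'_le : k.alpha0' ≤ k.alpha0 := by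
  have := k.alpha0_pos
  have h := k.two_div_le_inv_alpha0'
  have : k.alpha0⁻¹ ≤ k.alpha0'⁻¹ := by
    refine le_trans ?_ h
    rw [div_eq_mul_inv]
    have : 0 < k.alpha0⁻¹ := by positivity
    linarith
  exact (inv_le_inv₀ k.alpha0_pos k.alpha0'_pos).1 this

theorem alpha1'_eq : k.alpha1' =
    k.lamB ^ 2 * ((Real.exp (2 * (k.kappa * k.sigma)) - 1) / (2 * k.kappa)) := by
  rw [alpha1', show 2 * k.sigma * k.kappa = 2 * (k.kappa * k.sigma) by ring]; ring

theorem alpha1'_pos : 0 < k.alpha1' := by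
  have := k.one_lt_exp; have := k.kappa_pos; have := k.lamB_pos
  have : 0 < Real.exp (2 * (k.kappa * k.sigma)) - 1 := by linarith
  rw [alpha1'_eq]; positivity

theorem alpha1'_le : k.alpha1' ≤
    k.lamB ^ 2 * (Real.exp (2 * (k.kappa * k.sigma)) / (2 * k.kappa)) := by
  have := k.kappa_pos
  rw [alpha1'_eq]
  gcongr
  linarith

theorem alphaDual0_eq : k.alphaDual0 =
    (1 - (Real.exp (2 * (k.kappa * k.sigma)))⁻¹) / (2 * k.kappa) := by
  rw [alphaDual0, show -2 * k.kappa * k.sigma = -(2 * (k.kappa * k.sigma)) by ring, Real.exp_neg]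
  ring

theorem alphaDual0_pos : 0 < k.alphaDual0 := by
  have h := k.one_lt_exp; have := k.kappa_pos
  have : (Real.exp (2 * (k.kappa * k.sigma)))⁻¹ < 1 := inv_lt_one_of_one_lt₀ h
  have : 0 < 1 - (Real.exp (2 * (k.kappa * k.sigma)))⁻¹ := by linarith
  rw [alphaDual0_eq]; positivity

theorem alphaDual0_le_sigma : k.alphaDual0 ≤ k.sigma := by
  have := k.kappa_pos
  rw [alphaDual0_eq, div_le_iff₀ (by positivity), ← Real.exp_neg]
  have := Real.add_one_le_exp (-(2 * (k.kappa * k.sigma)))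
  linarith

theorem alphaDual0_le : k.alphaDual0 ≤ 1 / (2 * k.kappa) := by
  have := k.kappa_pos
  rw [alphaDual0_eq]
  gcongr
  have := Real.exp_pos (2 * (k.kappa * k.sigma))
  have : 0 ≤ (Real.exp (2 * (k.kappa * k.sigma)))⁻¹ := by positivity
  linarith

theorem alphaDual1_pos : 0 < k.alphaDual1 := by
  have h := k.one_lt_exp; have := k.kappa_pos
  rw [alphaDual1, show 2 * k.kappa * k.sigma = 2 * (k.kappa * k.sigma) by ring]
  have : 0 < Real.exp (2 * (k.kappa * k.sigma)) - 1 := by linarith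
  positivity

theorem c0_eq : k.c0 = min
    (2 * k.kappa * (k.lamB ^ 2 / k.gamR * (1 + k.alphaDual1 / k.alphaDual0) ^ 2 +
      1 / (k.gamQ * k.alphaDual0 ^ 2))⁻¹)
    (k.lamB ^ 2 / (2 * k.gamR * k.kappa) + 1 / k.gamQ)⁻¹ *
    (Real.exp (2 * (k.kappa * k.sigma)))⁻¹ := by
  rw [c0, show -2 * k.kappa * k.sigma = -(2 * (k.kappa * k.sigma)) by ring, Real.exp_neg]

theorem c0_pos : 0 < k.c0 := by
  have := k.kappa_pos; have := k.lamB_pos; have := k.gamR_pos; have := k.gamQ_pos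
  have := k.alphaDual0_pos; have := k.alphaDual1_pos
  rw [c0_eq]
  refine mul_pos (lt_min ?_ ?_) (by positivity) <;> positivity

theorem c0_mul_tail_le : k.c0 * (Real.exp (2 * (k.kappa * k.sigma)) *
    (k.lamB ^ 2 / k.gamR / (2 * k.kappa) + 1 / k.gamQ)) ≤ 1 := by
  have := k.kappa_pos; have := k.lamB_pos; have := k.gamR_pos; have := k.gamQ_pos
  set S := k.lamB ^ 2 / k.gamR / (2 * k.kappa) + 1 / k.gamQ with hS
  have hS' : k.lamB ^ 2 / (2 * k.gamR * k.kappa) + 1 / k.gamQ = S := by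
    rw [hS, div_div]; ring_nf
  have hS0 : 0 < S := by positivity
  have h1 : k.c0 ≤ S⁻¹ * (Real.exp (2 * (k.kappa * k.sigma)))⁻¹ := by
    rw [c0_eq, hS']
    exact mul_le_mul_of_nonneg_right (min_le_right _ _) (by positivity)
  calc _ ≤ S⁻¹ * (Real.exp (2 * (k.kappa * k.sigma)))⁻¹ *
        (Real.exp (2 * (k.kappa * k.sigma)) * S) := by gcongr
    _ = 1 := by
      have := (Real.exp_pos (2 * (k.kappa * k.sigma))).ne'
      field_simp

/-- The constant of the linear ramp is compared with the first entry of the minimum in `c0`. The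
ingredients are `σ ≤ exp(2κσ)/(2κ)`, `(1 + κσ)² ≤ exp(2κσ)`, and `2κ α̃₀² ≤ σ`, which follows from
`α̃₀ ≤ 1/(2κ)` and `α̃₀ ≤ σ`. -/
theorem c0_mul_window_le : k.c0 * (k.lamB ^ 2 / k.gamR * k.sigma +
    (1 + k.kappa * k.sigma) ^ 2 / (k.sigma * k.gamQ)) ≤ 1 := by
  have hκ := k.kappa_pos; have := k.lamB_pos; have := k.gamR_pos; have := k.gamQ_pos
  have h0 := k.alphaDual0_pos; have := k.alphaDual1_pos; have hσ := k.sigma_pos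
  set E := Real.exp (2 * (k.kappa * k.sigma)) with hE
  have hE0 : 0 < E := Real.exp_pos _
  set S := k.lamB ^ 2 / k.gamR * (1 + k.alphaDual1 / k.alphaDual0) ^ 2 +
      1 / (k.gamQ * k.alphaDual0 ^ 2) with hS
  have hS0 : 0 < S := by positivity
  have h1 : k.c0 ≤ 2 * k.kappa * S⁻¹ * E⁻¹ := by
    rw [c0_eq, ← hS]
    exact mul_le_mul_of_nonneg_right (min_le_left _ _) (by positivity)
  have h2 : k.sigma ≤ E / (2 * k.kappa) := by
    rw [le_div_iff₀ (by positivity)]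
    have := Real.add_one_le_exp (2 * (k.kappa * k.sigma))
    rw [← hE] at this
    linarith
  have h3 : k.lamB ^ 2 / k.gamR * k.sigma ≤
      E / (2 * k.kappa) * (k.lamB ^ 2 / k.gamR * (1 + k.alphaDual1 / k.alphaDual0) ^ 2) := by
    have h4 : (1 : ℝ) ≤ (1 + k.alphaDual1 / k.alphaDual0) ^ 2 := by
      have : 0 ≤ k.alphaDual1 / k.alphaDual0 := by positivity
      nlinarith
    calc _ ≤ k.lamB ^ 2 / k.gamR * (E / (2 * k.kappa)) * 1 := by
          rw [mul_one]; gcongr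
      _ ≤ k.lamB ^ 2 / k.gamR * (E / (2 * k.kappa)) *
          (1 + k.alphaDual1 / k.alphaDual0) ^ 2 := by gcongr
      _ = _ := by ring
  have h5 : (1 + k.kappa * k.sigma) ^ 2 / (k.sigma * k.gamQ) ≤
      E / (2 * k.kappa) * (1 / (k.gamQ * k.alphaDual0 ^ 2)) := by
    have h6 : (1 + k.kappa * k.sigma) ^ 2 ≤ E := by
      rw [hE, exp_two_mul_eq_sq]
      have := Real.add_one_le_exp (k.kappa * k.sigma)
      gcongr
      linarith
    have h7 : 1 / k.sigma ≤ 1 / (2 * k.kappa) * (1 / k.alphaDual0 ^ 2) := by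
      have h8 := k.alphaDual0_le
      rw [le_div_iff₀ (by positivity)] at h8
      rw [one_div_mul_one_div]
      refine one_div_le_one_div_of_le (by positivity) ?_
      calc 2 * k.kappa * k.alphaDual0 ^ 2 = k.alphaDual0 * (k.alphaDual0 * (2 * k.kappa)) := by ring
        _ ≤ k.alphaDual0 * 1 := by gcongr
        _ ≤ k.sigma := by rw [mul_one]; exact k.alphaDual0_le_sigma
    calc _ = (1 + k.kappa * k.sigma) ^ 2 * (1 / k.sigma) * (1 / k.gamQ) := by field_simp
      _ ≤ E * (1 / (2 * k.kappa) * (1 / k.alphaDual0 ^ 2)) * (1 / k.gamQ) := by gcongr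
      _ = _ := by field_simp
  calc _ ≤ 2 * k.kappa * S⁻¹ * E⁻¹ * (E / (2 * k.kappa) * S) := by
        have h8 : k.lamB ^ 2 / k.gamR * k.sigma +
            (1 + k.kappa * k.sigma) ^ 2 / (k.sigma * k.gamQ) ≤ E / (2 * k.kappa) * S := by
          rw [hS, mul_add]; exact add_le_add h3 h5
        have := k.c0_pos
        exact mul_le_mul h1 h8 (by positivity) (by positivity)
    _ = 1 := by field_simp

theorem c1_eq : k.c1 = max
    (((k.lamQ + k.lamH ^ 2 / k.gamR) * (1 + k.alpha1' / k.alpha0') ^ 2 +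
      k.lamR * k.lamB ^ 2 / k.alpha0' ^ 2) * (1 / (2 * k.kappa)))
    ((k.lamQ + k.lamH ^ 2 / k.gamR) * (1 + 1 / (2 * k.kappa))) *
    Real.exp (2 * (k.kappa * k.sigma)) := by
  rw [c1, show 2 * k.kappa * k.sigma = 2 * (k.kappa * k.sigma) by ring]

theorem c1_pos : 0 < k.c1 := by
  have := k.kappa_pos; have := k.lamQ_pos; have := k.gamR_pos
  rw [c1_eq]
  refine mul_pos (lt_max_of_lt_right ?_) (Real.exp_pos _)
  positivity

theorem tail_le_c1 : k.lamQ * (1 + 1 / (2 * k.kappa)) * Real.exp (2 * (k.kappa * k.sigma)) ≤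
    k.c1 := by
  have := k.kappa_pos; have := k.lamH_pos; have := k.gamR_pos
  rw [c1_eq]
  refine mul_le_mul_of_nonneg_right (le_trans ?_ (le_max_right _ _)) (Real.exp_pos _).le
  gcongr
  have : 0 ≤ k.lamH ^ 2 / k.gamR := by positivity
  linarith

theorem window_le_c1 : (k.lamQ * (1 + k.alpha1' / k.alpha0') ^ 2 +
      k.lamR * k.lamB ^ 2 / k.alpha0' ^ 2) *
      (Real.exp (2 * (k.kappa * k.sigma)) / (2 * k.kappa)) ≤ k.c1 := by
  have := k.kappa_pos; have := k.lamH_pos; have := k.gamR_pos; have := k.lamQ_pos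
  rw [c1_eq, div_eq_mul_one_div (Real.exp _), mul_comm (Real.exp _), ← mul_assoc]
  refine mul_le_mul_of_nonneg_right (le_trans ?_ (le_max_left _ _)) (Real.exp_pos _).le
  gcongr
  have : 0 ≤ k.lamH ^ 2 / k.gamR := by positivity
  linarith

theorem rhoZ_pos : 0 < k.rhoZ := by
  have := k.c1_pos; have := k.gamQ_pos
  unfold rhoZ; positivity

theorem cZ_pos : 0 < k.cZ := Real.sqrt_pos.2 (div_pos k.c1_pos k.c0_pos)

theorem cv_pos : 0 < k.cv := by
  have := k.c1_pos; have := k.cZ_pos; have := k.lamW_pos; have := k.lamB_pos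
  have := k.gamR_pos; have := k.lamC_pos; have := k.lamH_pos; have := k.lamG_pos
  unfold cv; positivity

theorem LambdaX_pos : 0 < k.LambdaX := by
  have := k.cv_pos; have := k.cZ_pos; have := k.lamW_pos; have := k.lamB_pos
  have := k.gamR_pos; have := k.lamC_pos; have := k.rhoZ_pos
  unfold LambdaX; positivity

theorem Lambda_pos : 0 < k.Lambda := by
  have := k.cv_pos; have := k.LambdaX_pos; have := k.c1_pos; have := k.lamB_pos
  have := k.gamR_pos; have := k.lamH_pos
  unfold Lambda; positivity

end Constants

/-! ### The reduced Hamiltonian system -/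

section Reduction

/-- Symmetry is part of the Loewner order: it holds for `M - c`, hence for `M`. This is where the
symmetry of `R`, `K` and `Q_T` comes from. -/
theorem symm_of_smul_one_le {n : ℕ} {M : Mat n n} {c : ℝ} (h : c • (1 : Mat n n) ≤ M) (x y : Vec n) :
    inner ℝ (M x) y = inner ℝ x (M y) := by
  have := ((ContinuousLinearMap.le_def _ _).1 h).inner_left_eq_inner_right x y
  simpa [inner_sub_left, inner_sub_right, inner_smul_left, inner_smul_right] using this

theorem le_inner_of_smul_one_le {n : ℕ} {M : Mat n n} {c : ℝ} (h : c • (1 : Mat n n) ≤ M)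
    (x : Vec n) : c * ‖x‖ ^ 2 ≤ inner ℝ x (M x) := by
  have := ((ContinuousLinearMap.le_def _ _).1 h).inner_nonneg_right x
  simpa [inner_sub_right, inner_smul_right] using this

theorem inner_le_of_le_smul_one {n : ℕ} {M : Mat n n} {c : ℝ} (h : M ≤ c • (1 : Mat n n))
    (x : Vec n) : inner ℝ x (M x) ≤ c * ‖x‖ ^ 2 := by
  have := ((ContinuousLinearMap.le_def _ _).1 h).inner_nonneg_right x
  simpa [inner_sub_right, inner_smul_right] using this

theorem isUnit_of_coercive {n : ℕ} {M : Mat n n} {c : ℝ} (hc : 0 < c)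
    (h : ∀ x, c * ‖x‖ ^ 2 ≤ inner ℝ x (M x)) : IsUnit M := by
  refine ContinuousLinearMap.isUnit_of_forall_le_norm_inner_map M (c := ⟨c, hc.le⟩) hc fun x => ?_
  rw [real_inner_comm]
  refine le_trans ?_ (Real.le_norm_self _)
  rw [mul_comm]
  exact h x

namespace Data

variable {nx nu nd : ℕ} (D : Data nx nu nd)

/-- `A - B R⁻¹ H`. -/
noncomputable def F (t : ℝ) : Mat nx nx := D.A t - D.B t ∘L (D.R t).inverse ∘L D.H t

/-- `B R⁻¹ Bᵀ`. -/
noncomputable def N (t : ℝ) : Mat nx nx := D.B t ∘L (D.R t).inverse ∘L (D.B t)†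

/-- `Q - Hᵀ R⁻¹ H`. -/
noncomputable def K (t : ℝ) : Mat nx nx := D.Q t - (D.H t)† ∘L (D.R t).inverse ∘L D.H t

end Data

namespace Assumptions

variable {nx nu nd : ℕ} {k : Constants} {T : ℝ} {D : Data nx nu nd} (h : Assumptions k T D)

include h

theorem T_pos : 0 < T := k.sigma_pos.trans h.sigma_lt

variable {t : ℝ} (ht : t ∈ Icc 0 T)

include ht

theorem isUnitR : IsUnit (D.R t) :=
  isUnit_of_coercive k.gamR_pos (le_inner_of_smul_one_le (h.coerciveR t ht))

theorem inverse_R (u : Vec nu) : (D.R t).inverse (D.R t u) = u := by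
  rw [← ContinuousLinearMap.ringInverse_eq_inverse]
  exact DFunLike.congr_fun (Ring.inverse_mul_cancel _ (h.isUnitR ht)) u

theorem R_inverse (u : Vec nu) : D.R t ((D.R t).inverse u) = u := by
  rw [← ContinuousLinearMap.ringInverse_eq_inverse]
  exact DFunLike.congr_fun (Ring.mul_inverse_cancel _ (h.isUnitR ht)) u

theorem symmR (u v : Vec nu) : inner ℝ (D.R t u) v = inner ℝ u (D.R t v) :=
  symm_of_smul_one_le (h.coerciveR t ht) u v

theorem R_nonneg (u : Vec nu) : 0 ≤ inner ℝ u (D.R t u) := by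
  refine le_trans ?_ (le_inner_of_smul_one_le (h.coerciveR t ht) u)
  have := k.gamR_pos
  positivity

theorem symm_inverse (u v : Vec nu) :
    inner ℝ ((D.R t).inverse u) v = inner ℝ u ((D.R t).inverse v) := by
  conv_lhs => rw [← h.R_inverse ht v]
  rw [← h.symmR ht, h.R_inverse ht]

theorem adjoint_inverse : (((D.R t).inverse)†) = (D.R t).inverse :=
  ((ContinuousLinearMap.eq_adjoint_iff _ _).2 (h.symm_inverse ht)).symm

theorem inverse_nonneg (u : Vec nu) : 0 ≤ inner ℝ u ((D.R t).inverse u) := by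
  have := h.R_nonneg ht ((D.R t).inverse u)
  rwa [h.R_inverse ht, real_inner_comm] at this

theorem norm_inverse_le : ‖(D.R t).inverse‖ ≤ 1 / k.gamR := by
  have hγ := k.gamR_pos
  refine ContinuousLinearMap.opNorm_le_bound _ (by positivity) fun u => ?_
  have h1 := le_inner_of_smul_one_le (h.coerciveR t ht) ((D.R t).inverse u)
  rw [h.R_inverse ht] at h1
  have h2 := h1.trans (real_inner_le_norm _ _)
  rw [one_div, inv_mul_eq_div, le_div_iff₀ hγ]
  rcases (norm_nonneg ((D.R t).inverse u)).eq_or_lt with h0 | h0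
  · rw [← h0]; simp
  · refine le_of_mul_le_mul_left ?_ h0
    linarith

theorem norm_F_le : ‖D.F t‖ ≤ k.kappa := by
  have := k.gamR_pos; have := k.lamB_pos
  refine (norm_sub_le _ _).trans (add_le_add (h.boundA t ht) ?_)
  refine (ContinuousLinearMap.opNorm_comp_le _ _).trans ?_
  calc _ ≤ ‖D.B t‖ * (‖(D.R t).inverse‖ * ‖D.H t‖) := by
        gcongr; exact ContinuousLinearMap.opNorm_comp_le _ _
    _ ≤ k.lamB * (1 / k.gamR * k.lamH) := by
        gcongr
        exacts [h.boundB t ht, h.norm_inverse_le ht, h.boundH t ht]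
    _ = _ := by ring

theorem norm_N_le : ‖D.N t‖ ≤ k.lamB ^ 2 / k.gamR := by
  have := k.gamR_pos; have := k.lamB_pos
  refine (ContinuousLinearMap.opNorm_comp_le _ _).trans ?_
  calc _ ≤ ‖D.B t‖ * (‖(D.R t).inverse‖ * ‖(D.B t)†‖) := by
        gcongr; exact ContinuousLinearMap.opNorm_comp_le _ _
    _ ≤ k.lamB * (1 / k.gamR * k.lamB) := by
        rw [LinearIsometryEquiv.norm_map]
        gcongr
        exacts [h.boundB t ht, h.norm_inverse_le ht, h.boundB t ht]
    _ = _ := by ring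

theorem inner_N_le (v : Vec nx) : inner ℝ v (D.N t v) ≤ k.lamB ^ 2 / k.gamR * ‖v‖ ^ 2 := by
  refine (real_inner_le_norm _ _).trans ?_
  have := (D.N t).le_opNorm v
  have := h.norm_N_le ht
  calc ‖v‖ * ‖D.N t v‖ ≤ ‖v‖ * (k.lamB ^ 2 / k.gamR * ‖v‖) := by
        gcongr; exact (D.N t).le_of_opNorm_le this v
    _ = _ := by ring

/-- The subtracted term `HᵀR⁻¹H` is positive semidefinite, so the bound of `Q` alone suffices. -/
theorem inner_K_le (v : Vec nx) : inner ℝ v (D.K t v) ≤ k.lamQ * ‖v‖ ^ 2 := by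
  have h1 := h.inverse_nonneg ht (D.H t v)
  have h2 : inner ℝ v (D.Q t v) ≤ k.lamQ * ‖v‖ ^ 2 := by
    refine (real_inner_le_norm _ _).trans ?_
    calc ‖v‖ * ‖D.Q t v‖ ≤ ‖v‖ * (k.lamQ * ‖v‖) := by
          gcongr; exact (D.Q t).le_of_opNorm_le (h.boundQ t ht) v
      _ = _ := by ring
  simp only [Data.K, sub_apply, ContinuousLinearMap.comp_apply, inner_sub_right,
    ContinuousLinearMap.adjoint_inner_right]
  linarith

theorem symmQ (x y : Vec nx) : inner ℝ (D.Q t x) y = inner ℝ x (D.Q t y) := by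
  have := symm_of_smul_one_le (h.coerciveQ t ht) x y
  simp only [sub_apply, ContinuousLinearMap.comp_apply, inner_sub_left, inner_sub_right,
    ContinuousLinearMap.adjoint_inner_right, ContinuousLinearMap.adjoint_inner_left,
    h.symm_inverse ht] at this
  linarith

omit ht

theorem contInverse : ContinuousOn (fun t => (D.R t).inverse) (Icc 0 T) := by
  intro t ht
  obtain ⟨u, hu⟩ := h.isUnitR ht
  have h1 := NormedRing.inverse_continuousAt u
  rw [hu] at h1
  simp only [← ContinuousLinearMap.ringInverse_eq_inverse]
  exact h1.comp_continuousWithinAt (h.contR t ht)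

theorem isHamiltonianSystem : IsHamiltonianSystem T k.gamQ D.F D.N D.K D.QT := by
  have hA := h.contA
  have hB := h.contB
  have hH := h.contH
  have hQ := h.contQ
  have hR := h.contInverse
  have hB' := continuousOn_adjoint h.contB
  have hH' := continuousOn_adjoint h.contH
  refine ⟨h.T_pos, k.gamQ_pos, ?_, ?_, ?_, fun t ht x y => ?_, fun t ht x y => ?_,
    symm_of_smul_one_le h.coerciveQT, fun t ht x => ?_, fun t ht x => ?_,
    le_inner_of_smul_one_le h.coerciveQT⟩
  · unfold Data.F; fun_prop
  · unfold Data.N; fun_prop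
  · unfold Data.K; fun_prop
  · simp only [Data.N, ContinuousLinearMap.comp_apply]
    rw [← ContinuousLinearMap.adjoint_inner_right, h.symm_inverse ht,
      ContinuousLinearMap.adjoint_inner_left]
  · exact symm_of_smul_one_le (h.coerciveQ t ht) x y
  · have := h.inverse_nonneg ht (((D.B t)†) x)
    simpa only [Data.N, ContinuousLinearMap.comp_apply, ContinuousLinearMap.adjoint_inner_left]
      using this
  · exact le_inner_of_smul_one_le (h.coerciveQ t ht) x

end Assumptions

end Reduction


/-! ### The controllability Gramian and the bounds of the value function -/

section Evolution

variable {n m : ℕ} {T : ℝ} {A : ℝ → Mat n n} {Φ : ℝ → ℝ → Mat n n}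

/-- `IsEvolution` speaks only of the first time argument. If `Z' = -AᵀZ` and `Z(a) = 1`, then
`Z(r)ᵀΦ(r,s)` is constant in `r`. This identifies `Φ(a,s)` with `Z(s)ᵀ`, which can be differentiated
in `s`, and shows that it is a left inverse of `Φ(s,a)`. -/
theorem IsEvolution.hasDerivWithinAt_snd (hΦ : IsEvolution T A Φ) (hT : 0 < T)
    (hA : ContinuousOn A (Icc 0 T)) {a : ℝ} (ha : a ∈ Icc 0 T) :
    (∀ s ∈ Icc 0 T, HasDerivWithinAt (Φ a) (-(Φ a s ∘L A s)) (Icc 0 T) s) ∧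
    ∀ s ∈ Icc 0 T, Φ a s ∘L Φ s a = 1 := by
  obtain ⟨Z, hZ, hZ'⟩ := exists_fundamental hT (M := fun t => -((A t)†))
    (continuousOn_adjoint hA).neg ha
  have hd : ∀ s ∈ Icc 0 T, HasDerivWithinAt (fun t => (Z t)†) (-((Z s)† ∘L A s)) (Icc 0 T) s := by
    intro s hs
    refine (hasDerivWithinAt_adjoint (hZ' s hs)).congr_deriv ?_
    rw [ContinuousLinearMap.adjoint_comp, map_neg, ContinuousLinearMap.adjoint_adjoint,
      ContinuousLinearMap.comp_neg]
  have hconst : ∀ s ∈ Icc 0 T, ∀ r ∈ Icc 0 T, ((Z r)†) ∘L Φ r s = (Z s)† := by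
    intro s hs r hr
    have h1 := eq_of_hasDerivWithinAt_zero (f := fun r => ((Z r)†) ∘L Φ r s) (fun q hq =>
      ((hd q hq).clm_comp ((hΦ s hs).2 q hq)).congr_deriv (by ext v; simp)) hr hs
    rw [h1, (hΦ s hs).1]
    rfl
  have hZa : ((Z a)†) = 1 := by
    rw [hZ]
    exact ((ContinuousLinearMap.eq_adjoint_iff _ _).2 (fun x y => rfl)).symm
  have hEq : ∀ s ∈ Icc 0 T, Φ a s = (Z s)† := by
    intro s hs
    rw [← hconst s hs a ha, hZa]
    rfl
  refine ⟨fun s hs => ?_, fun s hs => ?_⟩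
  · rw [hEq s hs]
    exact (hd s hs).congr hEq (hEq s hs)
  · rw [hEq s hs, hconst a ha s hs, hZa]

theorem hasDerivWithinAt_gramian (hT : 0 < T)
    (hA : ContinuousOn A (Icc 0 T)) {B : ℝ → Mat n m} (hB : ContinuousOn B (Icc 0 T)) {a b : ℝ}
    (ha : 0 ≤ a) (hab : a ≤ b) (hb : b ≤ T) {s : ℝ} (hs : s ∈ Icc a b) :
    HasDerivWithinAt (gramian T A B a) (evolution T A a s ∘L B s ∘L (B s)† ∘L
      (evolution T A a s)†) (Icc a b) s := by
  have ha' : a ∈ Icc 0 T := ⟨ha, hab.trans hb⟩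
  have hΦ := (evolution_spec hT hA).hasDerivWithinAt_snd hT hA ha'
  have hc : ContinuousOn (evolution T A a) (Icc 0 T) :=
    fun s hs => (hΦ.1 s hs).continuousWithinAt
  have hc' := continuousOn_adjoint hc
  have hB' := continuousOn_adjoint hB
  have hg : ContinuousOn (fun s => evolution T A a s ∘L B s ∘L (B s)† ∘L
      (evolution T A a s)†) (Icc a b) :=
    ContinuousOn.mono (by fun_prop) (Icc_subset_Icc ha hb)
  have : Fact (s ∈ Icc a b) := ⟨hs⟩
  have hi : IntervalIntegrable (fun s => evolution T A a s ∘L B s ∘L (B s)† ∘L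
      (evolution T A a s)†) volume a s :=
    (hg.mono (Icc_subset_Icc_right hs.2)).intervalIntegrable_of_Icc hs.1
  exact intervalIntegral.integral_hasDerivWithinAt_right hi
    (hg.stronglyMeasurableAtFilter_nhdsWithin measurableSet_Icc s) (hg s hs)

end Evolution

/-! ### The upper bound on a controllability window, and the two-sided bound. -/

section Window

variable {nx nu nd : ℕ} {k : Constants} {T : ℝ} {D : Data nx nu nd}

/-- With `z = G(b)⁻¹x(a)`, the control `-BᵀΦ(a,s)ᵀz` steers the pair `(A,B)` from `x(a)` along `ξ(s)
= Φ(s,a)(x(a) - G(s)z)` to `ξ(b) = 0`. Adding the feedback `R⁻¹Hξ` makes `ξ` a trajectory of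
`(F,B)`, and its cost bounds `⟨x,λ⟩` by `inner_le_of_trajectory`. -/
theorem Assumptions.inner_le_window (h : Assumptions k T D) {x lam : ℝ → Vec nx}
    (hs : IsHamiltonianSolution T D.F D.N D.K x lam) (hT : lam T = D.QT (x T)) {a : ℝ}
    (ha : a ∈ Icc 0 (T - k.sigma)) : inner ℝ (x a) (lam a) ≤ k.c1 * ‖x a‖ ^ 2 := by
  have H := h.isHamiltonianSystem
  obtain ⟨b, hb, hG0, hG1, -, -⟩ := h.controllable a ha
  have hκ := k.kappa_pos
  have hα := k.alpha0_pos
  have hα1 := k.alpha1_pos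
  have hA := k.lamA_pos
  have hγ := k.gamR_pos
  have hlB := k.lamB_pos
  have hlH := k.lamH_pos
  have hlQ := k.lamQ_pos
  have hlR := k.lamR_pos
  have hbT : b ≤ T := by linarith [hb.2, ha.2]
  have haT : a ∈ Icc 0 T := ⟨ha.1, hb.1.trans hbT⟩
  have hbT' : b ∈ Icc 0 T := ⟨ha.1.trans hb.1, hbT⟩
  have hsub : Icc a b ⊆ Icc 0 T := Icc_subset_Icc ha.1 hbT
  have hΦ := evolution_spec h.T_pos h.contA
  set Φ := evolution T D.A with hΦdef
  set G := gramian T D.A D.B a with hGdef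
  obtain ⟨hΨ, hΨΦ⟩ := hΦ.hasDerivWithinAt_snd h.T_pos h.contA haT
  have hΦΨ : ∀ s ∈ Icc 0 T, ∀ v, Φ s a (Φ a s v) = v := fun s hs' v =>
    DFunLike.congr_fun ((hΦ.hasDerivWithinAt_snd h.T_pos h.contA hs').2 a haT) v
  have hGd : ∀ s ∈ Icc a b, HasDerivWithinAt G (Φ a s ∘L D.B s ∘L (D.B s)† ∘L (Φ a s)†)
      (Icc a b) s := fun s hs' => hasDerivWithinAt_gramian h.T_pos h.contA h.contB ha.1 hb.1 hbT hs'
  have hGa : G a = 0 := by simp [hGdef, gramian]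
  have hΦa : Φ a a = 1 := (hΦ a haT).1
  -- the quadratic form of the Gramian
  let u : Vec nx → ℝ → Vec nu := fun v s => ((D.B s)†) (((Φ a s)†) v)
  have hGq : ∀ v, ∀ s ∈ Icc a b, HasDerivWithinAt (fun s => inner ℝ v (G s v)) (‖u v s‖ ^ 2)
      (Icc a b) s := by
    intro v s hs'
    refine ((hasDerivWithinAt_const s (Icc a b) v).inner ℝ
      (hasDerivWithinAt_apply (hGd s hs') v)).congr_deriv ?_
    simp only [inner_zero_left, add_zero, ContinuousLinearMap.comp_apply, u]
    rw [← ContinuousLinearMap.adjoint_inner_left, ← ContinuousLinearMap.adjoint_inner_left,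
      real_inner_self_eq_norm_sq]
  have hGmono : ∀ v, ∀ s ∈ Icc a b, 0 ≤ inner ℝ v (G s v) ∧
      inner ℝ v (G s v) ≤ inner ℝ v (G b v) := by
    intro v s hs'
    constructor
    · have := le_of_hasDerivWithinAt_nonneg hs'.1 (fun r hr => (hGq v r ⟨hr.1, hr.2.trans hs'.2⟩).mono
        (Icc_subset_Icc_right hs'.2)) (fun r _ => sq_nonneg _)
      simpa [hGa] using this
    · exact le_of_hasDerivWithinAt_nonneg hs'.2 (fun r hr => (hGq v r ⟨hs'.1.trans hr.1, hr.2⟩).mono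
        (Icc_subset_Icc_left hs'.1)) (fun r _ => sq_nonneg _)
  have hGsymm : ∀ s ∈ Icc a b, ∀ v w, inner ℝ (G s v) w = inner ℝ v (G s w) := by
    intro s hs' v w
    have := eq_of_hasDerivWithinAt_zero
      (f := fun s => inner ℝ (G s v) w - inner ℝ v (G s w)) (fun r hr => by
        refine (((hasDerivWithinAt_apply (hGd r hr) v).inner ℝ
          (hasDerivWithinAt_const r (Icc a b) w)).sub
          ((hasDerivWithinAt_const r (Icc a b) v).inner ℝ
          (hasDerivWithinAt_apply (hGd r hr) w))).congr_deriv ?_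
        simp only [inner_zero_left, inner_zero_right, add_zero, zero_add,
          ContinuousLinearMap.comp_apply]
        have e : ∀ p q, inner ℝ (Φ a r (D.B r (u p r))) q = inner ℝ (u p r) (u q r) :=
          fun p q => by simp only [u, ContinuousLinearMap.adjoint_inner_right]
        change inner ℝ (Φ a r (D.B r (u v r))) w - inner ℝ v (Φ a r (D.B r (u w r))) = 0
        rw [real_inner_comm (Φ a r (D.B r (u w r))) v, e, e, real_inner_comm (u v r),
          sub_self]) hs' (left_mem_Icc.2 hb.1)
    simp only [hGa, zero_apply, inner_zero_left, inner_zero_right, sub_self] at this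
    linarith
  -- The growth rate `λ_A` is weakened to `κ`, so that `α₁'`, which is built from `κ`, also bounds
  -- the Gramian of `(A,B)` from above.
  have hub : ∀ v, ∀ s ∈ Icc a b, ‖u v s‖ ^ 2 ≤
      k.lamB ^ 2 * ‖v‖ ^ 2 * Real.exp (2 * (k.kappa * (s - a))) := by
    intro v s hs'
    have hsubs : Icc a s ⊆ Icc 0 T := (Icc_subset_Icc_right hs'.2).trans hsub
    have h1 := norm_le_exp_of_norm_deriv_le (κ := k.kappa) hs'.1
      (y := fun r => ((Φ a r)†) v) (y' := fun r => -((D.A r)†) (((Φ a r)†) v))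
      (fun r hr => by
        refine (hasDerivWithinAt_apply (hasDerivWithinAt_adjoint
          ((hΨ r (hsubs hr)).mono hsubs)) v).congr_deriv ?_
        rw [map_neg, ContinuousLinearMap.adjoint_comp]; rfl)
      (fun r hr => by
        rw [norm_neg]
        refine (ContinuousLinearMap.le_opNorm _ _).trans
          (mul_le_mul_of_nonneg_right ?_ (norm_nonneg _))
        rw [LinearIsometryEquiv.norm_map]
        exact (h.boundA r (hsubs hr)).trans k.lamA_le_kappa)
    have h2 : ‖((Φ a a)†) v‖ = ‖v‖ := by
      rw [hΦa, ← ((ContinuousLinearMap.eq_adjoint_iff (1 : Mat nx nx) 1).2 (fun x y => rfl))]; rfl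
    simp only [h2] at h1
    rw [exp_two_mul_eq_sq, ← mul_pow, ← mul_pow]
    refine pow_le_pow_left₀ (norm_nonneg _) ?_ 2
    refine (ContinuousLinearMap.le_opNorm _ _).trans ?_
    rw [LinearIsometryEquiv.norm_map]
    calc ‖D.B s‖ * ‖((Φ a s)†) v‖ ≤ k.lamB * (Real.exp (k.kappa * (s - a)) * ‖v‖) :=
          mul_le_mul (h.boundB s (hsub hs')) h1 (norm_nonneg _) hlB.le
      _ = _ := by ring
  have hσ : ∀ c, 0 < c → ∀ s ∈ Icc a b, Real.exp (2 * (c * (s - a))) ≤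
      Real.exp (2 * (c * k.sigma)) := fun c hc s hs' => by
    have : s - a ≤ k.sigma := by linarith [hs'.2, hb.2]
    gcongr
  have hGα' : ∀ v, ∀ s ∈ Icc a b, inner ℝ v (G s v) ≤ k.alpha1' * ‖v‖ ^ 2 := by
    intro v s hs'
    have h1 := le_of_hasDerivWithinAt_nonneg hs'.1 (fun r hr =>
      (hasDerivAt_exp_primitive hκ (k.lamB ^ 2 * ‖v‖ ^ 2) a r).hasDerivWithinAt.sub
      ((hGq v r ⟨hr.1, hr.2.trans hs'.2⟩).mono (Icc_subset_Icc_right hs'.2)))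
      (fun r hr => sub_nonneg.2 (hub v r ⟨hr.1, hr.2.trans hs'.2⟩))
    simp only [Pi.sub_apply, hGa, zero_apply, inner_zero_right, sub_self, mul_zero,
      Real.exp_zero, sub_zero] at h1
    have h2 : k.lamB ^ 2 * ‖v‖ ^ 2 * (Real.exp (2 * (k.kappa * (s - a))) / (2 * k.kappa)) ≤
        k.lamB ^ 2 * ‖v‖ ^ 2 * (Real.exp (2 * (k.kappa * k.sigma)) / (2 * k.kappa)) := by
      have := hσ k.kappa hκ s hs'
      gcongr
    rw [k.alpha1'_eq, sub_div]
    linarith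
  have hGn : ∀ s ∈ Icc a b, ∀ v, ‖G s v‖ ≤ k.alpha1 * ‖v‖ := fun s hs' =>
    norm_apply_le_of_inner_le (hGsymm s hs') hα1 (fun v => (hGmono v s hs').1)
      (fun v => (hGmono v s hs').2.trans (inner_le_of_le_smul_one hG1 v))
  have hGn' : ∀ s ∈ Icc a b, ∀ v, ‖G s v‖ ≤ k.alpha1' * ‖v‖ := fun s hs' =>
    norm_apply_le_of_inner_le (hGsymm s hs') k.alpha1'_pos (fun v => (hGmono v s hs').1)
      (fun v => hGα' v s hs')
  -- the control steering `x a` to the origin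
  obtain ⟨z, hz⟩ : ∃ z, G b z = x a := by
    have := (ContinuousLinearMap.isUnit_iff_bijective.1
      (isUnit_of_coercive hα (le_inner_of_smul_one_le hG0))).2 (x a)
    exact this
  have hzn : ‖z‖ ≤ ‖x a‖ / k.alpha0 := by
    have h1 := le_inner_of_smul_one_le hG0 z
    change _ ≤ inner ℝ z (G b z) at h1
    rw [hz] at h1
    have h2 := h1.trans (real_inner_le_norm _ _)
    rw [le_div_iff₀ hα]
    rcases (norm_nonneg z).eq_or_lt with h0 | h0
    · rw [← h0]; simp
    · refine le_of_mul_le_mul_left ?_ h0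
      linarith
  have hzx : inner ℝ z (G b z) ≤ ‖x a‖ ^ 2 / k.alpha0 := by
    rw [hz]
    refine (real_inner_le_norm _ _).trans ?_
    calc ‖z‖ * ‖x a‖ ≤ ‖x a‖ / k.alpha0 * ‖x a‖ := by gcongr
      _ = _ := by ring
  let y : ℝ → Vec nx := fun s => x a - G s z
  let ξ : ℝ → Vec nx := fun s => Φ s a (y s)
  -- Two bounds of the same quantity are kept: this one enters the control cost and reproduces
  -- `α₀'`, the next one enters the state cost and reproduces the factor `(1 + α₁'/α₀')²` in `c1`.
  have hyn : ∀ s ∈ Icc a b, ‖y s‖ ≤ (1 + k.alpha1 / k.alpha0) * ‖x a‖ := by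
    intro s hs'
    refine (norm_sub_le _ _).trans ?_
    calc ‖x a‖ + ‖G s z‖ ≤ ‖x a‖ + k.alpha1 * (‖x a‖ / k.alpha0) := by
          gcongr
          exact (hGn s hs' z).trans (by gcongr)
      _ = _ := by ring
  have hyn' : ∀ s ∈ Icc a b, ‖y s‖ ≤ (1 + k.alpha1' / k.alpha0') * ‖x a‖ := by
    intro s hs'
    have h1 := k.alpha0'_pos
    have h2 := k.alpha0'_le
    have h3 := k.alpha1'_pos
    refine (norm_sub_le _ _).trans ?_
    calc ‖x a‖ + ‖G s z‖ ≤ ‖x a‖ + k.alpha1' * (‖x a‖ / k.alpha0') := by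
          gcongr
          refine (hGn' s hs' z).trans ?_
          gcongr
          exact hzn.trans (by gcongr)
      _ = _ := by ring
  have hΦn : ∀ s ∈ Icc a b, ∀ v, ‖Φ s a v‖ ≤ Real.exp (k.lamA * (s - a)) * ‖v‖ := by
    intro s hs' v
    have hsubs : Icc a s ⊆ Icc 0 T := (Icc_subset_Icc_right hs'.2).trans hsub
    have h1 := norm_le_exp_of_norm_deriv_le (κ := k.lamA) hs'.1
      (y := fun r => Φ r a v) (y' := fun r => D.A r (Φ r a v))
      (fun r hr => hasDerivWithinAt_apply (((hΦ a haT).2 r (hsubs hr)).mono hsubs) v)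
      (fun r hr => (ContinuousLinearMap.le_opNorm _ _).trans
          (mul_le_mul_of_nonneg_right (h.boundA r (hsubs hr)) (norm_nonneg _)))
    simpa [hΦa] using h1
  have hξn : ∀ s ∈ Icc a b, ‖ξ s‖ ^ 2 ≤
      (1 + k.alpha1 / k.alpha0) ^ 2 * ‖x a‖ ^ 2 * Real.exp (2 * (k.lamA * (s - a))) := by
    intro s hs'
    rw [exp_two_mul_eq_sq, ← mul_pow, ← mul_pow]
    refine pow_le_pow_left₀ (norm_nonneg _) ((hΦn s hs' _).trans ?_) 2
    rw [mul_comm]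
    exact mul_le_mul_of_nonneg_right (hyn s hs') (Real.exp_pos _).le
  have hξn' : ∀ s ∈ Icc a b, ‖ξ s‖ ^ 2 ≤
      (1 + k.alpha1' / k.alpha0') ^ 2 * ‖x a‖ ^ 2 * Real.exp (2 * (k.kappa * (s - a))) := by
    intro s hs'
    rw [exp_two_mul_eq_sq, ← mul_pow, ← mul_pow]
    refine pow_le_pow_left₀ (norm_nonneg _) ((hΦn s hs' _).trans ?_) 2
    rw [mul_comm]
    have h1 : Real.exp (k.lamA * (s - a)) ≤ Real.exp (k.kappa * (s - a)) := by
      have := k.lamA_le_kappa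
      have : 0 ≤ s - a := by linarith [hs'.1]
      gcongr
    exact mul_le_mul (hyn' s hs') h1 (Real.exp_pos _).le
      ((norm_nonneg _).trans (hyn' s hs'))
  let ω : ℝ → Vec nu := fun s => (D.R s).inverse (D.H s (ξ s)) - u z s
  -- The factor `2` of this splitting is the numerator of `2/α₀` in the definition of `α₀'`.
  have hωn : ∀ s ∈ Icc a b, ‖ω s‖ ^ 2 ≤
      2 * ((k.lamH / k.gamR) ^ 2 * ‖ξ s‖ ^ 2) + 2 * ‖u z s‖ ^ 2 := by
    intro s hs'
    have h1 : ‖(D.R s).inverse (D.H s (ξ s))‖ ≤ k.lamH / k.gamR * ‖ξ s‖ := by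
      refine ((D.R s).inverse.le_of_opNorm_le (h.norm_inverse_le (hsub hs')) _).trans ?_
      calc _ ≤ 1 / k.gamR * (k.lamH * ‖ξ s‖) := by
            gcongr; exact (D.H s).le_of_opNorm_le (h.boundH s (hsub hs')) _
        _ = _ := by ring
    have h2 : ‖ω s‖ ≤ k.lamH / k.gamR * ‖ξ s‖ + ‖u z s‖ :=
      (norm_sub_le _ _).trans (add_le_add h1 le_rfl)
    have h3 : ‖ω s‖ ^ 2 ≤ (k.lamH / k.gamR * ‖ξ s‖ + ‖u z s‖) ^ 2 := by gcongr
    nlinarith [sq_nonneg (k.lamH / k.gamR * ‖ξ s‖ - ‖u z s‖)]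
  have hξd : ∀ s ∈ Icc a b, HasDerivWithinAt ξ (D.F s (ξ s) + D.B s (ω s)) (Icc a b) s := by
    intro s hs'
    have h1 := ((hΦ a haT).2 s (hsub hs')).mono hsub |>.clm_apply
      ((hasDerivWithinAt_apply (hGd s hs') z).const_sub (x a))
    refine h1.congr_deriv ?_
    simp only [ContinuousLinearMap.comp_apply, map_neg, hΦΨ s (hsub hs'), Data.F, sub_apply,
      ω, u, map_sub, ξ, y]
    abel
  have hζ : ∀ s ∈ Icc a b, ∀ v, 0 ≤ inner ℝ v (D.N s v) + 2 * inner ℝ v (D.B s (ω s)) +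
      inner ℝ (ω s) (D.R s (ω s)) := by
    intro s hs' v
    -- The expression in question is a complete square: the `R`-form of `R⁻¹Bᵀv + ω`.
    have h1 := h.R_nonneg (hsub hs') ((D.R s).inverse (((D.B s)†) v) + ω s)
    have h2 : inner ℝ (ω s) (((D.B s)†) v) = inner ℝ v (D.B s (ω s)) := by
      rw [real_inner_comm, ContinuousLinearMap.adjoint_inner_left]
    have h3 : inner ℝ ((D.R s).inverse (((D.B s)†) v)) (D.R s (ω s)) =
        inner ℝ v (D.B s (ω s)) := by
      rw [← h.symmR (hsub hs'), h.R_inverse (hsub hs'), ContinuousLinearMap.adjoint_inner_left]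
    have h4 : inner ℝ ((D.R s).inverse (((D.B s)†) v)) (((D.B s)†) v) = inner ℝ v (D.N s v) := by
      rw [ContinuousLinearMap.adjoint_inner_right, real_inner_comm]; rfl
    simp only [map_add, h.R_inverse (hsub hs'), inner_add_left, inner_add_right, h2, h3, h4] at h1
    linarith
  have key := H.inner_le_of_trajectory hs ha.1 hb.1 hbT (ξ := ξ) (ζ := fun s => D.B s (ω s))
    (r := fun s => inner ℝ (ω s) (D.R s (ω s)))
    (β := fun s => (k.lamQ * ((1 + k.alpha1' / k.alpha0') ^ 2 * ‖x a‖ ^ 2)) *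
        (Real.exp (2 * (k.kappa * (s - a))) / (2 * k.kappa)) +
      ((k.lamR * (2 * (k.lamH / k.gamR) ^ 2) * ((1 + k.alpha1 / k.alpha0) ^ 2 * ‖x a‖ ^ 2)) *
        (Real.exp (2 * (k.lamA * (s - a))) / (2 * k.lamA)) +
      (k.lamR * 2) * inner ℝ z (G s z)))
    (by simp [ξ, y, hGa, hΦa]) hξd hζ
    (fun s hs' => ((hasDerivAt_exp_primitive hκ _ a s).hasDerivWithinAt).add
      (((hasDerivAt_exp_primitive hA _ a s).hasDerivWithinAt).add ((hGq z s hs').const_mul _)))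
    (fun s hs' => by
      have h1 : inner ℝ (ω s) (D.R s (ω s)) ≤ k.lamR * ‖ω s‖ ^ 2 := by
        refine (real_inner_le_norm _ _).trans ?_
        calc ‖ω s‖ * ‖D.R s (ω s)‖ ≤ ‖ω s‖ * (k.lamR * ‖ω s‖) := by
              gcongr; exact (D.R s).le_of_opNorm_le (h.boundR s (hsub hs')) _
          _ = _ := by ring
      have h2 := h.inner_K_le (hsub hs') (ξ s)
      have h3 := mul_le_mul_of_nonneg_left (hξn' s hs') hlQ.le
      have h4 := mul_le_mul_of_nonneg_left (hωn s hs') hlR.le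
      have h5 := mul_le_mul_of_nonneg_left (hξn s hs')
        (by positivity : 0 ≤ k.lamR * (2 * (k.lamH / k.gamR) ^ 2))
      linarith)
  have hξb : ξ b = 0 := by simp [ξ, y, hz]
  have hVb : 0 ≤ inner ℝ (x b) (lam b) := by
    refine le_trans ?_ (H.le_inner hs hT hbT')
    have := k.gamQ_pos
    positivity
  simp only [hξb, inner_zero_right, sub_self, mul_zero, Real.exp_zero, hGa, zero_apply] at key
  have hE := hσ k.kappa hκ b (right_mem_Icc.2 hb.1)
  have hE' := hσ k.lamA hA b (right_mem_Icc.2 hb.1)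
  have hα' := k.alpha0'_pos
  -- The control energy is at most `λ_R‖x(a)‖²/α₀'`, since the integral of `‖u z‖²` over the window
  -- is `⟨z, G(b)z⟩ ≤ ‖x(a)‖²/α₀`.
  have e1 : k.lamR * (2 * (k.lamH / k.gamR) ^ 2) * ((1 + k.alpha1 / k.alpha0) ^ 2 * ‖x a‖ ^ 2) *
      ((Real.exp (2 * (k.lamA * (b - a))) - 1) / (2 * k.lamA)) +
      k.lamR * 2 * inner ℝ z (G b z) ≤ k.lamR * ‖x a‖ ^ 2 * k.alpha0'⁻¹ := by
    rw [k.inv_alpha0', show 2 * k.lamA * k.sigma = 2 * (k.lamA * k.sigma) by ring]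
    calc _ ≤ k.lamR * (2 * (k.lamH / k.gamR) ^ 2) *
          ((1 + k.alpha1 / k.alpha0) ^ 2 * ‖x a‖ ^ 2) *
          ((Real.exp (2 * (k.lamA * k.sigma)) - 1) / (2 * k.lamA)) +
          k.lamR * 2 * (‖x a‖ ^ 2 / k.alpha0) := by gcongr
      _ = _ := by field_simp; ring
  have e2 : k.lamR * ‖x a‖ ^ 2 * k.alpha0'⁻¹ ≤ k.lamR * k.lamB ^ 2 / k.alpha0' ^ 2 *
      (Real.exp (2 * (k.kappa * k.sigma)) / (2 * k.kappa)) * ‖x a‖ ^ 2 := by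
    -- Only `1/α₀'` is needed, but `c1` contains `λ_B²/α₀'²`. The gap is closed by `α₀' ≤ α₀` and
    -- the two Gramian bounds tested on `x(a)` itself, so that no nonzero vector has to exist.
    have e3 : k.alpha0' * ‖x a‖ ^ 2 ≤
        k.lamB ^ 2 * (Real.exp (2 * (k.kappa * k.sigma)) / (2 * k.kappa)) * ‖x a‖ ^ 2 := by
      have h1 := le_inner_of_smul_one_le hG0 (x a)
      have h2 := hGα' (x a) b (right_mem_Icc.2 hb.1)
      have h3 := k.alpha1'_le
      have h4 := k.alpha0'_le
      calc _ ≤ k.alpha0 * ‖x a‖ ^ 2 := by gcongr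
        _ ≤ k.alpha1' * ‖x a‖ ^ 2 := h1.trans h2
        _ ≤ _ := by gcongr
    calc _ = k.lamR * (k.alpha0'⁻¹) ^ 2 * (k.alpha0' * ‖x a‖ ^ 2) := by field_simp
      _ ≤ k.lamR * (k.alpha0'⁻¹) ^ 2 * (k.lamB ^ 2 *
          (Real.exp (2 * (k.kappa * k.sigma)) / (2 * k.kappa)) * ‖x a‖ ^ 2) := by gcongr
      _ = _ := by field_simp
  have e4 : k.lamQ * ((1 + k.alpha1' / k.alpha0') ^ 2 * ‖x a‖ ^ 2) *
      (Real.exp (2 * (k.kappa * (b - a))) / (2 * k.kappa)) ≤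
      k.lamQ * ((1 + k.alpha1' / k.alpha0') ^ 2 * ‖x a‖ ^ 2) *
      (Real.exp (2 * (k.kappa * k.sigma)) / (2 * k.kappa)) := by gcongr
  have e5 : 0 ≤ k.lamQ * ((1 + k.alpha1' / k.alpha0') ^ 2 * ‖x a‖ ^ 2) * (1 / (2 * k.kappa)) := by
    positivity
  have e6 := mul_le_mul_of_nonneg_right k.window_le_c1 (sq_nonneg ‖x a‖)
  rw [sub_div, mul_sub] at e1
  linarith

/-- The two-sided bound of the value function. -/
theorem Assumptions.value_bounds (h : Assumptions k T D) {x lam : ℝ → Vec nx}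
    (hs : IsHamiltonianSolution T D.F D.N D.K x lam) (hT : lam T = D.QT (x T)) {t : ℝ}
    (ht : t ∈ Icc 0 T) : k.c0 * ‖x t‖ ^ 2 ≤ inner ℝ (x t) (lam t) ∧
      inner ℝ (x t) (lam t) ≤ k.c1 * ‖x t‖ ^ 2 := by
  have H := h.isHamiltonianSystem
  have hν : 0 ≤ k.lamB ^ 2 / k.gamR := by have := k.gamR_pos; positivity
  -- Up to `T - σ` a full window fits into the remaining horizon; later, the tail bounds, which use
  -- the terminal cost, take over.
  rcases le_total t (T - k.sigma) with h1 | h1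
  · exact ⟨H.le_inner_window hs hT k.kappa_pos k.sigma_pos (fun t ht => h.norm_F_le ht) hν
      (fun t ht => h.inner_N_le ht) k.c0_pos.le k.c0_mul_window_le ht.1 (by linarith),
      h.inner_le_window hs hT ⟨ht.1, h1⟩⟩
  · refine ⟨H.le_inner_tail hs hT k.kappa_pos (fun t ht => h.norm_F_le ht) hν
      (fun t ht => h.inner_N_le ht) k.c0_pos.le k.c0_mul_tail_le ht (by linarith),
      (H.inner_le_tail hs hT k.kappa_pos (fun t ht => h.norm_F_le ht) k.lamQ_pos.le
        (fun t ht => h.inner_K_le ht) (inner_le_of_le_smul_one h.boundQT) ht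
        (by linarith : T - t ≤ k.sigma)).trans ?_⟩
    exact mul_le_mul_of_nonneg_right k.tail_le_c1 (sq_nonneg _)

end Window


/-! ### Square-integrable functions -/

section MemLpLemmas

variable {E F : Type*} [NormedAddCommGroup E] [NormedSpace ℝ E] [NormedAddCommGroup F]
    [NormedSpace ℝ F] {T : ℝ}

theorem memLp_two_clm_apply {M : ℝ → E →L[ℝ] F} {g : ℝ → E} (hM : ContinuousOn M (Icc 0 T))
    (hg : MemLp g 2 (volume.restrict (Icc 0 T))) :
    MemLp (fun t => M t (g t)) 2 (volume.restrict (Icc 0 T)) := by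
  obtain ⟨C, hC⟩ := isCompact_Icc.exists_bound_of_continuousOn hM
  refine MemLp.of_le_mul (c := C) hg
    ((ContinuousLinearMap.id ℝ (E →L[ℝ] F)).aestronglyMeasurable_comp₂
      (hM.aestronglyMeasurable measurableSet_Icc) hg.1) ?_
  exact (ae_restrict_iff' measurableSet_Icc).2 (Eventually.of_forall fun t ht =>
    (M t).le_of_opNorm_le (hC t ht) _)

omit [NormedSpace ℝ E] in
theorem memLp_two_of_continuousOn {g : ℝ → E} (hg : ContinuousOn g (Icc 0 T)) :
    MemLp g 2 (volume.restrict (Icc 0 T)) := by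
  obtain ⟨C, hC⟩ := isCompact_Icc.exists_bound_of_continuousOn hg
  exact MemLp.of_bound (hg.aestronglyMeasurable measurableSet_Icc) C
    ((ae_restrict_iff' measurableSet_Icc).2 (Eventually.of_forall hC))

omit [NormedSpace ℝ E] in
theorem intervalIntegrable_of_memLp_two (hT : 0 ≤ T) {g : ℝ → E}
    (hg : MemLp g 2 (volume.restrict (Icc 0 T))) : IntervalIntegrable g volume 0 T := by
  rw [intervalIntegrable_iff_integrableOn_Icc_of_le hT]
  exact hg.integrable (by norm_num)

theorem intervalIntegrable_inner_of_memLp_two {V : Type*} [NormedAddCommGroup V]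
    [InnerProductSpace ℝ V] (hT : 0 ≤ T) {f g : ℝ → V}
    (hf : MemLp f 2 (volume.restrict (Icc 0 T))) (hg : MemLp g 2 (volume.restrict (Icc 0 T))) :
    IntervalIntegrable (fun t => inner ℝ (f t) (g t)) volume 0 T := by
  rw [intervalIntegrable_iff_integrableOn_Icc_of_le hT]
  refine Integrable.mono' (hf.norm.integrable_mul hg.norm) (hf.1.inner hg.1)
    (Eventually.of_forall fun t => norm_inner_le_norm _ _)

end MemLpLemmas

/-- The density of the perturbed control is not determined at `t'`; a single time does not affect
the integrals. -/
theorem HasJumpPrimitive.congr_deriv_ne {E : Type*} [NormedAddCommGroup E] [NormedSpace ℝ E]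
    {T t' : ℝ} {y : ℝ → E} {y₀ : E} {h k : ℝ → E} {p : E} (hT : 0 ≤ T)
    (hy : HasJumpPrimitive T t' y y₀ h p) (c : ℝ) (hk : ∀ t ∈ Icc 0 T, t ≠ c → k t = h t) :
    HasJumpPrimitive T t' y y₀ k p := by
  have hc : ∀ᵐ s : ℝ, s ≠ c := by simp [ae_iff]
  refine ⟨hy.int.congr_ae ?_, fun t ht => ?_⟩
  · rw [EventuallyEq, ae_restrict_iff' measurableSet_uIoc]
    filter_upwards [hc] with s hs hs'
    rw [uIoc_of_le hT] at hs'
    exact (hk s (Ioc_subset_Icc_self hs') hs).symm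
  · rw [hy.eq t ht]
    congr 2
    refine intervalIntegral.integral_congr_ae ?_
    filter_upwards [hc] with s hs hs'
    rw [uIoc_of_le ht.1] at hs'
    exact (hk s ⟨hs'.1.le, hs'.2.trans ht.2⟩ hs).symm

/-! ### The optimality system -/

namespace Data

variable {nx nu nd : ℕ} (D : Data nx nu nd)

/-- `C - B R⁻¹ Wᵀ`. -/
noncomputable def E (t : ℝ) : Mat nx nd := D.C t - D.B t ∘L (D.R t).inverse ∘L (D.W t)†

/-- `Gᵀ - Hᵀ R⁻¹ Wᵀ`. -/
noncomputable def J (t : ℝ) : Mat nx nd := (D.G t)† - (D.H t)† ∘L (D.R t).inverse ∘L (D.W t)†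

/-- The control which minimizes the Hamiltonian. -/
noncomputable def feedback (t : ℝ) (x lam : Vec nx) (d : Vec nd) : Vec nu :=
  -(D.R t).inverse (D.H t x + ((D.B t)†) lam + ((D.W t)†) d)

theorem dynamics_feedback (t : ℝ) (x lam : Vec nx) (d : Vec nd) :
    D.A t x + D.B t (D.feedback t x lam d) + D.C t d = D.F t x - D.N t lam + D.E t d := by
  simp only [feedback, F, N, E, map_add, map_neg, sub_apply, ContinuousLinearMap.comp_apply]
  abel

end Data

namespace Assumptions

variable {nx nu nd : ℕ} {k : Constants} {T : ℝ} {D : Data nx nu nd} (h : Assumptions k T D)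

include h

theorem contE : ContinuousOn D.E (Icc 0 T) := by
  have := h.contC
  have := h.contB
  have := h.contInverse
  have := continuousOn_adjoint h.contW
  unfold Data.E; fun_prop

theorem contJ : ContinuousOn D.J (Icc 0 T) := by
  have := continuousOn_adjoint h.contG
  have := continuousOn_adjoint h.contH
  have := h.contInverse
  have := continuousOn_adjoint h.contW
  unfold Data.J; fun_prop

theorem memLp_feedback {x lam : ℝ → Vec nx} {d : ℝ → Vec nd} (hx : ContinuousOn x (Icc 0 T))
    (hl : ContinuousOn lam (Icc 0 T)) (hd : MemLp d 2 (volume.restrict (Icc 0 T))) :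
    MemLp (fun t => D.feedback t (x t) (lam t) (d t)) 2 (volume.restrict (Icc 0 T)) :=
  (memLp_two_clm_apply h.contInverse
    (((memLp_two_clm_apply h.contH (memLp_two_of_continuousOn hx)).add
      (memLp_two_clm_apply (continuousOn_adjoint h.contB) (memLp_two_of_continuousOn hl))).add
      (memLp_two_clm_apply (continuousOn_adjoint h.contW) hd))).neg

theorem intervalIntegrable_feedback {x lam : ℝ → Vec nx} {d : ℝ → Vec nd}
    (hx : IntervalIntegrable x volume 0 T) (hl : IntervalIntegrable lam volume 0 T)
    (hd : IntervalIntegrable d volume 0 T) :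
    IntervalIntegrable (fun t => D.feedback t (x t) (lam t) (d t)) volume 0 T := by
  have hT := h.T_pos.le
  exact (intervalIntegrable_clm_apply hT h.contInverse
    (((intervalIntegrable_clm_apply hT h.contH hx).add
      (intervalIntegrable_clm_apply hT (continuousOn_adjoint h.contB) hl)).add
      (intervalIntegrable_clm_apply hT (continuousOn_adjoint h.contW) hd))).neg

theorem intervalIntegrable_state {x : ℝ → Vec nx} {u : ℝ → Vec nu} {d : ℝ → Vec nd}
    (hx : IntervalIntegrable x volume 0 T) (hu : IntervalIntegrable u volume 0 T)
    (hd : IntervalIntegrable d volume 0 T) :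
    IntervalIntegrable (fun s => D.A s (x s) + D.B s (u s) + D.C s (d s)) volume 0 T := by
  have hT := h.T_pos.le
  exact ((intervalIntegrable_clm_apply hT h.contA hx).add
    (intervalIntegrable_clm_apply hT h.contB hu)).add (intervalIntegrable_clm_apply hT h.contC hd)

theorem intervalIntegrable_adjoint {x lam : ℝ → Vec nx} {u : ℝ → Vec nu} {d : ℝ → Vec nd}
    (hx : IntervalIntegrable x volume 0 T) (hu : IntervalIntegrable u volume 0 T)
    (hl : IntervalIntegrable lam volume 0 T) (hd : IntervalIntegrable d volume 0 T) :
    IntervalIntegrable (fun s => ((D.A s)†) (lam s) + D.Q s (x s) + ((D.H s)†) (u s) +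
      ((D.G s)†) (d s)) volume 0 T := by
  have hT := h.T_pos.le
  exact (((intervalIntegrable_clm_apply hT (continuousOn_adjoint h.contA) hl).add
    (intervalIntegrable_clm_apply hT h.contQ hx)).add
    (intervalIntegrable_clm_apply hT (continuousOn_adjoint h.contH) hu)).add
    (intervalIntegrable_clm_apply hT (continuousOn_adjoint h.contG) hd)

variable {t : ℝ} (ht : t ∈ Icc 0 T)

include ht

theorem adjoint_feedback (x lam : Vec nx) (d : Vec nd) :
    ((D.A t)†) lam + D.Q t x + ((D.H t)†) (D.feedback t x lam d) + ((D.G t)†) d =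
      ((D.F t)†) lam + D.K t x + D.J t d := by
  simp only [Data.feedback, Data.F, Data.K, Data.J, map_add, map_sub, map_neg, sub_apply,
    ContinuousLinearMap.comp_apply, ContinuousLinearMap.adjoint_comp, h.adjoint_inverse ht]
  abel

theorem R_feedback (x lam : Vec nx) (d : Vec nd) :
    D.R t (D.feedback t x lam d) = -(D.H t x + ((D.B t)†) lam + ((D.W t)†) d) := by
  rw [Data.feedback, map_neg, h.R_inverse ht]

/-- The Hamiltonian is quadratic in the control with second derivative `R`, and the feedback is its
critical point, so only the second-order term survives. -/
theorem hamiltonian_sub (x lam : Vec nx) (d : Vec nd) (w : Vec nu) :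
    hamiltonian D t x w lam d - hamiltonian D t x (D.feedback t x lam d) lam d =
      (1 / 2) * inner ℝ (w - D.feedback t x lam d) (D.R t (w - D.feedback t x lam d)) := by
  set u := D.feedback t x lam d with hu
  have hR : D.R t u = -(D.H t x + ((D.B t)†) lam + ((D.W t)†) d) := h.R_feedback ht x lam d
  have hc : ∀ v, inner ℝ v (D.R t u) =
      -(inner ℝ v (D.H t x) + inner ℝ lam (D.B t v) + inner ℝ d (D.W t v)) := by
    intro v
    rw [hR, inner_neg_right, inner_add_right, inner_add_right,
      ContinuousLinearMap.adjoint_inner_right, ContinuousLinearMap.adjoint_inner_right,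
      real_inner_comm lam, real_inner_comm d]
  have hs : inner ℝ u (D.R t w) = inner ℝ w (D.R t u) := by
    rw [← h.symmR ht, real_inner_comm]
  have h1 := hc w
  have h2 := hc u
  have e1 : ∀ v, inner ℝ x (((D.H t)†) v) = inner ℝ v (D.H t x) := fun v => by
    rw [ContinuousLinearMap.adjoint_inner_right, real_inner_comm]
  have e2 : ∀ v, inner ℝ v (((D.W t)†) d) = inner ℝ d (D.W t v) := fun v => by
    rw [ContinuousLinearMap.adjoint_inner_right, real_inner_comm]
  simp only [hamiltonian, runningCost, inner_add_right, map_sub, inner_sub_left, inner_sub_right,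
    e1, e2, hs]
  linarith

/-- Minimality of the Hamiltonian determines the control. -/
theorem minimizes_iff (x lam : Vec nx) (d : Vec nd) (u : Vec nu) :
    (∀ w, hamiltonian D t x u lam d ≤ hamiltonian D t x w lam d) ↔
      u = D.feedback t x lam d := by
  constructor
  · intro hu
    have h1 := h.hamiltonian_sub ht x lam d u
    have h2 := hu (D.feedback t x lam d)
    have h3 := le_inner_of_smul_one_le (h.coerciveR t ht) (u - D.feedback t x lam d)
    have h4 := k.gamR_pos
    have h5 : ‖u - D.feedback t x lam d‖ ^ 2 ≤ 0 := by
      by_contra hne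
      have : 0 < k.gamR * ‖u - D.feedback t x lam d‖ ^ 2 := mul_pos h4 (not_le.1 hne)
      linarith
    have h6 : ‖u - D.feedback t x lam d‖ = 0 := by
      have := sq_nonneg ‖u - D.feedback t x lam d‖
      exact pow_eq_zero_iff two_ne_zero |>.1 (le_antisymm h5 this)
    exact sub_eq_zero.1 (norm_eq_zero.1 h6)
  · rintro rfl w
    have h1 := h.hamiltonian_sub ht x lam d w
    have h2 := h.R_nonneg ht (w - D.feedback t x lam d)
    linarith

omit ht

/-- Solutions of the optimality system solve the reduced boundary value problem. -/
theorem isBVPSolution_of_eq {t' : ℝ} (ht' : t' ∈ Icc 0 T) {x lam : ℝ → Vec nx} {u : ℝ → Vec nu}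
    {d : ℝ → Vec nd} {x₀ p q e : Vec nx} (hx : IntervalIntegrable x volume 0 T)
    (hu : IntervalIntegrable u volume 0 T) (hl : IntervalIntegrable lam volume 0 T)
    (hd : IntervalIntegrable d volume 0 T)
    (h1 : ∀ t ∈ Icc 0 T, x t = x₀ +
      (∫ s in (0 : ℝ)..t, (D.A s (x s) + D.B s (u s) + D.C s (d s))) + if t' ≤ t then p else 0)
    (h2 : ∀ t ∈ Icc 0 T, lam t = D.QT (x T) + e +
      (∫ s in t..T, (((D.A s)†) (lam s) + D.Q s (x s) + ((D.H s)†) (u s) + ((D.G s)†) (d s))) +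
      if t < t' then q else 0)
    (h3 : ∀ t ∈ Icc 0 T, t ≠ t' → u t = D.feedback t (x t) (lam t) (d t)) :
    IsBVPSolution T t' D.F D.N D.K D.QT (fun s => D.E s (d s)) (fun s => D.J s (d s)) x₀ e p q
      x lam := by
  have hT := h.T_pos.le
  have hp : HasJumpPrimitive T t' x x₀ (fun s => D.A s (x s) + D.B s (u s) + D.C s (d s)) p :=
    ⟨h.intervalIntegrable_state hx hu hd, h1⟩
  have hq := HasJumpPrimitive.of_eq_right (y := lam) (t' := t') (p := -q) (yT := D.QT (x T) + e)
    (h := fun s => -(((D.A s)†) (lam s) + D.Q s (x s) + ((D.H s)†) (u s) + ((D.G s)†) (d s)))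
    (h.intervalIntegrable_adjoint hx hu hl hd).neg (fun t ht => by
      rw [h2 t ht, intervalIntegral.integral_neg, sub_neg_eq_add, sub_eq_add_neg]
      congr 1
      split_ifs <;> simp)
  refine ⟨hp.congr_deriv_ne hT t' fun t ht hne => ?_,
    ⟨_, hq.congr_deriv_ne hT t' fun t ht hne => ?_⟩, ?_⟩
  · rw [h3 t ht hne, D.dynamics_feedback]
  · rw [h3 t ht hne, h.adjoint_feedback ht]
    abel
  · simpa [not_lt.2 ht'.2] using h2 T ⟨hT, le_rfl⟩

theorem eq_of_isBVPSolution {t' : ℝ} (ht' : t' ∈ Icc 0 T) {x lam : ℝ → Vec nx}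
    {d : ℝ → Vec nd} {x₀ p q e : Vec nx}
    (hs : IsBVPSolution T t' D.F D.N D.K D.QT (fun s => D.E s (d s)) (fun s => D.J s (d s)) x₀ e
      p q x lam) :
    (∀ t ∈ Icc 0 T, x t = x₀ +
      (∫ s in (0 : ℝ)..t, (D.A s (x s) + D.B s (D.feedback s (x s) (lam s) (d s)) + D.C s (d s))) +
        if t' ≤ t then p else 0) ∧
    (∀ t ∈ Icc 0 T, lam t = D.QT (x T) + e +
      (∫ s in t..T, (((D.A s)†) (lam s) + D.Q s (x s) +
        ((D.H s)†) (D.feedback s (x s) (lam s) (d s)) + ((D.G s)†) (d s))) +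
      if t < t' then q else 0) := by
  have hT := h.T_pos.le
  obtain ⟨l₀, hl⟩ := hs.adj
  refine ⟨fun t ht => ?_, fun t ht => ?_⟩
  · simp only [D.dynamics_feedback]
    exact hs.state.eq t ht
  · have e1 : ∫ s in t..T, (((D.A s)†) (lam s) + D.Q s (x s) +
        ((D.H s)†) (D.feedback s (x s) (lam s) (d s)) + ((D.G s)†) (d s)) =
        -∫ s in t..T, (-((D.F s)†) (lam s) - D.K s (x s) - D.J s (d s)) := by
      rw [← intervalIntegral.integral_neg]
      refine intervalIntegral.integral_congr fun s hs' => ?_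
      rw [uIcc_of_le ht.2] at hs'
      simp only [h.adjoint_feedback ⟨ht.1.trans hs'.1, hs'.2⟩]
      abel
    rw [e1, hl.eq_right hT ht'.2 ht, hs.right]
    split_ifs <;> abel

/-- The solution of the optimality system is optimal. -/
theorem isOptimalTriple_of_isBVPSolution {t' : ℝ} (ht' : t' ∈ Icc 0 T) {x lam : ℝ → Vec nx}
    {d : ℝ → Vec nd} {d0 : Vec nx} {dT : Vec nd} (hd : MemLp d 2 (volume.restrict (Icc 0 T)))
    (hs : IsBVPSolution T t' D.F D.N D.K D.QT (fun s => D.E s (d s)) (fun s => D.J s (d s)) d0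
      ((D.GT†) dT) 0 0 x lam) :
    IsOptimalTriple D T d d0 dT ⟨x, fun t => D.feedback t (x t) (lam t) (d t), lam⟩ := by
  have hT := h.T_pos.le
  have hTm : T ∈ Icc 0 T := ⟨hT, le_rfl⟩
  obtain ⟨l₀, hl⟩ := hs.adj
  rw [neg_zero] at hl
  have hxc := hs.state.continuousOn hT
  have hlc := hl.continuousOn hT
  obtain ⟨h1, h2⟩ := h.eq_of_isBVPSolution ht' hs
  simp only [ite_self, add_zero] at h1 h2
  have hu := h.memLp_feedback hxc hlc hd
  set u : ℝ → Vec nu := fun t => D.feedback t (x t) (lam t) (d t) with hudef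
  have hrc : ∀ (x : ℝ → Vec nx) (u : ℝ → Vec nu), ContinuousOn x (Icc 0 T) →
      MemLp u 2 (volume.restrict (Icc 0 T)) →
      IntervalIntegrable (fun t => runningCost D t (x t) (u t) (d t)) volume 0 T := by
    intro x u hx hu
    have hx' := memLp_two_of_continuousOn hx
    exact (((intervalIntegrable_inner_of_memLp_two hT hx'
      (((memLp_two_clm_apply h.contQ hx').add
        (memLp_two_clm_apply (continuousOn_adjoint h.contH) hu)).add
        (memLp_two_clm_apply (continuousOn_adjoint h.contG) hd))).add
      (intervalIntegrable_inner_of_memLp_two hT hu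
      (((memLp_two_clm_apply h.contH hx').add
        (memLp_two_clm_apply h.contR hu)).add
        (memLp_two_clm_apply (continuousOn_adjoint h.contW) hd)))).add
      (intervalIntegrable_inner_of_memLp_two hT hd
        ((memLp_two_clm_apply h.contG hx').add (memLp_two_clm_apply h.contW hu)))).const_mul _
  refine ⟨⟨hu, hxc, h1⟩, fun x' u' had => ?_, hlc, h2, fun t ht =>
    (h.minimizes_iff ht _ _ _ _).2 rfl⟩
  obtain ⟨hu', hxc', h1'⟩ := had
  have hdi := intervalIntegrable_of_memLp_two hT hd
  have hui := intervalIntegrable_of_memLp_two hT hu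
  have hui' := intervalIntegrable_of_memLp_two hT hu'
  have hxi := hxc.intervalIntegrable_of_Icc (μ := volume) hT
  have hxi' := hxc'.intervalIntegrable_of_Icc (μ := volume) hT
  let ξ : ℝ → Vec nx := fun t => x' t - x t
  let ω : ℝ → Vec nu := fun t => u' t - u t
  have hξ : HasJumpPrimitive T t' ξ 0 (fun s => D.A s (ξ s) + D.B s (ω s)) 0 := by
    have p1 : HasJumpPrimitive T t' x d0 (fun s => D.A s (x s) + D.B s (u s) + D.C s (d s)) 0 :=
      ⟨h.intervalIntegrable_state hxi hui hdi, fun t ht => by simpa using h1 t ht⟩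
    have p2 : HasJumpPrimitive T t' x' d0 (fun s => D.A s (x' s) + D.B s (u' s) + D.C s (d s)) 0 :=
      ⟨h.intervalIntegrable_state hxi' hui' hdi, fun t ht => by simpa using h1' t ht⟩
    refine (p2.sub p1).congr hT (fun _ _ => rfl) (sub_self d0).symm (fun s _ => ?_)
      (sub_self 0).symm
    simp only [ξ, ω, map_sub]
    abel
  let a : ℝ → Vec nx := fun s => ((D.A s)†) (lam s) + D.Q s (x s) + ((D.H s)†) (u s) +
    ((D.G s)†) (d s)
  have hlp : HasJumpPrimitive T t' lam l₀ (fun s => -a s) 0 := by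
    refine hl.congr hT (fun _ _ => rfl) rfl (fun s hs' => ?_) rfl
    simp only [a, u, h.adjoint_feedback hs']
    abel
  -- The product rule for `⟨λ, ξ⟩` turns the first-order variation of the running cost into a
  -- boundary term at `T`, where it cancels against the variation of the terminal cost.
  have hpr := HasJumpPrimitive.bilin (innerSL ℝ) hT ht' hlp hξ
  have hpi : IntervalIntegrable (fun s => inner ℝ (-a s) (ξ s) +
      inner ℝ (lam s) (D.A s (ξ s) + D.B s (ω s))) volume 0 T := hpr.int
  have hprT : inner ℝ (lam T) (ξ T) = ∫ s in (0 : ℝ)..T, (inner ℝ (-a s) (ξ s) +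
      inner ℝ (lam s) (D.A s (ξ s) + D.B s (ω s))) := by
    have e := hpr.eq T hTm
    rw [map_zero, map_zero, ite_self, zero_add, add_zero] at e
    exact e
  -- What the first-order terms leave over is half of `⟨ξ,Kξ⟩` plus half of the `R`-form of `ω +
  -- R⁻¹Hξ`. Both are nonnegative, which is the convexity of the cost.
  have hpt : ∀ s ∈ Icc 0 T, -(inner ℝ (-a s) (ξ s) + inner ℝ (lam s) (D.A s (ξ s) + D.B s (ω s))) ≤
      runningCost D s (x' s) (u' s) (d s) - runningCost D s (x s) (u s) (d s) := by
    intro s hs'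
    have e0 := le_trans (by have := k.gamQ_pos; positivity)
      (le_inner_of_smul_one_le (h.coerciveQ s hs') (ξ s))
    have e1 := h.R_nonneg hs' (ω s + (D.R s).inverse (D.H s (ξ s)))
    have e2 := h.R_feedback hs' (x s) (lam s) (d s)
    change D.R s (u s) = _ at e2
    have e3 : x' s = ξ s + x s := by simp [ξ]
    have e4 : u' s = ω s + u s := by simp [ω]
    have e5 := congrArg (fun v => inner ℝ (ω s) v) e2
    have c1 : inner ℝ ((D.R s).inverse (D.H s (ξ s))) (D.R s (ω s)) =
        inner ℝ (ω s) (D.H s (ξ s)) := by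
      rw [← h.symmR hs', h.R_inverse hs', real_inner_comm]
    have c2 : inner ℝ ((D.R s).inverse (D.H s (ξ s))) (D.H s (ξ s)) =
        inner ℝ (D.H s (ξ s)) ((D.R s).inverse (D.H s (ξ s))) := by rw [real_inner_comm]
    have c3 : inner ℝ (x s) (D.Q s (ξ s)) = inner ℝ (ξ s) (D.Q s (x s)) := by
      rw [← h.symmQ hs', real_inner_comm]
    have c4 : inner ℝ (u s) (D.R s (ω s)) = inner ℝ (ω s) (D.R s (u s)) := by
      rw [← h.symmR hs', real_inner_comm]
    have c5 : ∀ (y : Vec nx) (v : Vec nu), inner ℝ y (((D.H s)†) v) = inner ℝ v (D.H s y) :=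
      fun y v => by rw [ContinuousLinearMap.adjoint_inner_right, real_inner_comm]
    have c6 : ∀ (y : Vec nx) (v : Vec nd), inner ℝ y (((D.G s)†) v) = inner ℝ v (D.G s y) :=
      fun y v => by rw [ContinuousLinearMap.adjoint_inner_right, real_inner_comm]
    have c7 : ∀ (y : Vec nu) (v : Vec nd), inner ℝ y (((D.W s)†) v) = inner ℝ v (D.W s y) :=
      fun y v => by rw [ContinuousLinearMap.adjoint_inner_right, real_inner_comm]
    have c8 : ∀ (y : Vec nu) (v : Vec nx), inner ℝ y (((D.B s)†) v) = inner ℝ v (D.B s y) :=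
      fun y v => by rw [ContinuousLinearMap.adjoint_inner_right, real_inner_comm]
    have c9 : ∀ (y : Vec nx) (v : Vec nx), inner ℝ y (((D.A s)†) v) = inner ℝ v (D.A s y) :=
      fun y v => by rw [ContinuousLinearMap.adjoint_inner_right, real_inner_comm]
    have c10 : inner ℝ (a s) (ξ s) = inner ℝ (ξ s) (a s) := real_inner_comm _ _
    simp only [sub_apply, ContinuousLinearMap.comp_apply, inner_sub_right,
      ContinuousLinearMap.adjoint_inner_right] at e0
    simp only [map_add, inner_add_left, inner_add_right, h.R_inverse hs', c1, c2] at e1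
    simp only [inner_neg_right, inner_add_right, c7, c8] at e5
    rw [inner_neg_left, c10]
    simp only [a, runningCost, e3, e4, map_add, inner_add_left, inner_add_right, c3, c4, c5, c6,
      c7, c9]
    linarith
  have hint := intervalIntegral.integral_mono_on hT hpi.neg
    ((hrc x' u' hxc' hu').sub (hrc x u hxc hu)) hpt
  have hneg : (∫ s in (0 : ℝ)..T,
      (-fun s => inner ℝ (-a s) (ξ s) + inner ℝ (lam s) (D.A s (ξ s) + D.B s (ω s))) s) =
      -inner ℝ (lam T) (ξ T) := by
    rw [hprT, ← intervalIntegral.integral_neg]; rfl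
  rw [intervalIntegral.integral_sub (hrc x' u' hxc' hu') (hrc x u hxc hu), hneg, hs.right] at hint
  have hP := le_trans (by have := k.gamQ_pos; positivity)
    (le_inner_of_smul_one_le h.coerciveQT (ξ T))
  have e3 : x' T = ξ T + x T := by simp [ξ]
  have c3 : inner ℝ (x T) (D.QT (ξ T)) = inner ℝ (ξ T) (D.QT (x T)) := by
    rw [← symm_of_smul_one_le h.coerciveQT, real_inner_comm]
  have c6 : ∀ (y : Vec nx) (v : Vec nd), inner ℝ y ((D.GT†) v) = inner ℝ v (D.GT y) :=
    fun y v => by rw [ContinuousLinearMap.adjoint_inner_right, real_inner_comm]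
  have c7 : inner ℝ (D.QT (x T) + (D.GT†) dT) (ξ T) =
      inner ℝ (ξ T) (D.QT (x T)) + inner ℝ dT (D.GT (ξ T)) := by
    rw [real_inner_comm, inner_add_right, c6]
  rw [c7] at hint
  simp only [cost, terminalCost, e3, map_add, inner_add_left, inner_add_right, c3, c6]
  linarith

end Assumptions


/-! ### Bounds of the reduced coefficients, and the assertions of the theorem. -/

theorem Data.feedback_sub {nx nu nd : ℕ} (D : Data nx nu nd) (t : ℝ) (x x' lam lam' : Vec nx)
    (d : Vec nd) : D.feedback t x lam d - D.feedback t x' lam' d =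
      -(D.R t).inverse (D.H t (x - x') + ((D.B t)†) (lam - lam')) := by
  simp only [Data.feedback, map_add, map_sub]
  abel

namespace Assumptions

variable {nx nu nd : ℕ} {k : Constants} {T : ℝ} {D : Data nx nu nd}

section

variable (h : Assumptions k T D) {t : ℝ} (ht : t ∈ Icc 0 T)

include h ht

theorem norm_comp_inverse_le {m n : ℕ} {M : Mat m nu} {L : Mat nu n} {a b : ℝ} (hM : ‖M‖ ≤ a)
    (hL : ‖L‖ ≤ b) : ‖M ∘L (D.R t).inverse ∘L L‖ ≤ b * a / k.gamR := by
  have := k.gamR_pos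
  have ha := (norm_nonneg _).trans hM
  refine (ContinuousLinearMap.opNorm_comp_le _ _).trans ?_
  calc _ ≤ ‖M‖ * (‖(D.R t).inverse‖ * ‖L‖) := by
        gcongr; exact ContinuousLinearMap.opNorm_comp_le _ _
    _ ≤ a * (1 / k.gamR * b) := by
        gcongr
        exact h.norm_inverse_le ht
    _ = _ := by ring

theorem norm_E_le : ‖D.E t‖ ≤ k.lamW * k.lamB / k.gamR + k.lamC := by
  have := h.norm_comp_inverse_le ht (h.boundB t ht)
    ((LinearIsometryEquiv.norm_map _ _).trans_le (h.boundW t ht) : ‖(D.W t)†‖ ≤ _)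
  refine (norm_sub_le _ _).trans ?_
  linarith [h.boundC t ht]

theorem norm_J_le : ‖D.J t‖ ≤ k.lamW * k.lamH / k.gamR + k.lamG := by
  have := h.norm_comp_inverse_le ht
    ((LinearIsometryEquiv.norm_map _ _).trans_le (h.boundH t ht) : ‖(D.H t)†‖ ≤ _)
    ((LinearIsometryEquiv.norm_map _ _).trans_le (h.boundW t ht) : ‖(D.W t)†‖ ≤ _)
  have hG : ‖(D.G t)†‖ ≤ k.lamG := (LinearIsometryEquiv.norm_map _ _).trans_le (h.boundG t ht)
  refine (norm_sub_le _ _).trans ?_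
  linarith

theorem norm_feedback_sub_le (x x' lam lam' : Vec nx) (d : Vec nd) :
    ‖D.feedback t x lam d - D.feedback t x' lam' d‖ ≤
      k.lamH / k.gamR * ‖x - x'‖ + k.lamB / k.gamR * ‖lam - lam'‖ := by
  have := k.gamR_pos
  have hB : ‖(D.B t)†‖ ≤ k.lamB := (LinearIsometryEquiv.norm_map _ _).trans_le (h.boundB t ht)
  rw [D.feedback_sub, norm_neg]
  calc _ ≤ 1 / k.gamR * (k.lamH * ‖x - x'‖ + k.lamB * ‖lam - lam'‖) := by
        refine (ContinuousLinearMap.le_of_opNorm_le _ (h.norm_inverse_le ht) _).trans ?_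
        gcongr
        exact norm_add_le_of_le (ContinuousLinearMap.le_of_opNorm_le _ (h.boundH t ht) _)
          (ContinuousLinearMap.le_of_opNorm_le _ hB _)
    _ = _ := by ring

/-- The atom of the control is eliminated by stationarity exactly as its density is, so the jumps
are the reduced coefficients applied to `l`. -/
theorem jump_eq {η : Vec nu} {l : Vec nd} (hη : D.R t η + ((D.W t)†) l = 0) :
    D.B t η + D.C t l = D.E t l ∧ ((D.H t)†) η + ((D.G t)†) l = D.J t l := by
  have e : η = -(D.R t).inverse (((D.W t)†) l) := by
    rw [← h.inverse_R ht η, eq_neg_of_add_eq_zero_left hη, map_neg]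
  constructor <;>
  · simp only [e, Data.E, Data.J, map_neg, sub_apply, ContinuousLinearMap.comp_apply]
    abel

end

/-- Optimal solutions solve the reduced boundary value problem. -/
theorem isBVPSolution_of_isOptimalTriple (h : Assumptions k T D) {t' : ℝ} (ht' : t' ∈ Icc 0 T)
    {d : ℝ → Vec nd} {d0 : Vec nx} {dT : Vec nd} (hd : IntervalIntegrable d volume 0 T)
    {z : Trajectory nx nu} (hz : IsOptimalTriple D T d d0 dT z) :
    IsBVPSolution T t' D.F D.N D.K D.QT (fun s => D.E s (d s)) (fun s => D.J s (d s)) d0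
      ((D.GT†) dT) 0 0 z.x z.lam ∧
    ∀ t ∈ Icc 0 T, z.u t = D.feedback t (z.x t) (z.lam t) (d t) := by
  have hT := h.T_pos.le
  obtain ⟨⟨hu, hx, h1⟩, -, hl, h2, h3⟩ := hz
  have hu' := fun t ht => (h.minimizes_iff ht _ _ _ _).1 (h3 t ht)
  exact ⟨h.isBVPSolution_of_eq ht' (hx.intervalIntegrable_of_Icc hT)
    (intervalIntegrable_of_memLp_two hT hu) (hl.intervalIntegrable_of_Icc hT) hd
    (by simpa using h1) (by simpa using h2) fun t ht _ => hu' t ht, hu'⟩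

/-- Perturbed solutions solve the reduced boundary value problem with jumps. -/
theorem isBVPSolution_of_isPerturbedTriple (h : Assumptions k T D) {t' : ℝ} (ht' : t' ∈ Icc 0 T)
    {d : ℝ → Vec nd} {d0 : Vec nx} {dT l : Vec nd} (hd : IntervalIntegrable d volume 0 T)
    {z : Trajectory nx nu} (hz : IsPerturbedTriple D T d d0 dT t' l z) :
    IsBVPSolution T t' D.F D.N D.K D.QT (fun s => D.E s (d s)) (fun s => D.J s (d s)) d0
      ((D.GT†) dT) (D.E t' l) (D.J t' l) z.x z.lam ∧
    ∀ t ∈ Icc 0 T, t ≠ t' → z.u t = D.feedback t (z.x t) (z.lam t) (d t) := by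
  obtain ⟨hx, hu, hl, η, hη, h1, h2, h3⟩ := hz
  obtain ⟨e1, e2⟩ := h.jump_eq ht' hη
  rw [e1] at h1
  rw [e2] at h2
  have hu' := fun t ht hne => (h.minimizes_iff ht _ _ _ _).1 (h3 t ht hne)
  exact ⟨h.isBVPSolution_of_eq ht' hx hu hl hd h1 h2 hu', hu'⟩

theorem isPerturbedTriple_of_isBVPSolution (h : Assumptions k T D) {t' : ℝ} (ht' : t' ∈ Icc 0 T)
    {d : ℝ → Vec nd} {d0 : Vec nx} {dT l : Vec nd} (hd : IntervalIntegrable d volume 0 T)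
    {x lam : ℝ → Vec nx}
    (hs : IsBVPSolution T t' D.F D.N D.K D.QT (fun s => D.E s (d s)) (fun s => D.J s (d s)) d0
      ((D.GT†) dT) (D.E t' l) (D.J t' l) x lam) :
    IsPerturbedTriple D T d d0 dT t' l ⟨x, fun t => D.feedback t (x t) (lam t) (d t), lam⟩ := by
  have hT := h.T_pos.le
  obtain ⟨h1, h2⟩ := h.eq_of_isBVPSolution ht' hs
  obtain ⟨l₀, hl⟩ := hs.adj
  have hxi := hs.state.intervalIntegrable hT
  have hli := hl.intervalIntegrable hT
  have hη : D.R t' (-(D.R t').inverse (((D.W t')†) l)) + ((D.W t')†) l = 0 := by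
    rw [map_neg, h.R_inverse ht', neg_add_cancel]
  obtain ⟨e1, e2⟩ := h.jump_eq ht' hη
  refine ⟨hxi, h.intervalIntegrable_feedback hxi hli hd, hli, _, hη, ?_, ?_, fun t ht _ =>
    (h.minimizes_iff ht _ _ _ _).2 rfl⟩
  · rw [e1]
    exact h1
  · rw [e2]
    exact h2

theorem exists_unique_optimal (h : Assumptions k T D) {d : ℝ → Vec nd}
    (hd : MemLp d 2 (volume.restrict (Icc 0 T))) (d0 : Vec nx) (dT : Vec nd) :
    ∃ z, IsOptimalTriple D T d d0 dT z ∧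
      ∀ z', IsOptimalTriple D T d d0 dT z' → z'.AgreeOn z (Icc 0 T) := by
  have hT := h.T_pos.le
  have hT0 : (0 : ℝ) ∈ Icc 0 T := ⟨le_rfl, hT⟩
  have hdi := intervalIntegrable_of_memLp_two hT hd
  have H := h.isHamiltonianSystem
  obtain ⟨X, L, Y, hF⟩ := H.exists_isFundamental
  obtain ⟨x, lam, hs⟩ := hF.exists_isBVPSolution H hT0 (intervalIntegrable_clm_apply hT h.contE hdi)
    (intervalIntegrable_clm_apply hT h.contJ hdi) d0 ((D.GT†) dT) 0 0
  refine ⟨_, h.isOptimalTriple_of_isBVPSolution hT0 hd hs, fun z hz => ?_⟩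
  obtain ⟨hz', hu⟩ := h.isBVPSolution_of_isOptimalTriple hT0 hdi hz
  have ex : EqOn z.x x (Icc 0 T) := fun t ht =>
    (hF.eq_bvpW H hT0 hz' ht).1.trans (hF.eq_bvpW H hT0 hs ht).1.symm
  have el : EqOn z.lam lam (Icc 0 T) := fun t ht =>
    (hF.eq_bvpW H hT0 hz' ht).2.trans (hF.eq_bvpW H hT0 hs ht).2.symm
  exact ⟨ex, fun t ht => by rw [hu t ht, ex ht, el ht], el⟩

theorem exists_unique_perturbed (h : Assumptions k T D) {d : ℝ → Vec nd}
    (hdi : IntervalIntegrable d volume 0 T) (d0 : Vec nx) (dT : Vec nd) {t' : ℝ}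
    (ht' : t' ∈ Icc 0 T) (l : Vec nd) :
    ∃ zp, IsPerturbedTriple D T d d0 dT t' l zp ∧
      ∀ z', IsPerturbedTriple D T d d0 dT t' l z' → z'.AgreeOn zp (Icc 0 T \ {t'}) := by
  have hT := h.T_pos.le
  have H := h.isHamiltonianSystem
  obtain ⟨X, L, Y, hF⟩ := H.exists_isFundamental
  obtain ⟨x, lam, hs⟩ := hF.exists_isBVPSolution H ht' (intervalIntegrable_clm_apply hT h.contE hdi)
    (intervalIntegrable_clm_apply hT h.contJ hdi) d0 ((D.GT†) dT) (D.E t' l) (D.J t' l)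
  refine ⟨_, h.isPerturbedTriple_of_isBVPSolution ht' hdi hs, fun z hz => ?_⟩
  obtain ⟨hz', hu⟩ := h.isBVPSolution_of_isPerturbedTriple ht' hdi hz
  have ex : EqOn z.x x (Icc 0 T) := fun t ht =>
    (hF.eq_bvpW H ht' hz' ht).1.trans (hF.eq_bvpW H ht' hs ht).1.symm
  have el : EqOn z.lam lam (Icc 0 T) := fun t ht =>
    (hF.eq_bvpW H ht' hz' ht).2.trans (hF.eq_bvpW H ht' hs ht).2.symm
  -- State and adjoint agree at `t'` as well; the time is excluded only because of the control.
  exact ⟨ex.mono sdiff_subset, fun t ht => by rw [hu t ht.1 ht.2, ex ht.1, el ht.1],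
    el.mono sdiff_subset⟩

/-- The perturbed solution is the limit of the solutions for approximate point masses. -/
theorem tendsto_perturbed (h : Assumptions k T D) {d : ℝ → Vec nd}
    (hdi : IntervalIntegrable d volume 0 T) {d0 : Vec nx} {dT : Vec nd} {t' : ℝ}
    (ht' : t' ∈ Icc 0 T) {l : Vec nd} {zp : Trajectory nx nu}
    (hzp : IsPerturbedTriple D T d d0 dT t' l zp) {φ : ℕ → ℝ → ℝ} (hφ : ApproximatesDirac T t' φ)
    {zn : ℕ → Trajectory nx nu}
    (hzn : ∀ n, IsOptimalTriple D T (fun t => d t + φ n t • l) d0 dT (zn n)) {t : ℝ}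
    (ht : t ∈ Icc 0 T) (hne : t ≠ t') :
    Tendsto (fun n => (zn n).x t) atTop (𝓝 (zp.x t)) ∧
    Tendsto (fun n => (zn n).u t) atTop (𝓝 (zp.u t)) ∧
    Tendsto (fun n => (zn n).lam t) atTop (𝓝 (zp.lam t)) := by
  have hT := h.T_pos.le
  have H := h.isHamiltonianSystem
  obtain ⟨X, L, Y, hF⟩ := H.exists_isFundamental
  have hdn : ∀ n, IntervalIntegrable (fun t => d t + φ n t • l) volume 0 T := fun n =>
    hdi.add (hφ.intervalIntegrable_smul hT continuousOn_const n)
  obtain ⟨hp, hup⟩ := h.isBVPSolution_of_isPerturbedTriple ht' hdi hzp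
  have hn := fun n => h.isBVPSolution_of_isOptimalTriple ht' (hdn n) (hzn n)
  have hs : ∀ n, IsBVPSolution T t' D.F D.N D.K D.QT (fun s => φ n s • D.E s l)
      (fun s => φ n s • D.J s l) 0 0 (-D.E t' l) (-D.J t' l) (fun t => (zn n).x t - zp.x t)
      (fun t => (zn n).lam t - zp.lam t) := fun n => by
    simpa using (hn n).1.sub hp hT
  obtain ⟨tx, tl⟩ := hF.tendsto_zero H hφ ht' (h.contE.clm_apply continuousOn_const)
    (h.contJ.clm_apply continuousOn_const) hs ht hne
  rw [tendsto_sub_nhds_zero_iff] at tx tl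
  refine ⟨tx, ?_, tl⟩
  -- The feedback contains the value of the parameter at `t`, which for large `n` is the unperturbed
  -- `d t`, since `φₙ(t) = 0` there.
  have hφ0 : ∀ᶠ n in atTop, φ n t = 0 :=
    (hφ.2.2.2 |t - t'| (abs_pos.2 (sub_ne_zero.2 hne))).mono fun n hn => hn t ht le_rfl
  have hc : Tendsto (fun n => D.feedback t ((zn n).x t) ((zn n).lam t) (d t)) atTop
      (𝓝 (D.feedback t (zp.x t) (zp.lam t) (d t))) :=
    (((D.R t).inverse.continuous.tendsto _).comp
      ((((D.H t).continuous.tendsto _).comp tx).add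
        ((((D.B t)†).continuous.tendsto _).comp tl) |>.add tendsto_const_nhds)).neg
  rw [hup t ht hne]
  refine hc.congr' (hφ0.mono fun n h0 => ?_)
  simp only [(hn n).2 t ht, h0, zero_smul, add_zero]

/-- The effect of a point perturbation decays exponentially. -/
theorem norm_perturbed_sub_le (h : Assumptions k T D) {d : ℝ → Vec nd}
    (hdi : IntervalIntegrable d volume 0 T) {d0 : Vec nx} {dT : Vec nd} {t' : ℝ}
    (ht' : t' ∈ Icc 0 T) {l : Vec nd} {z zp : Trajectory nx nu}
    (hz : IsOptimalTriple D T d d0 dT z) (hzp : IsPerturbedTriple D T d d0 dT t' l zp) {t : ℝ}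
    (ht : t ∈ Icc 0 T) (hne : t ≠ t') :
    ‖zp.x t - z.x t‖ + ‖zp.u t - z.u t‖ + ‖zp.lam t - z.lam t‖ ≤
      ‖l‖ * k.Lambda * Real.exp (-k.rhoZ * |t - t'|) := by
  have hT := h.T_pos.le
  have H := h.isHamiltonianSystem
  obtain ⟨X, L, Y, hF⟩ := H.exists_isFundamental
  obtain ⟨hp, hup⟩ := h.isBVPSolution_of_isPerturbedTriple ht' hdi hzp
  obtain ⟨ho, huo⟩ := h.isBVPSolution_of_isOptimalTriple ht' hdi hz
  have hv := fun t ht v => h.value_bounds (hF.isHamiltonianSolution v) (hF.right v) (t := t) ht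
  obtain ⟨dx, dl⟩ := hF.decay H k.c0_pos k.c1_pos (fun t ht v => (hv t ht v).1)
    (fun t ht v => (hv t ht v).2) (fun t ht => h.norm_N_le ht) ht'
    (by simpa only [sub_self, sub_zero] using hp.sub ho hT) (fun t _ => rfl)
    (fun t _ => rfl) (ContinuousLinearMap.le_of_opNorm_le _ (h.norm_E_le ht') l)
    (ContinuousLinearMap.le_of_opNorm_le _ (h.norm_J_le ht') l) ht
  have du := h.norm_feedback_sub_le ht (zp.x t) (z.x t) (zp.lam t) (z.lam t) (d t)
  rw [← hup t ht hne, ← huo t ht] at du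
  have hR := k.gamR_pos
  have hH := k.lamH_pos
  have hB := k.lamB_pos
  have hc := k.c1_pos
  have e1 : √(k.c1 / k.c0) * (√(k.c1 / k.c0) * ((k.lamW * k.lamB / k.gamR + k.lamC) * ‖l‖ * k.c1 +
      (k.lamW * k.lamH / k.gamR + k.lamG) * ‖l‖) * (k.lamB ^ 2 / k.gamR) /
      (2 * (k.gamQ / (2 * k.c1))) + (k.lamW * k.lamB / k.gamR + k.lamC) * ‖l‖) =
      ‖l‖ * k.LambdaX := by
    have hρ := k.rhoZ_pos.ne'
    have hR' := hR.ne'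
    change k.cZ * (k.cZ * _ * _ / (2 * k.rhoZ) + _) = _
    rw [Constants.LambdaX, Constants.cv]
    field_simp
    ring
  have e2 : √(k.c1 / k.c0) * ((k.lamW * k.lamB / k.gamR + k.lamC) * ‖l‖ * k.c1 +
      (k.lamW * k.lamH / k.gamR + k.lamG) * ‖l‖) = ‖l‖ * k.cv := by
    rw [Constants.cv, Constants.cZ]
    ring
  rw [e1] at dx
  rw [e2] at dl
  change _ ≤ _ * Real.exp (-k.rhoZ * |t - t'|) at dx
  change _ ≤ _ + _ * Real.exp (-k.rhoZ * |t - t'|) at dl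
  set ε := Real.exp (-k.rhoZ * |t - t'|)
  -- The control difference is at most `λ_H/γ_R ‖δx‖ + λ_B/γ_R ‖δλ‖`, and `‖δλ‖ ≤ c₁‖δx‖ + ‖l‖ c_v
  -- ε`. Collecting the factors of `‖δx‖` and of `‖l‖ c_v ε` in the sum of the three norms yields
  -- the two brackets of `Lambda`.
  have hb : 0 < 1 + k.lamB / k.gamR := by positivity
  have ha : 0 < 1 + k.lamH / k.gamR + k.c1 * (1 + k.lamB / k.gamR) := by positivity
  have m1 := mul_le_mul_of_nonneg_left dx ha.le
  have m2 := mul_le_mul_of_nonneg_left dl hb.le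
  rw [Constants.Lambda]
  linarith

end Assumptions

end LQ

theorem mainTheorem4 (k : LQ.Constants) :
    0 < k.rhoZ ∧ 0 < k.Lambda ∧
    ∀ (nx nu nd : ℕ) (T : ℝ) (D : LQ.Data nx nu nd), LQ.Assumptions k T D →
    ∀ (d : ℝ → LQ.Vec nd) (d0 : LQ.Vec nx) (dT : LQ.Vec nd),
      MemLp d 2 (volume.restrict (Icc 0 T)) →
    ∀ t' ∈ Icc 0 T, ∀ l : LQ.Vec nd,
      -- the unperturbed and the perturbed solution exist and are unique
      (∃ z, LQ.IsOptimalTriple D T d d0 dT z ∧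
        ∀ z', LQ.IsOptimalTriple D T d d0 dT z' → z'.AgreeOn z (Icc 0 T)) ∧
      (∃ zp, LQ.IsPerturbedTriple D T d d0 dT t' l zp ∧
        ∀ z', LQ.IsPerturbedTriple D T d d0 dT t' l z' → z'.AgreeOn zp (Icc 0 T \ {t'})) ∧
      -- the perturbed solution is the limit of the optimal solutions for approximate point masses
      (∀ zp, LQ.IsPerturbedTriple D T d d0 dT t' l zp →
        ∀ φ : ℕ → ℝ → ℝ, LQ.ApproximatesDirac T t' φ →
        ∀ zn : ℕ → LQ.Trajectory nx nu,
          (∀ n, LQ.IsOptimalTriple D T (fun t => d t + φ n t • l) d0 dT (zn n)) →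
        ∀ t ∈ Icc 0 T, t ≠ t' →
          Tendsto (fun n => (zn n).x t) atTop (𝓝 (zp.x t)) ∧
          Tendsto (fun n => (zn n).u t) atTop (𝓝 (zp.u t)) ∧
          Tendsto (fun n => (zn n).lam t) atTop (𝓝 (zp.lam t))) ∧
      -- exponential decay of sensitivity
      ∀ z zp, LQ.IsOptimalTriple D T d d0 dT z → LQ.IsPerturbedTriple D T d d0 dT t' l zp →
        ∀ t ∈ Icc 0 T, t ≠ t' →
          ‖zp.x t - z.x t‖ + ‖zp.u t - z.u t‖ + ‖zp.lam t - z.lam t‖ ≤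
            ‖l‖ * k.Lambda * Real.exp (-k.rhoZ * |t - t'|) := by
  refine ⟨k.rhoZ_pos, k.Lambda_pos, fun nx nu nd T D h d d0 dT hd t' ht' l => ?_⟩
  have hdi := LQ.intervalIntegrable_of_memLp_two h.T_pos.le hd
  exact ⟨h.exists_unique_optimal hd d0 dT, h.exists_unique_perturbed hdi d0 dT ht' l,
    fun zp hzp φ hφ zn hzn t ht hne => h.tendsto_perturbed hdi ht' hzp hφ hzn ht hne,
    fun z zp hz hzp t ht hne => h.norm_perturbed_sub_le hdi ht' hz hzp ht hne⟩
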